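/- Setting. A player has a finite nonempty set $\mathcal A$ of $K$ actions; $\mathcal O$ is the set of joint actions of the opponents, $\mathcal Z$ the set of contexts, and $\mathcal D=\mathcal A\times\mathcal O\times\mathcal Z$. The reward $r:\mathcal D\to[0,1]$ lies in the reproducing kernel Hilbert space of a positive semidefinite kernel $k:\mathcal D\times\mathcal D\to[-1,1]$ and satisfies $\|r\|_k\le B$. Contexts $z_1,\dots,z_T$ are i.i.d. from a distribution $\zeta$ unknown to the player. In round $t$ the player sees $z_t$ and draws $a_t\sim p_t(z_t)$; the opponents choose $o_t\in\mathcal O$ as a function of the history of rounds $1,\dots,t-1$ (past player actions, contexts and noise), without seeing $z_t$; then the player observes $o_t$ and $\tilde r_t=r(a_t,o_t,z_t)+\epsilon_t$. The noises $\epsilon_1,\dots,\epsilon_T$ are independent, $\sigma$-sub-Gaussian ($\mathbb E\,e^{\alpha\epsilon_t}\le e^{\alpha^2\sigma^2/2}$ for all $\alpha\in\mathbb R$), and independent of the contexts and of the player's randomization. Algorithm (c.GP-MW). With $x_j=(a_j,o_j,z_j)$, $K_t=[k(x_i,x_j)]_{i,j\le t}$, $\mathbf k_t(x)=[k(x_j,x)]_{j\le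 t}$, $\mathbf y_t=[\tilde r_j]_{j\le t}$ and $\lambda>0$, let $$\mu_t(x)=\mathbf k_t(x)^{\top}(K_t+\lambda I)^{-1}\mathbf y_t,\quad \sigma_t^2(x)=k(x,x)-\mathbf k_t(x)^{\top}(K_t+\lambda I)^{-1}\mathbf k_t(x),\quad \mathrm{ucb}_t(x)=\min\{\mu_t(x)+\beta_t\sigma_t(x),1\},$$ and play according to $$p_t(z_t)[a]\propto\exp\Big(\eta_t\sum_{\tau=1}^{t-1}\mathrm{ucb}_\tau(a,o_\tau,z_t)\Big),\qquad a\in\mathcal A.$$ Let $\gamma_t=\sup_{x_1,\dots,x_t\in\mathcal D}\tfrac12\log\det(I+K_t/\lambda)$. Theorem. Let $\delta\in(0,1)$, $\lambda\ge1$, $T\ge 1$, $\beta_t=B+\sigma\lambda^{-1/2}\sqrt{2(\gamma_{t-1}+\log(1/\delta))}$ and $\eta_t=\sqrt{8\log K/T}$ for all $t$. Then, with probability at least $1-\delta$ over the noise $\epsilon_1,\dots,\epsilon_T$, $$\sup_{\pi:\mathcal Z\to\mathcal A}\mathbb E\Big[\sum_{t=1}^T r(\pi(z_t),o_t,z_t)-\sum_{t=1}^T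 r(a_t,o_t,z_t)\Big]\le\sqrt{0.5\,T\log K}+4\beta_T\sqrt{\gamma_T\lambda T},$$ where the expectation is over the contexts $z_1,\dots,z_T$ and the randomization of the algorithm, for the given realization of the noise. -/

import Mathlib

open MeasureTheory ProbabilityTheory
open scoped NNReal Matrix

noncomputable section

namespace CGPMW

/-! ### Kernel ridge regression on an abstract domain `X` -/

section Regression

variable {X : Type*}

/-- The scalar kernel `k(x, y)` of a real reproducing kernel Hilbert space `H` of functions on `X`
(the operator-valued kernel of Mathlib applied to `1 : ℝ`). -/
def scalarKernel (H : Type*) [NormedAddCommGroup H] [InnerProductSpace ℝ H] [CompleteSpace H]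
    [RKHS ℝ H X ℝ] (x y : X) : ℝ :=
  RKHS.kernel H x y 1

/-- The kernel matrix `[k(x_i, x_j)]` of finitely many points. -/
def gram (k : X → X → ℝ) {n : ℕ} (x : Fin n → X) : Matrix (Fin n) (Fin n) ℝ :=
  Matrix.of fun i j => k (x i) (x j)

/-- The maximum information gain `γ_n`: the supremum of `(1/2) log det (I + K / lam)` over all
choices of `n` points. -/
def infoGain (k : X → X → ℝ) (lam : ℝ) (n : ℕ) : ℝ :=
  ⨆ x : Fin n → X, (1 / 2 : ℝ) * Real.log (1 + lam⁻¹ • gram k x).det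

/-- The confidence parameter
`β_t = B + sg lam^{-1/2} √(2 (γ_{t-1} + log (1/δ)))`, used for `t ≥ 1`. -/
def confidence (k : X → X → ℝ) (lam B sg δ : ℝ) (t : ℕ) : ℝ :=
  B + sg / √lam * √(2 * (infoGain k lam (t - 1) + Real.log (1 / δ)))

/-- The posterior mean after the observations `d = ((x_1, y_1), …, (x_n, y_n))`. -/
def postMean (k : X → X → ℝ) (lam : ℝ) {n : ℕ} (d : Fin n → X × ℝ) (x : X) : ℝ :=
  (fun j => k (d j).1 x) ⬝ᵥ
    ((gram k (fun j => (d j).1) + lam • (1 : Matrix (Fin n) (Fin n) ℝ))⁻¹ *ᵥ fun j => (d j).2)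

/-- The posterior variance after the observations `d` (it depends only on the points). -/
def postVar (k : X → X → ℝ) (lam : ℝ) {n : ℕ} (d : Fin n → X × ℝ) (x : X) : ℝ :=
  k x x - (fun j => k (d j).1 x) ⬝ᵥ
    ((gram k (fun j => (d j).1) + lam • (1 : Matrix (Fin n) (Fin n) ℝ))⁻¹ *ᵥ
      fun j => k (d j).1 x)

/-- The upper confidence bound function `ucb_n = min {μ_n + β_n σ_n, 1}` built from the data `d`
of the first `n` rounds. -/
def ucb (k : X → X → ℝ) (lam : ℝ) (β : ℕ → ℝ) {n : ℕ} (d : Fin n → X × ℝ) (x : X) : ℝ :=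
  min (postMean k lam d x + β n * √(postVar k lam d x)) 1

end Regression

/-! ### The player's algorithm

`A` is the finite action set of the player, `O` the set of joint actions of the opponents and `Z`
the set of contexts. One observation is `((a, o, z), y)`: own action, opponents' action, context
and noisy reward. -/

section Algorithm

variable {A O Z : Type*}

/-- The exponent of the multiplicative weights rule after `n` rounds: the sum over the past rounds
`τ = 1, …, n` of `ucb_τ(a, o_τ, z)`, where `o_τ` is the opponents' action in round `τ`, `ucb_τ` is
built from the data of the rounds `1, …, τ`, and `z` is the current context. -/
def score (k : A × O × Z → A × O × Z → ℝ) (lam : ℝ) (β : ℕ → ℝ) {n : ℕ}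
    (d : Fin n → (A × O × Z) × ℝ) (z : Z) (a : A) : ℝ :=
  ∑ τ : Fin n, ucb k lam β (Fin.take (τ + 1) τ.isLt d) (a, (d τ).1.2.1, z)

/-- The probability with which the algorithm plays `a` in round `n + 1` when the context of this
round is `z` and the data of the first `n` rounds are `d`. -/
def playProb [Fintype A] (k : A × O × Z → A × O × Z → ℝ) (lam : ℝ) (β η : ℕ → ℝ) {n : ℕ}
    (d : Fin n → (A × O × Z) × ℝ) (z : Z) (a : A) : ℝ :=
  Real.exp (η (n + 1) * score k lam β d z a) / ∑ b, Real.exp (η (n + 1) * score k lam β d z b)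

end Algorithm

/-! ### The repeated game

A history of `n` rounds records in each round the player's action, the context and the observation
noise. A (deterministic, adaptive) opponent is a family of functions `f`, where `f n` maps a history
of `n` rounds to the opponents' action in round `n + 1`; it does not see the context of that
round. -/

section Game

variable {A O Z : Type*}

/-- The points `(a_t, o_t, z_t)`, `t = 1, …, n`, visited along a history. -/
def visited (f : ∀ n : ℕ, (Fin n → A × Z × ℝ) → O) {n : ℕ} (h : Fin n → A × Z × ℝ)
    (t : Fin n) : A × O × Z :=
  ((h t).1, f t (Fin.take t t.isLt.le h), (h t).2.1)

/-- What the player observes along a history: the visited points and the noisy rewards. -/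
def observed (r : A × O × Z → ℝ) (f : ∀ n : ℕ, (Fin n → A × Z × ℝ) → O) {n : ℕ}
    (h : Fin n → A × Z × ℝ) (t : Fin n) : (A × O × Z) × ℝ :=
  (visited f h t, r (visited f h t) + (h t).2.2)

/-- The history with actions `a`, contexts `z` and noise `e`. -/
def history {T : ℕ} (a : Fin T → A) (z : Fin T → Z) (e : Fin T → ℝ) (t : Fin T) : A × Z × ℝ :=
  (a t, z t, e t)

/-- The probability that the algorithm plays the actions `a` in the rounds `1, …, T`, when the
contexts are `z` and the noise is `e`: the product over `t` of the probability of playing `a_t` in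
context `z_t` given the data of the rounds before `t`. -/
def actionsProb [Fintype A] (k : A × O × Z → A × O × Z → ℝ) (lam : ℝ) (β η : ℕ → ℝ)
    (r : A × O × Z → ℝ) (f : ∀ n : ℕ, (Fin n → A × Z × ℝ) → O) {T : ℕ}
    (e : Fin T → ℝ) (z : Fin T → Z) (a : Fin T → A) : ℝ :=
  ∏ t : Fin T,
    playProb k lam β η (observed r f (Fin.take t t.isLt.le (history a z e))) (z t) (a t)

/-- The regret with respect to the policy `π` along a history. -/
def regret (r : A × O × Z → ℝ) (f : ∀ n : ℕ, (Fin n → A × Z × ℝ) → O) (π : Z → A) {T : ℕ}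
    (h : Fin T → A × Z × ℝ) : ℝ :=
  ∑ t, r (π (h t).2.1, (visited f h t).2) - ∑ t, r (visited f h t)

/-- The expectation of the regret over the randomization of the algorithm, given the contexts `z`
and the noise `e`. -/
def meanRegret [Fintype A] (k : A × O × Z → A × O × Z → ℝ) (lam : ℝ) (β η : ℕ → ℝ)
    (r : A × O × Z → ℝ) (f : ∀ n : ℕ, (Fin n → A × Z × ℝ) → O) (π : Z → A) {T : ℕ}
    (e : Fin T → ℝ) (z : Fin T → Z) : ℝ :=
  ∑ a : Fin T → A, actionsProb k lam β η r f e z a * regret r f π (history a z e)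

end Game

end CGPMW

end

/-! The usual argument works on the event that all confidence bounds hold. That event depends on
actions and contexts as well as on the noise. Here the good event may involve the noise only, and
the expectation then also runs over trajectories on which some bounds fail. The proof never asks the
bounds to hold; it controls the expected cost of their failure.

Let N be the energy of the noise divided by σ (`noiseEnergy`) and D = det(I + K/λ) (`infoDet`).
Gaussian mixing makes M = exp(N/2)/√D (`mixture`) a supermartingale. Each noise term is independent
of the past and of the context and action of its round, so the average of M over contexts and
actions, given the noise, is still a supermartingale along the noise
(`lintegral_mixture_update_le`). Ville's inequality (`ville`) yields an event of probability at
least 1-δ on which these averages are at most 1/δ in all rounds (`exists_noise_event`).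

On this event E = δM has mean at most 1. Put θ = σ/√λ and let v be the posterior variance. The
posterior mean errs by at most (B + θ√N)√v (`abs_sub_postMean_le`). Failure of optimism: after n+1
observations `ucb` falls below the reward by at most θ(√N - b)₊√v with b² = 2(γ_n + log(1/δ)), and
(√N - b)₊√v is at most E times a coefficient of order √(λ/n) (`posPart_mul_sqrt_designVar_le`). The
design may carry information γ_{n+1}, while b contains only γ_n. An exchange argument closes this
gap: if y keeps a large variance, trading a few design points for copies of y gives n points, whose
information is at most γ_n. Excess of optimism: `ucb` exceeds the reward by at most (2B + θb +
θ√N)√v, now with b² = 2(γ_{T-1} + log(1/δ)), and N ≤ b² + 2(E - 1), so that N is at most b² in the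
mean (`ucb_sub_le`).

The opponents do not see the current context, so in the expected regret the contexts of all rounds
may be replaced by one fresh context z (`integral_regret`). For fixed z the algorithm is exponential
weights for the rewards `ucb`(·, o, z), with regret at most √(0.5 T log K)
(`sum_le_sum_expWeights`). The variances at the fresh points have the same mean as those at the
visited points, whose sum is at most (2/log 2)λγ_T (`sum_designVar_take_le`).

Altogether the regret beyond the exponential weights term is at most 2β_T√((2/log 2)λγ_T T) plus a
failure cost of order θ√(λT). Since 2√(2/log 2) < 3.4, the constant 4 absorbs the failure cost once
γ_T ≥ 3. For smaller γ_T the estimate is interpolated with the trivial bound r ≤ B√k(x,x), where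
k(x,x) ≤ λ(exp(2γ_T) - 1)/T (`regret_numerics`). -/

noncomputable section

namespace CGPMW

/-! ### A variational bound for the inverse of a positive definite matrix -/

section Matrices

variable {ι : Type*} [Fintype ι] [DecidableEq ι]

/-- Expand the nonnegative quadratic form of `M` at `w - M⁻¹e`. The variational formula for the
posterior variance and the recursion of the noise energy both rest on this. -/
theorem PosDef.two_mul_dotProduct_sub_le {M : Matrix ι ι ℝ} (hM : M.PosDef) (w e : ι → ℝ) :
    2 * (w ⬝ᵥ e) - w ⬝ᵥ (M *ᵥ w) ≤ e ⬝ᵥ (M⁻¹ *ᵥ e) := by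
  have hdet : IsUnit M.det := hM.det_pos.ne'.isUnit
  have hs : Mᵀ = M := by simpa [Matrix.IsSymm] using hM.1
  have h := hM.posSemidef.dotProduct_mulVec_nonneg (w - M⁻¹ *ᵥ e)
  have h1 : M *ᵥ (M⁻¹ *ᵥ e) = e := by
    rw [Matrix.mulVec_mulVec, Matrix.mul_nonsing_inv _ hdet, Matrix.one_mulVec]
  have h2 : (M⁻¹ *ᵥ e) ⬝ᵥ (M *ᵥ w) = w ⬝ᵥ e := by
    rw [Matrix.dotProduct_mulVec, ← Matrix.mulVec_transpose, hs, h1, dotProduct_comm]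
  simp only [star_trivial, Matrix.mulVec_sub, h1, sub_dotProduct, dotProduct_sub, h2] at h
  rw [dotProduct_comm (M⁻¹ *ᵥ e) e] at h
  linarith

end Matrices

/-! ### Posterior variance and information of a design -/

section Design

variable {X : Type*}

/-- The regularized kernel matrix `K + lam I` of a design. -/
def ridge (k : X → X → ℝ) (lam : ℝ) {n : ℕ} (x : Fin n → X) : Matrix (Fin n) (Fin n) ℝ :=
  gram k x + lam • (1 : Matrix (Fin n) (Fin n) ℝ)

/-- The vector of kernel values between a design and a point. -/
def kerVec (k : X → X → ℝ) {n : ℕ} (x : Fin n → X) (y : X) : Fin n → ℝ := fun j => k (x j) y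

/-- The posterior variance of a design at a point. -/
def designVar (k : X → X → ℝ) (lam : ℝ) {n : ℕ} (x : Fin n → X) (y : X) : ℝ :=
  k y y - kerVec k x y ⬝ᵥ ((ridge k lam x)⁻¹ *ᵥ kerVec k x y)

/-- The determinant `det (I + K / lam)` of a design. -/
def infoDet (k : X → X → ℝ) (lam : ℝ) {n : ℕ} (x : Fin n → X) : ℝ :=
  (1 + lam⁻¹ • gram k x).det

/-- The posterior mean of pure noise. -/
def noiseMean (k : X → X → ℝ) (lam : ℝ) {n : ℕ} (x : Fin n → X) (e : Fin n → ℝ) (y : X) : ℝ :=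
  kerVec k x y ⬝ᵥ ((ridge k lam x)⁻¹ *ᵥ e)

/-- The self-normalized energy `eᵀ K (K + lam I)⁻¹ e` of the noise `e`. -/
def noiseEnergy (k : X → X → ℝ) (lam : ℝ) {n : ℕ} (x : Fin n → X) (e : Fin n → ℝ) : ℝ :=
  e ⬝ᵥ e - lam * (e ⬝ᵥ ((ridge k lam x)⁻¹ *ᵥ e))

theorem postVar_eq_designVar (k : X → X → ℝ) (lam : ℝ) {n : ℕ} (d : Fin n → X × ℝ) (y : X) :
    postVar k lam d y = designVar k lam (fun j => (d j).1) y := rfl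

variable {H : Type*} [NormedAddCommGroup H] [InnerProductSpace ℝ H]
  {φ : X → H} {k : X → X → ℝ} {lam : ℝ}

theorem dotProduct_gram_mulVec (hk : ∀ x y, k x y = inner ℝ (φ x) (φ y)) {n : ℕ} (x : Fin n → X)
    (w : Fin n → ℝ) : w ⬝ᵥ (gram k x *ᵥ w) = ‖∑ j, w j • φ (x j)‖ ^ 2 := by
  rw [← real_inner_self_eq_norm_sq]
  simp only [dotProduct, Matrix.mulVec, gram, Matrix.of_apply, sum_inner, inner_sum,
    real_inner_smul_left, real_inner_smul_right, hk, Finset.mul_sum]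
  refine Finset.sum_congr rfl fun i _ => Finset.sum_congr rfl fun j _ => ?_
  rw [real_inner_comm]
  ring

theorem dotProduct_ridge_mulVec (hk : ∀ x y, k x y = inner ℝ (φ x) (φ y)) {n : ℕ} (x : Fin n → X)
    (w : Fin n → ℝ) :
    w ⬝ᵥ (ridge k lam x *ᵥ w) = ‖∑ j, w j • φ (x j)‖ ^ 2 + lam * (w ⬝ᵥ w) := by
  rw [ridge, Matrix.add_mulVec, dotProduct_add, dotProduct_gram_mulVec hk, Matrix.smul_mulVec,
    Matrix.one_mulVec, dotProduct_smul, smul_eq_mul]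

theorem ridge_posDef (hk : ∀ x y, k x y = inner ℝ (φ x) (φ y)) (hlam : 0 < lam) {n : ℕ}
    (x : Fin n → X) : (ridge k lam x).PosDef := by
  refine Matrix.PosDef.of_dotProduct_mulVec_pos ?_ fun w hw => ?_
  · ext i j
    simp only [ridge, gram, Matrix.conjTranspose_apply, Matrix.add_apply, Matrix.of_apply,
      Matrix.smul_apply, Matrix.one_apply, star_trivial, hk]
    rw [real_inner_comm]
    simp [eq_comm]
  · rw [star_trivial, dotProduct_ridge_mulVec hk]
    have : 0 < w ⬝ᵥ w := by simpa using Matrix.dotProduct_star_self_pos_iff.2 hw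
    positivity

theorem ridge_transpose (hk : ∀ x y, k x y = inner ℝ (φ x) (φ y)) (hlam : 0 < lam) {n : ℕ}
    (x : Fin n → X) : (ridge k lam x)ᵀ = ridge k lam x := by
  simpa [Matrix.IsSymm] using (ridge_posDef hk hlam x).1

theorem ridge_mulVec_inv (hk : ∀ x y, k x y = inner ℝ (φ x) (φ y)) (hlam : 0 < lam) {n : ℕ}
    (x : Fin n → X) (w : Fin n → ℝ) : ridge k lam x *ᵥ ((ridge k lam x)⁻¹ *ᵥ w) = w := by
  rw [Matrix.mulVec_mulVec, Matrix.mul_nonsing_inv _ (ridge_posDef hk hlam x).det_pos.ne'.isUnit,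
    Matrix.one_mulVec]

/-- The bilinear form of the inverse is symmetric. -/
theorem dotProduct_ridge_inv_comm (hk : ∀ x y, k x y = inner ℝ (φ x) (φ y)) (hlam : 0 < lam)
    {n : ℕ} (x : Fin n → X) (v w : Fin n → ℝ) :
    v ⬝ᵥ ((ridge k lam x)⁻¹ *ᵥ w) = w ⬝ᵥ ((ridge k lam x)⁻¹ *ᵥ v) := by
  rw [Matrix.dotProduct_mulVec, ← Matrix.mulVec_transpose, Matrix.transpose_nonsing_inv,
    ridge_transpose hk hlam, dotProduct_comm]

theorem norm_sub_sum_sq (hk : ∀ x y, k x y = inner ℝ (φ x) (φ y)) {n : ℕ} (x : Fin n → X)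
    (y : X) (w : Fin n → ℝ) :
    ‖φ y - ∑ j, w j • φ (x j)‖ ^ 2 + lam * (w ⬝ᵥ w) =
      k y y - 2 * (w ⬝ᵥ kerVec k x y) + w ⬝ᵥ (ridge k lam x *ᵥ w) := by
  rw [dotProduct_ridge_mulVec hk, norm_sub_sq_real, hk y y, real_inner_self_eq_norm_sq]
  have : inner ℝ (φ y) (∑ j, w j • φ (x j)) = w ⬝ᵥ kerVec k x y := by
    simp only [dotProduct, kerVec, inner_sum, real_inner_smul_right, hk]
    exact Finset.sum_congr rfl fun j _ => by rw [real_inner_comm]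
  rw [this]; ring

/-- The posterior variance is the minimum of the ridge functional over the weights `w`, attained in
`designVar_eq`. Comparisons of variances thus reduce to the choice of a competitor `w`. -/
theorem designVar_le (hk : ∀ x y, k x y = inner ℝ (φ x) (φ y)) (hlam : 0 < lam) {n : ℕ}
    (x : Fin n → X) (y : X) (w : Fin n → ℝ) :
    designVar k lam x y ≤ ‖φ y - ∑ j, w j • φ (x j)‖ ^ 2 + lam * (w ⬝ᵥ w) := by
  have := PosDef.two_mul_dotProduct_sub_le (ridge_posDef hk hlam x) w (kerVec k x y)
  rw [norm_sub_sum_sq hk, designVar]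
  linarith

theorem designVar_eq (hk : ∀ x y, k x y = inner ℝ (φ x) (φ y)) (hlam : 0 < lam) {n : ℕ}
    (x : Fin n → X) (y : X) :
    designVar k lam x y =
      ‖φ y - ∑ j, ((ridge k lam x)⁻¹ *ᵥ kerVec k x y) j • φ (x j)‖ ^ 2 +
        lam * (((ridge k lam x)⁻¹ *ᵥ kerVec k x y) ⬝ᵥ ((ridge k lam x)⁻¹ *ᵥ kerVec k x y)) := by
  rw [norm_sub_sum_sq hk, designVar, ridge_mulVec_inv hk hlam,
    dotProduct_comm (kerVec k x y)]
  ring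

theorem designVar_nonneg (hk : ∀ x y, k x y = inner ℝ (φ x) (φ y)) (hlam : 0 < lam) {n : ℕ}
    (x : Fin n → X) (y : X) : 0 ≤ designVar k lam x y := by
  rw [designVar_eq hk hlam]
  have : 0 ≤ ((ridge k lam x)⁻¹ *ᵥ kerVec k x y) ⬝ᵥ ((ridge k lam x)⁻¹ *ᵥ kerVec k x y) :=
    Finset.sum_nonneg fun j _ => mul_self_nonneg _
  positivity

theorem designVar_le_self (hk : ∀ x y, k x y = inner ℝ (φ x) (φ y)) (hlam : 0 < lam) {n : ℕ}
    (x : Fin n → X) (y : X) : designVar k lam x y ≤ k y y := by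
  refine (designVar_le hk hlam x y 0).trans ?_
  simp [hk y y]

/-- Extension by zero turns weights on a subdesign into competing weights on the whole design. -/
theorem sum_extend {m n : ℕ} {g : Fin m → Fin n} (hg : Function.Injective g) (w : Fin m → ℝ)
    {E : Type*} [AddCommMonoid E] (F : ℝ → Fin n → E) (hF : ∀ j, F 0 j = 0) :
    ∑ j, F (Function.extend g w 0 j) j = ∑ i, F (w i) (g i) := by
  rw [← Finset.sum_subset (Finset.subset_univ (Finset.univ.image g)),
    Finset.sum_image hg.injOn]
  · exact Finset.sum_congr rfl fun i _ => by rw [hg.extend_apply]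
  · intro j _ hj
    rw [Function.extend_apply', Pi.zero_apply, hF]
    rintro ⟨i, rfl⟩
    exact hj (Finset.mem_image_of_mem _ (Finset.mem_univ _))

/-- Deleting points from a design increases the posterior variance. -/
theorem designVar_anti (hk : ∀ x y, k x y = inner ℝ (φ x) (φ y)) (hlam : 0 < lam) {m n : ℕ}
    (x : Fin n → X) (g : Fin m → Fin n) (hg : Function.Injective g) (y : X) :
    designVar k lam x y ≤ designVar k lam (x ∘ g) y := by
  rw [designVar_eq hk hlam (x ∘ g)]
  set w := (ridge k lam (x ∘ g))⁻¹ *ᵥ kerVec k (x ∘ g) y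
  refine (designVar_le hk hlam x y (Function.extend g w 0)).trans (le_of_eq ?_)
  have h1 := sum_extend hg w (fun c j => c • φ (x j)) (by simp)
  have h2 := sum_extend hg w (fun c _ => c * c) (by simp)
  simp only [dotProduct, Function.comp_apply]
  rw [h1, h2]

theorem infoDet_eq (hlam : 0 < lam) {n : ℕ} (x : Fin n → X) :
    infoDet k lam x = lam⁻¹ ^ n * (ridge k lam x).det := by
  have : 1 + lam⁻¹ • gram k x = lam⁻¹ • ridge k lam x := by
    rw [ridge, smul_add, smul_smul, inv_mul_cancel₀ hlam.ne', one_smul, add_comm]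
  rw [infoDet, this, Matrix.det_smul, Fintype.card_fin]

/-- Move row and column `i` to the end. The Schur complement of the remaining block is the posterior
variance at `x i` plus `lam`. -/
theorem det_ridge_removeNth (hk : ∀ x y, k x y = inner ℝ (φ x) (φ y)) (hlam : 0 < lam) {n : ℕ}
    (x : Fin (n + 1) → X) (i : Fin (n + 1)) :
    (ridge k lam x).det = (ridge k lam (i.removeNth x)).det *
      (designVar k lam (i.removeNth x) (x i) + lam) := by
  set A := ridge k lam (i.removeNth x)
  have hA : IsUnit A.det := (ridge_posDef hk hlam _).det_pos.ne'.isUnit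
  let _ := A.invertibleOfIsUnitDet hA
  let q := kerVec k (i.removeNth x) (x i)
  have hb : (ridge k lam x).submatrix
      ((Equiv.optionEquivSumPUnit.{0} (Fin n)).symm.trans (finSuccEquiv' i).symm)
      ((Equiv.optionEquivSumPUnit.{0} (Fin n)).symm.trans (finSuccEquiv' i).symm) =
      Matrix.fromBlocks A (Matrix.replicateCol Unit q) (Matrix.replicateRow Unit q)
        (Matrix.of fun _ _ => k (x i) (x i) + lam) := by
    ext (a | a) (b | b)
    · simp [A, ridge, gram, Fin.removeNth, Matrix.one_apply]
    · simp [ridge, gram, q, kerVec, Fin.removeNth, Fin.succAbove_ne]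
    · simp [ridge, gram, q, kerVec, Fin.removeNth, Fin.ne_succAbove]
      rw [hk, hk, real_inner_comm]
    · simp [ridge, gram]
  rw [← Matrix.det_submatrix_equiv_self
    ((Equiv.optionEquivSumPUnit.{0} (Fin n)).symm.trans (finSuccEquiv' i).symm), hb,
    Matrix.det_fromBlocks₁₁]
  congr 1
  rw [Matrix.det_unique]
  simp only [Matrix.sub_apply, Matrix.of_apply, designVar, Matrix.invOf_eq_nonsing_inv]
  have : (Matrix.replicateRow Unit q * A⁻¹ * Matrix.replicateCol Unit q) default default
      = q ⬝ᵥ (A⁻¹ *ᵥ q) := by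
    rw [Matrix.mul_assoc, Matrix.mul_apply]
    rfl
  rw [this]
  ring

theorem infoDet_removeNth (hk : ∀ x y, k x y = inner ℝ (φ x) (φ y)) (hlam : 0 < lam) {n : ℕ}
    (x : Fin (n + 1) → X) (i : Fin (n + 1)) :
    infoDet k lam x = infoDet k lam (i.removeNth x) *
      (1 + designVar k lam (i.removeNth x) (x i) / lam) := by
  rw [infoDet_eq hlam, infoDet_eq hlam, det_ridge_removeNth hk hlam x i]
  rw [pow_succ]
  field_simp
  ring

theorem infoDet_snoc (hk : ∀ x y, k x y = inner ℝ (φ x) (φ y)) (hlam : 0 < lam) {n : ℕ}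
    (x : Fin n → X) (y : X) :
    infoDet k lam (Fin.snoc x y : Fin (n + 1) → X) =
      infoDet k lam x * (1 + designVar k lam x y / lam) := by
  have h : (Fin.last n).removeNth (Fin.snoc x y : Fin (n + 1) → X) = x := by
    ext j; simp [Fin.removeNth]
  have := infoDet_removeNth hk hlam (Fin.snoc x y : Fin (n + 1) → X) (Fin.last n)
  rwa [h, Fin.snoc_last] at this

theorem infoDet_zero (x : Fin 0 → X) : infoDet k lam x = 1 := by
  simp [infoDet]

theorem one_le_infoDet (hk : ∀ x y, k x y = inner ℝ (φ x) (φ y)) (hlam : 0 < lam) {n : ℕ}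
    (x : Fin n → X) : 1 ≤ infoDet k lam x := by
  induction n with
  | zero => rw [infoDet_zero]
  | succ n ih =>
    rw [infoDet_removeNth hk hlam x (Fin.last n)]
    have := designVar_nonneg hk hlam ((Fin.last n).removeNth x) (x (Fin.last n))
    have h2 : 1 ≤ 1 + designVar k lam ((Fin.last n).removeNth x) (x (Fin.last n)) / lam := by
      have : 0 ≤ designVar k lam ((Fin.last n).removeNth x) (x (Fin.last n)) / lam := by positivity
      linarith
    nlinarith [ih ((Fin.last n).removeNth x)]

theorem infoDet_le (hk : ∀ x y, k x y = inner ℝ (φ x) (φ y)) (hlam : 0 < lam)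
    (hk1 : ∀ x, k x x ≤ 1) {n : ℕ} (x : Fin n → X) :
    infoDet k lam x ≤ (1 + lam⁻¹) ^ n := by
  induction n with
  | zero => simp [infoDet_zero]
  | succ n ih =>
    rw [infoDet_removeNth hk hlam x (Fin.last n), pow_succ]
    have h := (designVar_le_self hk hlam ((Fin.last n).removeNth x) (x (Fin.last n))).trans (hk1 _)
    have h0 := designVar_nonneg hk hlam ((Fin.last n).removeNth x) (x (Fin.last n))
    have h2 : designVar k lam ((Fin.last n).removeNth x) (x (Fin.last n)) / lam ≤ lam⁻¹ := by
      rw [div_eq_mul_inv]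
      exact mul_le_of_le_one_left (by positivity) h
    have := ih ((Fin.last n).removeNth x)
    gcongr

end Design

/-! ### Exchange of design points, and the energy of the noise -/

section Design

variable {X : Type*} {H : Type*} [NormedAddCommGroup H] [InnerProductSpace ℝ H]
  {φ : X → H} {k : X → X → ℝ} {lam : ℝ}

theorem one_le_one_add_designVar_div (hk : ∀ x y, k x y = inner ℝ (φ x) (φ y)) (hlam : 0 < lam)
    {n : ℕ} (x : Fin n → X) (y : X) : 1 ≤ 1 + designVar k lam x y / lam := by
  have := div_nonneg (designVar_nonneg hk hlam x y) hlam.le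
  linarith

/-- Chain rule for the information: each point contributes conditionally on its predecessors. -/
theorem log_infoDet_eq_sum (hk : ∀ x y, k x y = inner ℝ (φ x) (φ y)) (hlam : 0 < lam) {n : ℕ}
    (x : Fin n → X) :
    Real.log (infoDet k lam x) =
      ∑ i : Fin n, Real.log (1 + designVar k lam (Fin.take i i.isLt.le x) (x i) / lam) := by
  induction n with
  | zero => simp [infoDet_zero]
  | succ n ih =>
    rw [infoDet_removeNth hk hlam x (Fin.last n), Real.log_mul, ih, Fin.sum_univ_castSucc]
    · congr 1
      · refine Finset.sum_congr rfl fun i _ => ?_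
        have : (Fin.last n).removeNth x i = x i.castSucc := by simp [Fin.removeNth]
        rw [this]
        congr 4
        ext j
        simp [Fin.removeNth, Fin.take]
      · congr 4
        ext j
        simp [Fin.removeNth, Fin.take]
        rfl
    · exact (zero_lt_one.trans_le (one_le_infoDet hk hlam _)).ne'
    · exact (zero_lt_one.trans_le (one_le_one_add_designVar_div hk hlam _ _)).ne'

/-- Some point can be deleted from a design at an at most average loss of information. -/
theorem exists_removeNth_log_infoDet (hk : ∀ x y, k x y = inner ℝ (φ x) (φ y)) (hlam : 0 < lam)
    {n : ℕ} (x : Fin (n + 1) → X) :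
    ∃ i : Fin (n + 1), (n : ℝ) * Real.log (infoDet k lam x) ≤
      (n + 1) * Real.log (infoDet k lam (i.removeNth x)) := by
  -- Han's inequality. The loss from deleting point `i` is its information given all other points,
  -- hence at most its information given its predecessors. The latter sum to the total, so not every
  -- loss can exceed the average.
  by_contra! hc
  have h1 : ∀ i : Fin (n + 1), Real.log (infoDet k lam x) -
      Real.log (infoDet k lam (i.removeNth x)) ≤
      Real.log (1 + designVar k lam (Fin.take i i.isLt.le x) (x i) / lam) := by
    intro i
    have hp := one_le_one_add_designVar_div hk hlam (i.removeNth x) (x i)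
    have hq := one_le_infoDet hk hlam (i.removeNth x)
    rw [infoDet_removeNth hk hlam x i, Real.log_mul (by linarith) (by linarith),
      add_sub_cancel_left]
    refine Real.log_le_log (by linarith) ?_
    have hi : (i : ℕ) ≤ n := Nat.lt_succ_iff.1 i.isLt
    have : Fin.take i i.isLt.le x = i.removeNth x ∘ Fin.castLE hi := by
      ext j
      simp only [Fin.take, Fin.removeNth, Function.comp_apply]
      congr 1
      rw [Fin.succAbove_of_castSucc_lt _ _ (by rw [Fin.lt_def]; exact j.isLt)]
      rfl
    rw [this]
    have := designVar_anti hk hlam (i.removeNth x) (Fin.castLE hi) (Fin.castLE_injective hi) (x i)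
    gcongr
  have h2 := Finset.sum_le_sum fun i (_ : i ∈ Finset.univ) => h1 i
  rw [← log_infoDet_eq_sum hk hlam, Finset.sum_sub_distrib] at h2
  have h3 := Finset.sum_lt_sum_of_nonempty Finset.univ_nonempty
    fun i (_ : i ∈ Finset.univ) => hc i
  rw [← Finset.mul_sum] at h3
  simp only [Finset.sum_const, Finset.card_univ, Fintype.card_fin, nsmul_eq_mul] at h2 h3
  push_cast at h2 h3
  have hn : (0 : ℝ) < n + 1 := by positivity
  nlinarith

/-- A design contains subdesigns of every smaller size that keep a proportional part of its
information. -/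
theorem exists_subdesign (hk : ∀ x y, k x y = inner ℝ (φ x) (φ y)) (hlam : 0 < lam) {m n : ℕ}
    (hmn : m ≤ n) (x : Fin n → X) :
    ∃ x' : Fin m → X, (m : ℝ) * Real.log (infoDet k lam x) ≤ n * Real.log (infoDet k lam x') ∧
      ∀ y, designVar k lam x y ≤ designVar k lam x' y := by
  induction n, hmn using Nat.le_induction with
  | base => exact ⟨x, le_rfl, fun y => le_rfl⟩
  | succ n hmn ih =>
    obtain ⟨i, hi⟩ := exists_removeNth_log_infoDet hk hlam x
    obtain ⟨x', h1, h2⟩ := ih (i.removeNth x)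
    refine ⟨x', ?_, fun y => (designVar_anti hk hlam x i.succAbove i.succAbove_right_injective
      y).trans (h2 y)⟩
    rcases Nat.eq_zero_or_pos n with rfl | hn
    · obtain rfl : m = 0 := by omega
      have : 0 ≤ Real.log (infoDet k lam x') := Real.log_nonneg (one_le_infoDet hk hlam _)
      simpa using this
    · have hn' : (0 : ℝ) < n := by exact_mod_cast hn
      have hm : (0 : ℝ) ≤ m := by positivity
      push_cast
      have h3 := mul_le_mul_of_nonneg_left hi hm
      have h4 := mul_le_mul_of_nonneg_left h1 (by positivity : (0 : ℝ) ≤ n + 1)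
      refine le_of_mul_le_mul_left ?_ hn'
      nlinarith

/-- Observing a point once more shrinks its posterior variance by no more than the noise allows. -/
theorem le_designVar_snoc_self (hk : ∀ x y, k x y = inner ℝ (φ x) (φ y)) (hlam : 0 < lam) {n : ℕ}
    (x : Fin n → X) (y : X) :
    designVar k lam x y * lam ≤
      designVar k lam (Fin.snoc x y : Fin (n + 1) → X) y * (designVar k lam x y + lam) := by
  set s := designVar k lam x y with hs
  have hs0 : 0 ≤ s := designVar_nonneg hk hlam x y
  rw [designVar_eq hk hlam (Fin.snoc x y : Fin (n + 1) → X)]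
  set w := (ridge k lam (Fin.snoc x y : Fin (n + 1) → X))⁻¹ *ᵥ
    kerVec k (Fin.snoc x y : Fin (n + 1) → X) y
  rw [Fin.sum_univ_castSucc, dotProduct, Fin.sum_univ_castSucc]
  simp only [Fin.snoc_castSucc, Fin.snoc_last]
  set c := w (Fin.last n)
  set u : Fin n → ℝ := fun j => w j.castSucc
  -- The weight `c` on the new copy leaves the target `(1 - c) • φ y`. Rescaling the other weights
  -- by `(1 - c)⁻¹` gives a competitor for the old design.
  have key : (1 - c) ^ 2 * s ≤ ‖φ y - (∑ j, u j • φ (x j) + c • φ y)‖ ^ 2 +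
      lam * (u ⬝ᵥ u) := by
    have hu : 0 ≤ u ⬝ᵥ u := Finset.sum_nonneg fun j _ => mul_self_nonneg _
    by_cases hc : 1 - c = 0
    · rw [hc]; simp only [ne_eq, OfNat.ofNat_ne_zero, not_false_eq_true, zero_pow, zero_mul]
      positivity
    · have h := designVar_le hk hlam x y ((1 - c)⁻¹ • u)
      have h1 : φ y - (∑ j, u j • φ (x j) + c • φ y) =
          (1 - c) • (φ y - ∑ j, ((1 - c)⁻¹ • u) j • φ (x j)) := by
        have h2 : (1 - c) • ∑ j, ((1 - c)⁻¹ • u) j • φ (x j) = ∑ j, u j • φ (x j) := by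
          rw [Finset.smul_sum]
          refine Finset.sum_congr rfl fun j _ => ?_
          rw [Pi.smul_apply, smul_eq_mul, smul_smul, mul_inv_cancel_left₀ hc]
        rw [smul_sub, h2, sub_smul, one_smul]
        abel
      have h2 : u ⬝ᵥ u = (1 - c) ^ 2 * (((1 - c)⁻¹ • u) ⬝ᵥ ((1 - c)⁻¹ • u)) := by
        rw [smul_dotProduct, dotProduct_smul, smul_eq_mul, smul_eq_mul]
        field_simp
      rw [h1, norm_smul, mul_pow, Real.norm_eq_abs, sq_abs, h2]
      have := mul_le_mul_of_nonneg_left h (sq_nonneg (1 - c))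
      linarith
  have key' : (1 - c) ^ 2 * s + lam * (c * c) ≤
      ‖φ y - (∑ j, u j • φ (x j) + c • φ y)‖ ^ 2 + lam * (u ⬝ᵥ u + c * c) := by linarith
  refine le_trans ?_ (mul_le_mul_of_nonneg_right key' (by positivity))
  -- The two sides differ by exactly this square.
  nlinarith [sq_nonneg ((1 - c) * s - lam * c)]

/-- Appending `j` copies of a point `y` to a design. -/
theorem exists_append_copies (hk : ∀ x y, k x y = inner ℝ (φ x) (φ y)) (hlam : 0 < lam) {n : ℕ}
    (x : Fin n → X) (y : X) (j : ℕ) :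
    ∃ x' : Fin (n + j) → X,
      infoDet k lam x * (1 + j * (designVar k lam x y / lam)) ≤ infoDet k lam x' ∧
      designVar k lam x y * lam ≤
        designVar k lam x' y * (lam + j * designVar k lam x y) := by
  induction j with
  | zero => exact ⟨x, by simp, by simp⟩
  | succ j ih =>
    obtain ⟨x', h1, h2⟩ := ih
    refine ⟨(Fin.snoc x' y : Fin (n + j + 1) → X), ?_, ?_⟩
    · rw [infoDet_snoc hk hlam]
      have hs0 := designVar_nonneg hk hlam x y
      have hv0 := designVar_nonneg hk hlam x' y
      have hD := one_le_infoDet hk hlam x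
      set s := designVar k lam x y
      set v := designVar k lam x' y
      -- The second invariant gives v ≥ sλ/(λ + js), so 1 + v/λ ≥ (λ + (j+1)s)/(λ + js), and these
      -- factors telescope.
      have h3 : 1 + ((j + 1 : ℕ) : ℝ) * (s / lam) ≤ (1 + j * (s / lam)) * (1 + v / lam) := by
        have e1 : (1 + j * (s / lam)) * (1 + v / lam) =
          1 + j * (s / lam) + (v * (lam + j * s)) / lam ^ 2 := by field_simp
        have e2 : s / lam = s * lam / lam ^ 2 := by field_simp
        rw [e1]
        push_cast
        have : s * lam / lam ^ 2 ≤ (v * (lam + j * s)) / lam ^ 2 := by gcongr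
        rw [← e2] at this
        linarith
      calc _ ≤ infoDet k lam x * ((1 + j * (s / lam)) * (1 + v / lam)) := by gcongr
        _ = infoDet k lam x * (1 + j * (s / lam)) * (1 + v / lam) := by ring
        _ ≤ _ := by gcongr
    · have h3 := le_designVar_snoc_self hk hlam x' y
      have hs0 := designVar_nonneg hk hlam x y
      have hv0 := designVar_nonneg hk hlam x' y
      have hw0 := designVar_nonneg hk hlam (Fin.snoc x' y : Fin (n + j + 1) → X) y
      set s := designVar k lam x y
      set v := designVar k lam x' y
      set w := designVar k lam (Fin.snoc x' y : Fin (n + j + 1) → X) y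
      push_cast
      rcases hs0.eq_or_lt with hs | hs
      · rw [← hs]; simp only [zero_mul, mul_zero, add_zero]; positivity
      have hj : (0 : ℝ) ≤ j := by positivity
      have hq : 0 < lam + j * s := by positivity
      have hv : 0 < v := by
        by_contra hv
        have : v = 0 := by linarith
        rw [this] at h2
        nlinarith [mul_pos hs hlam]
      refine le_of_mul_le_mul_left ?_ hv
      calc v * (s * lam) = s * (v * lam) := by ring
        _ ≤ s * (w * (v + lam)) := by gcongr
        _ = w * (s * v + s * lam) := by ring
        _ ≤ w * (s * v + v * (lam + j * s)) := by gcongr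
        _ = _ := by ring

theorem designVar_zero (x : Fin 0 → X) (y : X) : designVar k lam x y = k y y := by
  simp [designVar]

/-- With p = (K + λI)⁻¹e the energy equals |Kp|² + λ pᵀKp. -/
theorem noiseEnergy_nonneg (hk : ∀ x y, k x y = inner ℝ (φ x) (φ y)) (hlam : 0 < lam) {n : ℕ}
    (x : Fin n → X) (e : Fin n → ℝ) : 0 ≤ noiseEnergy k lam x e := by
  set p := (ridge k lam x)⁻¹ *ᵥ e with hp
  have he : e = gram k x *ᵥ p + lam • p := by
    rw [← ridge_mulVec_inv hk hlam x e, ← hp, ridge, Matrix.add_mulVec, Matrix.smul_mulVec,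
      Matrix.one_mulVec]
  have h1 : noiseEnergy k lam x e =
      (gram k x *ᵥ p) ⬝ᵥ (gram k x *ᵥ p) + lam * (p ⬝ᵥ (gram k x *ᵥ p)) := by
    rw [noiseEnergy, ← hp]
    nth_rewrite 1 2 3 [he]
    simp only [dotProduct_add, add_dotProduct, smul_dotProduct, dotProduct_smul, smul_eq_mul]
    rw [dotProduct_comm (gram k x *ᵥ p) p]
    ring
  rw [h1, dotProduct_gram_mulVec hk]
  have : 0 ≤ (gram k x *ᵥ p) ⬝ᵥ (gram k x *ᵥ p) := Finset.sum_nonneg fun j _ => mul_self_nonneg _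
  positivity

theorem dotProduct_snoc {n : ℕ} (u v : Fin n → ℝ) (a b : ℝ) :
    (Fin.snoc u a : Fin (n + 1) → ℝ) ⬝ᵥ (Fin.snoc v b : Fin (n + 1) → ℝ) = u ⬝ᵥ v + a * b := by
  simp [dotProduct, Fin.sum_univ_castSucc]

theorem dotProduct_ridge_snoc (hk : ∀ x y, k x y = inner ℝ (φ x) (φ y)) {n : ℕ}
    (x : Fin n → X) (y : X) (w : Fin n → ℝ) (c : ℝ) :
    (Fin.snoc w c : Fin (n + 1) → ℝ) ⬝ᵥ
        (ridge k lam (Fin.snoc x y : Fin (n + 1) → X) *ᵥ (Fin.snoc w c : Fin (n + 1) → ℝ)) =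
      w ⬝ᵥ (ridge k lam x *ᵥ w) + 2 * c * (w ⬝ᵥ kerVec k x y) + c ^ 2 * (k y y + lam) := by
  rw [dotProduct_ridge_mulVec hk, dotProduct_ridge_mulVec hk, dotProduct_snoc,
    Fin.sum_univ_castSucc]
  simp only [Fin.snoc_castSucc, Fin.snoc_last]
  have : inner ℝ (∑ j, w j • φ (x j)) (φ y) = w ⬝ᵥ kerVec k x y := by
    simp only [dotProduct, kerVec, sum_inner, real_inner_smul_left, hk]
  rw [norm_add_sq_real, real_inner_smul_right, this, norm_smul, mul_pow, hk y y,
    real_inner_self_eq_norm_sq, Real.norm_eq_abs, sq_abs]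
  ring

/-- The recursive bound on the self-normalized noise energy. -/
theorem noiseEnergy_snoc_le (hk : ∀ x y, k x y = inner ℝ (φ x) (φ y)) (hlam : 0 < lam) {n : ℕ}
    (x : Fin n → X) (e : Fin n → ℝ) (y : X) (a : ℝ) :
    noiseEnergy k lam (Fin.snoc x y : Fin (n + 1) → X) (Fin.snoc e a : Fin (n + 1) → ℝ) ≤
      noiseEnergy k lam x e +
        (a ^ 2 - (a - noiseMean k lam x e y) ^ 2 / (1 + designVar k lam x y / lam)) := by
  set m := noiseMean k lam x e y with hm
  set v := designVar k lam x y with hv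
  have hv0 : 0 ≤ v := designVar_nonneg hk hlam x y
  set p := (ridge k lam x)⁻¹ *ᵥ e with hp
  set q := (ridge k lam x)⁻¹ *ᵥ kerVec k x y with hq
  -- `c` is the normalized innovation of the new noise value; `(p - c • q, c)` is the solution of
  -- the enlarged ridge system found by block elimination. Inserted in the variational bound, it
  -- avoids inverting the block matrix.
  set c := (a - m) / (v + lam) with hc
  have h := PosDef.two_mul_dotProduct_sub_le
    (ridge_posDef hk hlam (Fin.snoc x y : Fin (n + 1) → X))
    (Fin.snoc (p - c • q) c : Fin (n + 1) → ℝ) (Fin.snoc e a : Fin (n + 1) → ℝ)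
  rw [dotProduct_ridge_snoc hk, dotProduct_snoc] at h
  have hRp : ridge k lam x *ᵥ p = e := ridge_mulVec_inv hk hlam x e
  have hRq : ridge k lam x *ᵥ q = kerVec k x y := ridge_mulVec_inv hk hlam x _
  have e1 : p ⬝ᵥ e = e ⬝ᵥ p := dotProduct_comm _ _
  have e2 : q ⬝ᵥ e = m := by
    rw [dotProduct_comm, hq, dotProduct_ridge_inv_comm hk hlam, hm, noiseMean]
  have e3 : p ⬝ᵥ kerVec k x y = m := by rw [dotProduct_comm, hm, noiseMean]
  have e4 : q ⬝ᵥ kerVec k x y = k y y - v := by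
    rw [dotProduct_comm, hv, designVar]; ring
  rw [Matrix.mulVec_sub, Matrix.mulVec_smul, hRp, hRq] at h
  simp only [sub_dotProduct, dotProduct_sub, smul_dotProduct, dotProduct_smul, smul_eq_mul,
    e1, e2, e3, e4] at h
  have hvl : v + lam ≠ 0 := by positivity
  have e5 : lam * ((a - m) ^ 2 / (v + lam)) = (a - m) ^ 2 / (1 + v / lam) := by
    field_simp; ring
  have e6 : 2 * c * (a - m) - c ^ 2 * (v + lam) = (a - m) ^ 2 / (v + lam) := by
    rw [hc]; field_simp; ring
  rw [noiseEnergy, noiseEnergy, dotProduct_snoc, ← e5, ← hp]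
  have h' : e ⬝ᵥ p + (a - m) ^ 2 / (v + lam) ≤ (Fin.snoc e a : Fin (n + 1) → ℝ) ⬝ᵥ
      ((ridge k lam (Fin.snoc x y : Fin (n + 1) → X))⁻¹ *ᵥ (Fin.snoc e a : Fin (n + 1) → ℝ)) := by
    rw [← e6]; linarith
  have := mul_le_mul_of_nonneg_left h' hlam.le
  linarith

/-- Append `y` as a fictitious observation with noise `a`. The energy stays nonnegative for every
`a`, so the recursion yields a nonnegative polynomial in `a` of degree at most two, and suitable
values of `a` give the bound. -/
theorem noiseMean_sq_le (hk : ∀ x y, k x y = inner ℝ (φ x) (φ y)) (hlam : 0 < lam) {n : ℕ}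
    (x : Fin n → X) (e : Fin n → ℝ) (y : X) :
    noiseMean k lam x e y ^ 2 ≤ designVar k lam x y / lam * noiseEnergy k lam x e := by
  have hN := noiseEnergy_nonneg hk hlam x e
  have hs : 0 ≤ designVar k lam x y / lam := div_nonneg (designVar_nonneg hk hlam x y) hlam.le
  have h : ∀ a : ℝ, 0 ≤ noiseEnergy k lam x e +
      (a ^ 2 - (a - noiseMean k lam x e y) ^ 2 / (1 + designVar k lam x y / lam)) := fun a =>
    (noiseEnergy_nonneg hk hlam _ _).trans (noiseEnergy_snoc_le hk hlam x e y a)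
  set m := noiseMean k lam x e y
  set s := designVar k lam x y / lam
  set N := noiseEnergy k lam x e
  have h' : ∀ a : ℝ, 0 ≤ N * (1 + s) + (a ^ 2 * s + 2 * a * m - m ^ 2) := by
    intro a
    have h1 := mul_nonneg (h a) (by positivity : 0 ≤ 1 + s)
    have h2 : (N + (a ^ 2 - (a - m) ^ 2 / (1 + s))) * (1 + s) =
      N * (1 + s) + (a ^ 2 * s + 2 * a * m - m ^ 2) := by field_simp; ring
    linarith
  -- For s = 0 the polynomial is affine and `a` is chosen with 2am = -(N+1), which makes it negative
  -- unless m = 0. For s > 0 the minimizer a = -m/s is used.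
  rcases hs.eq_or_lt with hs0 | hs0
  · rw [← hs0] at h' ⊢
    have h1 := h' (-(N + 1) / (2 * m))
    by_contra hm
    have hm' : m ≠ 0 := by rintro h0; simp [h0] at hm
    have : 2 * (-(N + 1) / (2 * m)) * m = -(N + 1) := by field_simp
    nlinarith [sq_nonneg m]
  · have h1 := h' (-m / s)
    have e1 : (-m / s) ^ 2 * s + 2 * (-m / s) * m - m ^ 2 = -(m ^ 2 / s) * (1 + s) := by
      field_simp; ring
    rw [e1] at h1
    have h2 : m ^ 2 / s ≤ N := by
      have : 0 ≤ (N - m ^ 2 / s) * (1 + s) := by linarith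
      have := nonneg_of_mul_nonneg_left this (by positivity)
      linarith
    rw [div_le_iff₀ hs0] at h2
    linarith

theorem noiseMean_smul (c : ℝ) {n : ℕ} (x : Fin n → X) (e : Fin n → ℝ) (y : X) :
    noiseMean k lam x (c • e) y = c * noiseMean k lam x e y := by
  simp [noiseMean, Matrix.mulVec_smul]

end Design

/-! ### Growth of the maximum information gain -/

section Information

variable {X : Type*} {H : Type*} [NormedAddCommGroup H] [InnerProductSpace ℝ H]
  {φ : X → H} {k : X → X → ℝ} {lam : ℝ}

theorem log_infoDet_le (hk : ∀ x y, k x y = inner ℝ (φ x) (φ y)) (hlam : 1 ≤ lam)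
    (hk1 : ∀ x, k x x ≤ 1) {n : ℕ} (x : Fin n → X) :
    Real.log (infoDet k lam x) ≤ n * Real.log 2 := by
  have h0 : 0 < lam := by linarith
  rw [← Real.log_pow]
  refine Real.log_le_log (zero_lt_one.trans_le (one_le_infoDet hk h0 x))
    ((infoDet_le hk h0 hk1 x).trans ?_)
  have := inv_le_one_of_one_le₀ hlam
  gcongr
  linarith

/-- The gain is a real supremum, which dominates its terms only once they are known to be bounded;
the bound n log 2 supplies this. -/
theorem log_infoDet_le_infoGain (hk : ∀ x y, k x y = inner ℝ (φ x) (φ y)) (hlam : 1 ≤ lam)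
    (hk1 : ∀ x, k x x ≤ 1) {n : ℕ} (x : Fin n → X) :
    Real.log (infoDet k lam x) ≤ 2 * infoGain k lam n := by
  have hb : BddAbove (Set.range fun x : Fin n → X =>
      (1 / 2 : ℝ) * Real.log (1 + lam⁻¹ • gram k x).det) := by
    refine ⟨(1 / 2) * (n * Real.log 2), ?_⟩
    rintro _ ⟨x, rfl⟩
    exact mul_le_mul_of_nonneg_left (log_infoDet_le hk hlam hk1 x) (by norm_num)
  have := le_ciSup hb x
  change 1 / 2 * Real.log (infoDet k lam x) ≤ infoGain k lam n at this
  linarith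

theorem infoGain_le_of_forall [Nonempty X] {n : ℕ} {c : ℝ}
    (h : ∀ x : Fin n → X, Real.log (infoDet k lam x) ≤ 2 * c) : infoGain k lam n ≤ c := by
  refine ciSup_le fun x => ?_
  have := h x
  rw [infoDet] at this
  linarith

theorem infoGain_nonneg [Nonempty X] (hk : ∀ x y, k x y = inner ℝ (φ x) (φ y)) (hlam : 1 ≤ lam)
    (hk1 : ∀ x, k x x ≤ 1) (n : ℕ) : 0 ≤ infoGain k lam n := by
  obtain ⟨y⟩ := ‹Nonempty X›
  have := log_infoDet_le_infoGain hk hlam hk1 fun _ : Fin n => y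
  have := Real.log_nonneg (one_le_infoDet hk (zero_lt_one.trans_le hlam) fun _ : Fin n => y)
  linarith

theorem infoGain_le [Nonempty X] (hk : ∀ x y, k x y = inner ℝ (φ x) (φ y)) (hlam : 1 ≤ lam)
    (hk1 : ∀ x, k x x ≤ 1) (n : ℕ) : 2 * infoGain k lam n ≤ n * Real.log 2 := by
  have : infoGain k lam n ≤ n * Real.log 2 / 2 := infoGain_le_of_forall fun x =>
    (log_infoDet_le hk hlam hk1 x).trans (by linarith)
  linarith

/-- γ_n/n does not increase, since a well chosen subdesign keeps its proportional share. This
compares γ_{T-1}, which occurs in β_T, with γ_T. -/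
theorem mul_infoGain_le [Nonempty X] (hk : ∀ x y, k x y = inner ℝ (φ x) (φ y)) (hlam : 1 ≤ lam)
    (hk1 : ∀ x, k x x ≤ 1) {m n : ℕ} (hm : 0 < m) (hmn : m ≤ n) :
    m * infoGain k lam n ≤ n * infoGain k lam m := by
  have hm' : (0 : ℝ) < m := by exact_mod_cast hm
  have hn' : (0 : ℝ) < n := by exact_mod_cast hm.trans_le hmn
  have : infoGain k lam n ≤ n * infoGain k lam m / m := by
    refine infoGain_le_of_forall fun x => ?_
    obtain ⟨x', h, -⟩ := exists_subdesign hk (by linarith) hmn x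
    have h1 := log_infoDet_le_infoGain hk hlam hk1 x'
    have h2 : Real.log (infoDet k lam x) ≤ n * (2 * infoGain k lam m) / m := by
      rw [le_div_iff₀ hm', mul_comm]
      exact h.trans (by gcongr)
    calc _ ≤ _ := h2
      _ = _ := by ring
  rw [le_div_iff₀ hm'] at this
  linarith

theorem infoGain_mono [Nonempty X] (hk : ∀ x y, k x y = inner ℝ (φ x) (φ y)) (hlam : 1 ≤ lam)
    (hk1 : ∀ x, k x x ≤ 1) : Monotone (infoGain k lam) := by
  refine monotone_nat_of_le_succ fun n => infoGain_le_of_forall fun x => ?_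
  obtain ⟨y⟩ := ‹Nonempty X›
  have h0 : 0 < lam := by linarith
  refine le_trans ?_ (log_infoDet_le_infoGain hk hlam hk1 (Fin.snoc x y : Fin (n + 1) → X))
  refine Real.log_le_log (zero_lt_one.trans_le (one_le_infoDet hk h0 x)) ?_
  rw [infoDet_snoc hk h0]
  exact le_mul_of_one_le_right (zero_le_one.trans (one_le_infoDet hk h0 x))
    (one_le_one_add_designVar_div hk h0 x y)

/-- A design of `n` copies of `y` has determinant at least 1 + n k(y,y)/λ. A small information gain
therefore forces a small kernel, and with it small rewards. -/
theorem mul_kernel_le (hk : ∀ x y, k x y = inner ℝ (φ x) (φ y)) (hlam : 1 ≤ lam)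
    (hk1 : ∀ x, k x x ≤ 1) (n : ℕ) (y : X) :
    n * k y y ≤ lam * (Real.exp (2 * infoGain k lam n) - 1) := by
  have h0 : 0 < lam := by linarith
  obtain ⟨x', h1, -⟩ := exists_append_copies hk h0 (Fin.elim0 : Fin 0 → X) y n
  rw [infoDet_zero, one_mul, designVar_zero] at h1
  have h2 := log_infoDet_le_infoGain hk hlam hk1 x'
  rw [Real.log_le_iff_le_exp (zero_lt_one.trans_le (one_le_infoDet hk h0 x'))] at h2
  have h3 := h1.trans h2
  rw [zero_add] at h3
  have : n * (k y y / lam) ≤ Real.exp (2 * infoGain k lam n) - 1 := by linarith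
  have := mul_le_mul_of_nonneg_left this h0.le
  calc _ = lam * (n * (k y y / lam)) := by field_simp
    _ ≤ _ := this

theorem mul_log_two_le_log_one_add {s : ℝ} (h0 : 0 ≤ s) (h1 : s ≤ 1) :
    s * Real.log 2 ≤ Real.log (1 + s) := by
  have := strictConcaveOn_log_Ioi.concaveOn.2 (x := 1) (y := 2) (by simp) (by simp)
    (sub_nonneg.2 h1) h0 (by ring)
  simp only [smul_eq_mul, Real.log_one, mul_zero, zero_add] at this
  calc _ ≤ _ := this
    _ = _ := by congr 1; ring

/-- Each variance divided by λ lies in [0,1], where s ≤ log(1+s)/log 2 by concavity; the logarithms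
add up by the chain rule. -/
theorem sum_designVar_take_le (hk : ∀ x y, k x y = inner ℝ (φ x) (φ y)) (hlam : 1 ≤ lam)
    (hk1 : ∀ x, k x x ≤ 1) {n : ℕ} (x : Fin n → X) :
    ∑ i : Fin n, designVar k lam (Fin.take i i.isLt.le x) (x i) ≤
      2 / Real.log 2 * (lam * infoGain k lam n) := by
  have h0 : 0 < lam := by linarith
  have hl : 0 < Real.log 2 := Real.log_pos (by norm_num)
  have h1 : ∀ i : Fin n, designVar k lam (Fin.take i i.isLt.le x) (x i) ≤ lam / Real.log 2 *
      Real.log (1 + designVar k lam (Fin.take i i.isLt.le x) (x i) / lam) := by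
    intro i
    have h2 := designVar_nonneg hk h0 (Fin.take i i.isLt.le x) (x i)
    have h3 := (designVar_le_self hk h0 (Fin.take i i.isLt.le x) (x i)).trans (hk1 _)
    have := mul_log_two_le_log_one_add (div_nonneg h2 h0.le)
      ((div_le_one h0).2 (h3.trans hlam))
    calc _ = lam / Real.log 2 * (designVar k lam (Fin.take i i.isLt.le x) (x i) / lam *
        Real.log 2) := by field_simp
      _ ≤ _ := by gcongr
  refine (Finset.sum_le_sum fun i _ => h1 i).trans ?_
  rw [← Finset.mul_sum, ← log_infoDet_eq_sum hk h0]
  calc _ ≤ lam / Real.log 2 * (2 * infoGain k lam n) := by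
        gcongr; exact log_infoDet_le_infoGain hk hlam hk1 x
    _ = _ := by ring

end Information

/-! ### The price of failed optimism -/

section Coefficient

variable {X : Type*} {H : Type*} [NormedAddCommGroup H] [InnerProductSpace ℝ H]
  {φ : X → H} {k : X → X → ℝ} {lam : ℝ}

/-- A design of `n + 1` points can be traded for one of `n` points, `j` of which are copies of
`y`. -/
theorem log_infoDet_add_log_le (hk : ∀ x y, k x y = inner ℝ (φ x) (φ y)) (hlam : 1 ≤ lam)
    (hk1 : ∀ x, k x x ≤ 1) {n j : ℕ} (hj : j ≤ n) (x : Fin (n + 1) → X) (y : X) :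
    Real.log (infoDet k lam x) + Real.log (1 + j * (designVar k lam x y / lam)) ≤
      2 * infoGain k lam n + (j + 1) / (n + 1) * Real.log (infoDet k lam x) := by
  have h0 : 0 < lam := by linarith
  -- Deleting `j + 1` points keeps the share 1 - (j+1)/(n+1) of the information and does not lower
  -- the variance at `y`, so the `j` copies of `y` add at least log(1 + jv/λ).
  obtain ⟨x', h1, h2⟩ := exists_subdesign hk h0 (by omega : n - j ≤ n + 1) x
  obtain ⟨x'', h3, -⟩ := exists_append_copies hk h0 x' y j
  have hx'' : Real.log (infoDet k lam x'') ≤ 2 * infoGain k lam n := by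
    have := log_infoDet_le_infoGain hk hlam hk1 x''
    have e : n - j + j = n := Nat.sub_add_cancel hj
    calc _ ≤ _ := this
      _ = _ := by rw [e]
  have hv := designVar_nonneg hk h0 x y
  have hD := one_le_infoDet hk h0 x'
  have hp : 0 < 1 + j * (designVar k lam x y / lam) := by positivity
  have hle : 1 + j * (designVar k lam x y / lam) ≤ 1 + j * (designVar k lam x' y / lam) := by
    have := h2 y
    gcongr
  have h4 : Real.log (infoDet k lam x') + Real.log (1 + j * (designVar k lam x y / lam)) ≤
      2 * infoGain k lam n := by
    rw [← Real.log_mul (by linarith) hp.ne']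
    refine le_trans (Real.log_le_log (by positivity) ?_) hx''
    exact le_trans (by gcongr) h3
  rw [Nat.cast_sub hj] at h1
  push_cast at h1
  have hn : (0 : ℝ) < n + 1 := by positivity
  have h5 : Real.log (infoDet k lam x) - (j + 1) / (n + 1) * Real.log (infoDet k lam x) ≤
      Real.log (infoDet k lam x') := by
    have : Real.log (infoDet k lam x) - (j + 1) / (n + 1) * Real.log (infoDet k lam x) =
      (n - j) * Real.log (infoDet k lam x) / (n + 1) := by field_simp; ring
    rw [this, div_le_iff₀ hn]
    linarith
  linarith

/-- The excess of L/2 = (log D)/2 over γ_n is paid by the variance: the exchange lowers the exponent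
by log(1 + jv/λ)/2, which outweighs √v ≤ √(λ/j)·√(1 + jv/λ). -/
theorem exp_mul_sqrt_designVar_le (hk : ∀ x y, k x y = inner ℝ (φ x) (φ y)) (hlam : 1 ≤ lam)
    (hk1 : ∀ x, k x x ≤ 1) {n j : ℕ} (hj : j ≤ n) (hj0 : 0 < j) (x : Fin (n + 1) → X) (y : X) :
    Real.exp (Real.log (infoDet k lam x) / 2 - infoGain k lam n) * √(designVar k lam x y) ≤
      Real.exp ((j + 1) / (n + 1) * infoGain k lam (n + 1)) * √(lam / j) := by
  have h0 : 0 < lam := by linarith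
  have h := log_infoDet_add_log_le hk hlam hk1 hj x y
  have hL := log_infoDet_le_infoGain hk hlam hk1 x
  have hv := designVar_nonneg hk h0 x y
  set v := designVar k lam x y
  have hj' : (0 : ℝ) < j := by exact_mod_cast hj0
  have hp : 0 < 1 + j * (v / lam) := by positivity
  have h1 : Real.log (infoDet k lam x) / 2 - infoGain k lam n ≤
      (j + 1) / (n + 1) * infoGain k lam (n + 1) - Real.log (1 + j * (v / lam)) / 2 := by
    have : (j + 1 : ℝ) / (n + 1) * Real.log (infoDet k lam x) ≤
        (j + 1) / (n + 1) * (2 * infoGain k lam (n + 1)) := by gcongr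
    linarith
  have h2 : √v ≤ √(lam / j) * √(1 + j * (v / lam)) := by
    rw [← Real.sqrt_mul (by positivity)]
    refine Real.sqrt_le_sqrt ?_
    have : lam / j * (1 + j * (v / lam)) = lam / j + v := by field_simp
    rw [this]
    have : 0 ≤ lam / j := by positivity
    linarith
  have h3 : Real.exp (Real.log (1 + j * (v / lam)) / 2) = √(1 + j * (v / lam)) := by
    rw [Real.exp_half, Real.exp_log hp]
  have h4 : 0 < √(1 + j * (v / lam)) := Real.sqrt_pos.2 hp
  calc _ ≤ Real.exp ((j + 1) / (n + 1) * infoGain k lam (n + 1) -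
        Real.log (1 + j * (v / lam)) / 2) * (√(lam / j) * √(1 + j * (v / lam))) := by gcongr
    _ = _ := by rw [Real.exp_sub, h3]; field_simp

/-- For u = x - b ≥ 0 one has x² - b² ≥ u², and u ≤ (u² + 1)/2 ≤ exp((u² - 1)/2). -/
theorem posPart_sub_le_exp (x b : ℝ) (hb : 0 ≤ b) :
    max (x - b) 0 ≤ Real.exp (-1 / 2) * Real.exp ((x ^ 2 - b ^ 2) / 2) := by
  rw [← Real.exp_add]
  refine max_le ?_ (Real.exp_pos _).le
  rcases le_or_gt x b with h | h
  · exact (sub_nonpos.2 h).trans (Real.exp_pos _).le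
  set u := x - b with hu
  have h1 := Real.add_one_le_exp ((u ^ 2 - 1) / 2)
  have h2 : Real.exp ((u ^ 2 - 1) / 2) ≤ Real.exp (-1 / 2 + (x ^ 2 - b ^ 2) / 2) := by
    rw [Real.exp_le_exp]
    have : x = u + b := by rw [hu]; ring
    rw [this]
    nlinarith [mul_nonneg (sub_pos.2 h).le hb]
  nlinarith [sq_nonneg (u - 1)]

/-- Here x² - b² ≥ 2ub and ub ≤ exp(ub - 1) are used. The gain 1/b matters when the information gain
is large. -/
theorem posPart_sub_le_exp_div (x b : ℝ) (hb : 0 < b) :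
    max (x - b) 0 ≤ Real.exp (-1) / b * Real.exp ((x ^ 2 - b ^ 2) / 2) := by
  refine max_le ?_ (by positivity)
  rcases le_or_gt x b with h | h
  · exact (sub_nonpos.2 h).trans (by positivity)
  set u := x - b with hu
  have h1 := Real.add_one_le_exp (u * b - 1)
  have h2 : Real.exp (u * b - 1) ≤ Real.exp (-1 + (x ^ 2 - b ^ 2) / 2) := by
    rw [Real.exp_le_exp]
    have : x = u + b := by rw [hu]; ring
    rw [this]
    nlinarith [sq_nonneg u]
  rw [div_mul_eq_mul_div, ← Real.exp_add, le_div_iff₀ hb]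
  linarith

theorem exp_half_log_two : Real.exp (Real.log 2 / 2) = √2 := by
  rw [Real.exp_half, Real.exp_log (by norm_num)]

/-- The coefficient bounding the failure of optimism after `n + 1` observations. -/
def failCoef (lam : ℝ) (n : ℕ) : ℝ :=
  if n = 0 then √2 * Real.exp (-1 / 2) else 2 * Real.exp (-1 / 2) * √(lam / n)

theorem failCoef_nonneg (lam : ℝ) (n : ℕ) : 0 ≤ failCoef lam n := by
  unfold failCoef
  split_ifs <;> positivity

theorem one_div_sqrt_le {n : ℝ} (h1 : 1 ≤ n) : 1 / √n ≤ 2 * (√n - √(n - 1)) := by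
  have hs : 0 < √n := Real.sqrt_pos.2 (by linarith)
  rw [div_le_iff₀ hs]
  have e1 := Real.sq_sqrt (by linarith : (0 : ℝ) ≤ n)
  have e2 := Real.sq_sqrt (by linarith : (0 : ℝ) ≤ n - 1)
  nlinarith [sq_nonneg (√n - √(n - 1))]

theorem sum_failCoef_le {lam : ℝ} (hlam : 1 ≤ lam) (T : ℕ) :
    ∑ n ∈ Finset.range T, failCoef lam n ≤ 4 * Real.exp (-1 / 2) * √(lam * (T + 1)) := by
  have hl : 1 ≤ √lam := Real.one_le_sqrt.2 hlam
  have hE := Real.exp_pos (-1 / 2)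
  have hs2 : √2 ≤ 2 := by
    rw [Real.sqrt_le_left (by norm_num)]; norm_num
  have h2 : ∀ T : ℕ,
      failCoef lam (T + 1) = 2 * Real.exp (-1 / 2) * √lam * (1 / √((T : ℝ) + 1)) := by
    intro T
    rw [failCoef, if_neg (Nat.succ_ne_zero T), Real.sqrt_div (by linarith)]
    push_cast
    ring
  have key : ∀ T : ℕ, ∑ n ∈ Finset.range (T + 2), failCoef lam n ≤
      4 * Real.exp (-1 / 2) * √lam * √((T : ℝ) + 1) := by
    intro T
    induction T with
    | zero =>
      rw [Finset.sum_range_succ, Finset.sum_range_one, h2]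
      simp only [failCoef, CharP.cast_eq_zero, zero_add, Real.sqrt_one, if_true]
      nlinarith
    | succ T ih =>
      rw [Finset.sum_range_succ, h2]
      have h1 := one_div_sqrt_le (n := ((T + 1 : ℕ) : ℝ) + 1) (by
        have : (0 : ℝ) ≤ ((T + 1 : ℕ) : ℝ) := by positivity
        linarith)
      have h4 : ((T + 1 : ℕ) : ℝ) + 1 - 1 = T + 1 := by push_cast; ring
      rw [h4] at h1
      have h3 : 2 * Real.exp (-1 / 2) * √lam * (1 / √(((T + 1 : ℕ) : ℝ) + 1)) ≤
          2 * Real.exp (-1 / 2) * √lam * (2 * (√(((T + 1 : ℕ) : ℝ) + 1) - √((T : ℝ) + 1))) := by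
        gcongr
      linarith
  rw [Real.sqrt_mul (by linarith)]
  rcases T with _ | _ | T
  · simp; positivity
  · simp only [zero_add, Finset.sum_range_one, failCoef, if_true, Nat.cast_one]
    have : 1 ≤ √((1 : ℝ) + 1) := Real.one_le_sqrt.2 (by norm_num)
    have h3 : 1 ≤ √lam * √((1 : ℝ) + 1) := by nlinarith
    calc √2 * Real.exp (-1 / 2) ≤ 4 * Real.exp (-1 / 2) * 1 := by nlinarith
      _ ≤ _ := by gcongr
  · refine (key T).trans ?_
    rw [mul_assoc (4 * Real.exp (-1 / 2))]
    gcongr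
    linarith

/-- The expected failure of optimism: the positive part of `x - b`, weighted by the posterior
standard deviation, in terms of the mixture martingale. -/
theorem posPart_mul_sqrt_designVar_le [Nonempty X] (hk : ∀ x y, k x y = inner ℝ (φ x) (φ y))
    (hlam : 1 ≤ lam) (hk1 : ∀ x, k x x ≤ 1) {n : ℕ} (x : Fin (n + 1) → X) (y : X) {l : ℝ}
    (hl : 0 ≤ l) (u : ℝ) :
    max (u - √(2 * (infoGain k lam n + l))) 0 * √(designVar k lam x y) ≤
      failCoef lam n * Real.exp (u ^ 2 / 2 - Real.log (infoDet k lam x) / 2 - l) := by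
  have h0 : 0 < lam := by linarith
  have hg : ∀ n, 0 ≤ infoGain k lam n := infoGain_nonneg hk hlam hk1
  have hv := designVar_nonneg hk h0 x y
  set b := √(2 * (infoGain k lam n + l)) with hb
  have hb2 : b ^ 2 = 2 * (infoGain k lam n + l) := Real.sq_sqrt (by have := hg n; positivity)
  set L := Real.log (infoDet k lam x) with hL
  have hexp : Real.exp ((u ^ 2 - b ^ 2) / 2) =
      Real.exp (u ^ 2 / 2 - L / 2 - l) * Real.exp (L / 2 - infoGain k lam n) := by
    rw [← Real.exp_add, hb2]; congr 1; ring
  -- The weight exp(L/2 - γ_n) separates off the mixture; `C` is the constant of one of the two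
  -- bounds on the positive part.
  suffices h : ∃ C, max (u - b) 0 ≤ C * Real.exp ((u ^ 2 - b ^ 2) / 2) ∧ 0 ≤ C ∧
      C * (Real.exp (L / 2 - infoGain k lam n) * √(designVar k lam x y)) ≤ failCoef lam n by
    obtain ⟨C, h1, h2, h3⟩ := h
    rw [hexp] at h1
    calc _ ≤ C * (Real.exp (u ^ 2 / 2 - L / 2 - l) * Real.exp (L / 2 - infoGain k lam n)) *
          √(designVar k lam x y) := by gcongr
      _ = C * (Real.exp (L / 2 - infoGain k lam n) * √(designVar k lam x y)) *
          Real.exp (u ^ 2 / 2 - L / 2 - l) := by ring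
      _ ≤ _ := by gcongr
  -- With a single observation no exchange is possible, but L ≤ log 2 and v ≤ 1.
  rcases Nat.eq_zero_or_pos n with rfl | hn
  · refine ⟨_, posPart_sub_le_exp u b (Real.sqrt_nonneg _), (Real.exp_pos _).le, ?_⟩
    have hL2 : L ≤ Real.log 2 := by simpa using log_infoDet_le hk hlam hk1 x
    have h1 : Real.exp (L / 2 - infoGain k lam 0) ≤ √2 := by
      rw [← exp_half_log_two, Real.exp_le_exp]
      have := hg 0
      linarith
    have h2 : √(designVar k lam x y) ≤ 1 := by
      rw [Real.sqrt_le_left zero_le_one, one_pow]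
      exact (designVar_le_self hk h0 x y).trans (hk1 y)
    rw [failCoef, if_pos rfl, mul_comm]
    have h3 := Real.sqrt_nonneg (designVar k lam x y)
    gcongr
    calc _ ≤ √2 * 1 := by gcongr
      _ = _ := mul_one _
  have hn' : (0 : ℝ) < n := by exact_mod_cast hn
  rw [failCoef, if_neg hn.ne']
  set g := infoGain k lam (n + 1) with hgdef
  have hg2 : 2 * g ≤ (n + 1) * Real.log 2 := by
    have := infoGain_le hk hlam hk1 (n + 1)
    push_cast at this
    exact this
  -- With little information all points can be traded, j = n, at the price exp(g) ≤ exp(1/2) ≤ 2.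
  rcases le_or_gt g (1 / 2) with hg1 | hg1
  · refine ⟨_, posPart_sub_le_exp u b (Real.sqrt_nonneg _), (Real.exp_pos _).le, ?_⟩
    have h1 := exp_mul_sqrt_designVar_le hk hlam hk1 le_rfl hn x y
    rw [div_self (by positivity), one_mul] at h1
    have h2 : Real.exp (infoGain k lam (n + 1)) ≤ 2 := by
      have := Real.exp_one_lt_d9
      have h3 : Real.exp (1 / 2) ≤ 2 := by
        rw [Real.exp_half, Real.sqrt_le_left (by norm_num)]; linarith
      exact (Real.exp_le_exp.2 hg1).trans h3
    calc _ ≤ Real.exp (-1 / 2) * (Real.exp (infoGain k lam (n + 1)) * √(lam / n)) := by gcongr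
      _ ≤ Real.exp (-1 / 2) * (2 * √(lam / n)) := by gcongr
      _ = _ := by ring
  · have hmul := mul_infoGain_le hk hlam hk1 hn (Nat.le_succ n)
    push_cast at hmul
    rw [← hgdef] at hmul
    have hgn : 0 < infoGain k lam n := by
      have : 0 < (n : ℝ) * g := by positivity
      by_contra hc
      have : infoGain k lam n = 0 := le_antisymm (not_lt.1 hc) (hg n)
      rw [this] at hmul
      linarith
    have hbpos : 0 < b := Real.sqrt_pos.2 (by linarith)
    refine ⟨_, posPart_sub_le_exp_div u b hbpos, by positivity, ?_⟩
    -- With j = ⌊q⌋ the exchange costs (j+1)g/(n+1) ≤ 1/2 + (log 2)/2 in the exponent. Moreover q <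
    -- j + 1 ≤ 2j gives λ/j ≤ 4gλ/(n+1), and the factor √g cancels against 1/b. The constants
    -- multiply to e⁻¹·e^{1/2}·√2·√2 = 2e^{-1/2}.
    set q : ℝ := (n + 1) / (2 * g) with hq
    have hq1 : 1 ≤ q := by
      rw [hq, le_div_iff₀ (by linarith)]
      have : Real.log 2 ≤ 1 := by linarith [Real.log_two_lt_d9]
      nlinarith
    have hqn : q < n + 1 := by
      rw [hq, div_lt_iff₀ (by linarith)]
      nlinarith
    set j := ⌊q⌋₊ with hj
    have hj1 : 1 ≤ j := Nat.one_le_floor_iff _ |>.2 hq1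
    have hjq : (j : ℝ) ≤ q := Nat.floor_le (by linarith)
    have hjn : j ≤ n := by
      have : (j : ℝ) < n + 1 := by linarith
      exact_mod_cast Nat.lt_succ_iff.1 (by exact_mod_cast this)
    have hqj : q < j + 1 := Nat.lt_floor_add_one q
    have hj1' : (1 : ℝ) ≤ j := by exact_mod_cast hj1
    have h1 := exp_mul_sqrt_designVar_le hk hlam hk1 hjn hj1 x y
    have hexp2 : Real.exp ((j + 1) / (n + 1) * infoGain k lam (n + 1)) ≤
        Real.exp (1 / 2) * √2 := by
      rw [← exp_half_log_two, ← Real.exp_add,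
        Real.exp_le_exp, ← hgdef]
      have e1 : (j : ℝ) * (2 * g) ≤ n + 1 := by
        rw [hq, le_div_iff₀ (by linarith)] at hjq
        exact hjq
      rw [div_mul_eq_mul_div, div_le_iff₀ (by positivity)]
      nlinarith
    have hb3 : √(2 * g * (n / (n + 1))) ≤ b := by
      refine Real.sqrt_le_sqrt ?_
      have : g * (n / (n + 1)) ≤ infoGain k lam n := by
        rw [← mul_div_assoc, div_le_iff₀ (by positivity)]
        linarith
      linarith
    have hlamj : √(lam / j) ≤ √(2 * (2 * g * (n / (n + 1)))) * √(lam / n) := by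
      rw [← Real.sqrt_mul (by positivity)]
      refine Real.sqrt_le_sqrt ?_
      have e1 : 2 * (2 * g * (n / (n + 1))) * (lam / n) = lam * (2 / q) := by
        rw [hq]; field_simp
      rw [e1, div_eq_mul_inv, ← one_div]
      gcongr ?_ * ?_
      rw [div_le_div_iff₀ (by linarith) (by linarith)]
      linarith
    rw [Real.sqrt_mul (by norm_num)] at hlamj
    have hee : Real.exp (-1) * Real.exp (1 / 2) = Real.exp (-1 / 2) := by
      rw [← Real.exp_add]; norm_num
    have hbinv : √(2 * g * (n / (n + 1))) / b ≤ 1 := (div_le_one hbpos).2 hb3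
    have hs22 : √(2 : ℝ) * √2 = 2 := Real.mul_self_sqrt (by norm_num)
    calc _ ≤ Real.exp (-1) / b * (Real.exp (1 / 2) * √2 *
          (√2 * √(2 * g * (n / (n + 1))) * √(lam / n))) := by
          refine mul_le_mul_of_nonneg_left (h1.trans ?_) (by positivity)
          exact mul_le_mul hexp2 hlamj (by positivity) (by positivity)
      _ = Real.exp (-1) * Real.exp (1 / 2) * (√2 * √2) *
          (√(2 * g * (n / (n + 1))) / b) * √(lam / n) := by ring
      _ ≤ Real.exp (-1) * Real.exp (1 / 2) * (√2 * √2) * 1 * √(lam / n) := by gcongr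
      _ = _ := by rw [hee, hs22]; ring

end Coefficient

/-! ### Method of mixtures: one step -/

section Mixture

/-- Completing the square in `g`: tilting the Gaussian with mean `m` and variance `s` by exp(gx -
g²/2) gives a multiple of the Gaussian with mean (m + sx)/(1 + s) and variance s/(1 + s). -/
theorem exp_mul_gaussianPDFReal {m s : ℝ} (hs : 0 < s) (x g : ℝ) :
    Real.exp ((x ^ 2 - (x - m) ^ 2 / (1 + s)) / 2) *
        gaussianPDFReal ((m + s * x) / (1 + s)) (s / (1 + s)).toNNReal g =
      √(1 + s) * (gaussianPDFReal m s.toNNReal g * Real.exp (g * x - g ^ 2 / 2)) := by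
  have h1 : 0 < 1 + s := by linarith
  have h2 : √(2 * Real.pi * (s / (1 + s))) * √(1 + s) = √(2 * Real.pi * s) := by
    rw [← Real.sqrt_mul (by positivity)]
    congr 1
    field_simp
  have h3 : 0 < √(2 * Real.pi * s) := Real.sqrt_pos.2 (by positivity)
  have h4 : 0 < √(1 + s) := Real.sqrt_pos.2 h1
  rw [gaussianPDFReal, gaussianPDFReal, Real.coe_toNNReal _ (by positivity),
    Real.coe_toNNReal _ hs.le, ← h2, mul_inv]
  have h5 : Real.exp ((x ^ 2 - (x - m) ^ 2 / (1 + s)) / 2) *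
      Real.exp (-(g - (m + s * x) / (1 + s)) ^ 2 / (2 * (s / (1 + s)))) =
      Real.exp (-(g - m) ^ 2 / (2 * s)) * Real.exp (g * x - g ^ 2 / 2) := by
    rw [← Real.exp_add, ← Real.exp_add]
    congr 1
    field_simp
    ring
  calc _ = (√(2 * Real.pi * (s / (1 + s))))⁻¹ *
        (Real.exp ((x ^ 2 - (x - m) ^ 2 / (1 + s)) / 2) *
        Real.exp (-(g - (m + s * x) / (1 + s)) ^ 2 / (2 * (s / (1 + s))))) := by ring
    _ = _ := by rw [h5]; field_simp

/-- The one-step bound of the method of mixtures: a standard sub-Gaussian exponential moment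
condition controls a quadratic exponential moment. -/
theorem lintegral_exp_quadratic_le {ν : Measure ℝ} [SFinite ν]
    (hν : ∀ g : ℝ, ∫⁻ x, ENNReal.ofReal (Real.exp (g * x - g ^ 2 / 2)) ∂ν ≤ 1) (m : ℝ) {s : ℝ}
    (hs : 0 ≤ s) :
    ∫⁻ x, ENNReal.ofReal (Real.exp ((x ^ 2 - (x - m) ^ 2 / (1 + s)) / 2)) ∂ν ≤
      ENNReal.ofReal (√(1 + s)) := by
  -- For s = 0 the mixing law is the point mass at `m`, which has no density; the hypothesis at g =
  -- m is the claim.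
  rcases hs.eq_or_lt with rfl | hs
  · simp only [add_zero, div_one, Real.sqrt_one, ENNReal.ofReal_one]
    convert! hν m using 5
    ring
  have hne : (s / (1 + s)).toNNReal ≠ 0 := by
    rw [ne_eq, Real.toNNReal_eq_zero, not_le]; positivity
  have hne' : s.toNNReal ≠ 0 := by rwa [ne_eq, Real.toNNReal_eq_zero, not_le]
  have key : ∀ x, ENNReal.ofReal (Real.exp ((x ^ 2 - (x - m) ^ 2 / (1 + s)) / 2)) =
      ENNReal.ofReal (√(1 + s)) * ∫⁻ g, gaussianPDF m s.toNNReal g *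
        ENNReal.ofReal (Real.exp (g * x - g ^ 2 / 2)) := by
    intro x
    rw [← lintegral_const_mul' _ _ ENNReal.ofReal_ne_top, ← mul_one (ENNReal.ofReal _),
      ← lintegral_gaussianPDF_eq_one ((m + s * x) / (1 + s)) hne,
      ← lintegral_const_mul' _ _ ENNReal.ofReal_ne_top]
    refine lintegral_congr fun g => ?_
    rw [gaussianPDF, gaussianPDF, ← ENNReal.ofReal_mul (Real.exp_pos _).le,
      ← ENNReal.ofReal_mul (gaussianPDFReal_nonneg _ _ _),
      ← ENNReal.ofReal_mul (Real.sqrt_nonneg _), exp_mul_gaussianPDFReal hs]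
  simp_rw [key]
  rw [lintegral_const_mul' _ _ ENNReal.ofReal_ne_top, lintegral_lintegral_swap]
  · refine mul_le_of_le_one_right' ?_
    calc _ = ∫⁻ g, gaussianPDF m s.toNNReal g *
          ∫⁻ x, ENNReal.ofReal (Real.exp (g * x - g ^ 2 / 2)) ∂ν := by
          refine lintegral_congr fun g => ?_
          rw [lintegral_const_mul' _ _ (by simp [gaussianPDF])]
      _ ≤ ∫⁻ g, gaussianPDF m s.toNNReal g * 1 := by gcongr with g; exact hν g
      _ = 1 := by simp only [mul_one]; exact lintegral_gaussianPDF_eq_one m hne'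
  · refine Measurable.aemeasurable ?_
    exact ((measurable_gaussianPDF _ _).comp measurable_snd).mul (by fun_prop)

end Mixture

/-! ### Exponential weights -/

section Hedge

variable {A : Type*} [Fintype A]

/-- Hoeffding's lemma for a finitely supported distribution on `[0, 1]`. -/
theorem sum_mul_exp_le (p v : A → ℝ) (hp : ∀ a, 0 ≤ p a) (hp1 : ∑ a, p a = 1)
    (hv : ∀ a, v a ∈ Set.Icc (0 : ℝ) 1) (η : ℝ) :
    ∑ a, p a * Real.exp (η * v a) ≤ Real.exp (η * ∑ a, p a * v a + η ^ 2 / 8) := by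
  let mA : MeasurableSpace A := ⊤
  have hsum : ∑ a, ENNReal.ofReal (p a) = 1 := by
    rw [← ENNReal.ofReal_sum_of_nonneg fun a _ => hp a, hp1, ENNReal.ofReal_one]
  let q : PMF A := PMF.ofFintype (fun a => ENNReal.ofReal (p a)) hsum
  have hint : ∀ F : A → ℝ, ∫ a, F a ∂q.toMeasure = ∑ a, p a * F a := by
    intro F
    rw [PMF.integral_eq_sum]
    refine Finset.sum_congr rfl fun a _ => ?_
    simp [q, ENNReal.toReal_ofReal (hp a)]
  have h := hasSubgaussianMGF_of_mem_Icc (μ := q.toMeasure) (X := v) (a := 0) (b := 1)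
    (Measurable.of_discrete.aemeasurable) (Filter.Eventually.of_forall hv)
  have h1 := h.mgf_le η
  rw [mgf, hint, hint] at h1
  have h2 : ∑ a, p a * Real.exp (η * (v a - ∑ b, p b * v b)) =
      Real.exp (-(η * ∑ b, p b * v b)) * ∑ a, p a * Real.exp (η * v a) := by
    rw [Finset.mul_sum]
    refine Finset.sum_congr rfl fun a _ => ?_
    rw [mul_sub, Real.exp_sub, Real.exp_neg]
    field_simp
  rw [h2, Real.exp_neg, inv_mul_le_iff₀ (Real.exp_pos _), ← Real.exp_add] at h1
  refine h1.trans (Real.exp_le_exp.2 (add_le_add le_rfl (le_of_eq ?_)))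
  simp
  ring

/-- The exponential weights of cumulative rewards `s`. -/
def expWeights (η : ℝ) (s : A → ℝ) (a : A) : ℝ :=
  Real.exp (η * s a) / ∑ b, Real.exp (η * s b)

theorem expWeights_nonneg (η : ℝ) (s : A → ℝ) (a : A) : 0 ≤ expWeights η s a := by
  unfold expWeights; positivity

theorem sum_expWeights [Nonempty A] (η : ℝ) (s : A → ℝ) : ∑ a, expWeights η s a = 1 := by
  have : 0 < ∑ b, Real.exp (η * s b) :=
    Finset.sum_pos (fun b _ => Real.exp_pos _) Finset.univ_nonempty
  unfold expWeights
  rw [← Finset.sum_div, div_self this.ne']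

/-- The regret bound of exponential weights for rewards that are at most `1`, where the player is
credited with the positive parts of the rewards. -/
theorem sum_le_sum_expWeights [Nonempty A] (u : ℕ → A → ℝ) (hu : ∀ i a, u i a ≤ 1) {T : ℕ}
    (hT : 0 < T) {η : ℝ} (hη : η = √(8 * Real.log (Fintype.card A) / T)) (a : A) :
    ∑ i ∈ Finset.range T, u i a ≤ ∑ i ∈ Finset.range T,
        ∑ b, expWeights η (fun b => ∑ j ∈ Finset.range i, u j b) b * max (u i b) 0 +
      √(0.5 * T * Real.log (Fintype.card A)) := by
  have hT' : (0 : ℝ) < T := by exact_mod_cast hT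
  have hK : 1 ≤ Fintype.card A := Fintype.card_pos
  -- With one action η = 0, and the final division by η is impossible; the regret is trivially
  -- nonpositive.
  rcases hK.eq_or_lt with hK | hK
  · have : Subsingleton A := Fintype.card_le_one_iff_subsingleton.1 hK.ge
    refine le_add_of_le_of_nonneg (Finset.sum_le_sum fun i _ => ?_) (Real.sqrt_nonneg _)
    have h1 : ∀ b, max (u i b) 0 = max (u i a) 0 := fun b => by rw [Subsingleton.elim b a]
    simp_rw [h1]
    rw [← Finset.sum_mul, sum_expWeights, one_mul]
    exact le_max_left _ _
  have hlog : 0 < Real.log (Fintype.card A) := Real.log_pos (by exact_mod_cast hK)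
  have hηpos : 0 < η := by rw [hη]; exact Real.sqrt_pos.2 (by positivity)
  set S : ℕ → A → ℝ := fun n b => ∑ j ∈ Finset.range n, u j b with hS
  set Z : ℕ → ℝ := fun n => ∑ b, Real.exp (η * S n b) with hZ
  have hZpos : ∀ n, 0 < Z n := fun n =>
    Finset.sum_pos (fun b _ => Real.exp_pos _) Finset.univ_nonempty
  have hstep : ∀ n, Z n ≤ Fintype.card A * Real.exp (η * ∑ i ∈ Finset.range n,
      ∑ b, expWeights η (S i) b * max (u i b) 0 + n * (η ^ 2 / 8)) := by
    intro n
    induction n with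
    | zero => simp [hZ, hS]
    | succ n ih =>
      have h1 : Z (n + 1) = Z n * ∑ b, expWeights η (S n) b * Real.exp (η * u n b) := by
        rw [Finset.mul_sum]
        refine Finset.sum_congr rfl fun b _ => ?_
        have : S (n + 1) b = S n b + u n b := Finset.sum_range_succ _ _
        rw [this, mul_add, Real.exp_add, expWeights, ← mul_assoc, mul_div_cancel₀ _ (hZpos n).ne']
      -- Passing to the positive part only raises the potential and brings the rewards into [0,1],
      -- the range of Hoeffding's lemma. Confidence bounds may be very negative.
      have h2 : ∑ b, expWeights η (S n) b * Real.exp (η * u n b) ≤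
          ∑ b, expWeights η (S n) b * Real.exp (η * max (u n b) 0) := by
        refine Finset.sum_le_sum fun b _ => ?_
        have := expWeights_nonneg η (S n) b
        gcongr
        exact le_max_left _ _
      have h3 := sum_mul_exp_le (expWeights η (S n)) (fun b => max (u n b) 0)
        (expWeights_nonneg _ _) (sum_expWeights _ _)
        (fun b => ⟨le_max_right _ _, max_le (hu n b) zero_le_one⟩) η
      rw [h1, Finset.sum_range_succ]
      refine (mul_le_mul ih (h2.trans h3) ?_ (by positivity)).trans (le_of_eq ?_)
      · exact Finset.sum_nonneg fun b _ =>
          mul_nonneg (expWeights_nonneg _ _ _) (Real.exp_pos _).le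
      · rw [mul_assoc, ← Real.exp_add]
        push_cast
        congr 2
        ring
  have h1 : Real.exp (η * S T a) ≤ Z T :=
    Finset.single_le_sum (f := fun b => Real.exp (η * S T b)) (fun b _ => (Real.exp_pos _).le)
      (Finset.mem_univ a)
  have h2 := h1.trans (hstep T)
  nth_rewrite 1 [← Real.exp_log (by positivity : (0 : ℝ) < Fintype.card A)] at h2
  rw [← Real.exp_add, Real.exp_le_exp] at h2
  have hη2 : η ^ 2 * T = 8 * Real.log (Fintype.card A) := by
    rw [hη, Real.sq_sqrt (by positivity)]; field_simp
  -- For this η the terms (log K)/η and Tη/8 coincide, so their sum is ηT/4.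
  have hbound : √(0.5 * T * Real.log (Fintype.card A)) = η * T / 4 := by
    rw [Real.sqrt_eq_iff_mul_self_eq (by positivity) (by positivity)]
    nlinarith
  rw [hbound]
  change S T a ≤ _
  refine le_of_mul_le_mul_left ?_ hηpos
  nlinarith

end Hedge

/-! ### Numerical constants -/

section Numerics

theorem le_of_sq_le_sq_of_nonneg {a b : ℝ} (h : a ^ 2 ≤ b ^ 2) (hb : 0 ≤ b) : a ≤ b :=
  abs_le_of_sq_le_sq' h hb |>.2

/-- The chord of the exponential over [0, 2c]. -/
theorem exp_two_mul_sub_one_le {c g : ℝ} (hg : 0 ≤ g) (hc : 0 < c) (h : g ≤ c) :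
    Real.exp (2 * g) - 1 ≤ (Real.exp (2 * c) - 1) / c * g := by
  have := convexOn_exp.2 (Set.mem_univ 0) (Set.mem_univ (2 * c))
    (sub_nonneg.2 ((div_le_one hc).2 h)) (div_nonneg hg hc.le) (sub_add_cancel 1 (g / c))
  simp only [smul_eq_mul, mul_zero, zero_add, Real.exp_zero, mul_one] at this
  have e : g / c * (2 * c) = 2 * g := by field_simp
  rw [e] at this
  calc _ ≤ (1 - g / c + g / c * Real.exp (2 * c)) - 1 := by linarith
    _ = _ := by ring

theorem exp_le_of_pow_le {a b : ℝ} {n : ℕ} (hb : 0 ≤ b) (h : (2.7182818286 : ℝ) ^ n ≤ b ^ 10)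
    (ha : a * 10 = n) : Real.exp a ≤ b := by
  have h1 : Real.exp a ^ 10 ≤ b ^ 10 := by
    rw [← Real.exp_nat_mul]
    have e : ((10 : ℕ) : ℝ) * a = n * 1 := by push_cast; linarith
    rw [e, Real.exp_nat_mul]
    refine le_trans ?_ h
    have := Real.exp_one_lt_d9
    gcongr
  exact le_of_pow_le_pow_left₀ (by norm_num) hb h1

/-- The constants of the regret bound: an estimate that is effective for a large information gain
is interpolated with the trivial one. -/
theorem regret_numerics {R B θ b g lam T W Y : ℝ} (hB : 0 ≤ B) (hθ : 0 ≤ θ) (hb0 : 0 ≤ b)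
    (hg : 0 ≤ g) (hlam : 1 ≤ lam) (hT : 1 ≤ T) (hb : 2 * g * (T - 1) ≤ T * b ^ 2)
    (hW : W ≤ 4 * Real.exp (-1 / 2) * √(lam * T)) (hYT : Y ≤ T)
    (hY : Y ^ 2 ≤ T * (lam * (Real.exp (2 * g) - 1))) (h1 : R ≤ B * Y)
    (h2 : 0 < b → 0 < g → R ≤ 2 * (B + θ * b) * √(T * (2 / Real.log 2 * (lam * g))) + θ * W) :
    R ≤ 4 * (B + θ * b) * √(g * lam * T) := by
  set Q := √(g * lam * T) with hQ
  have hQ0 : 0 ≤ Q := Real.sqrt_nonneg _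
  have hQ2 : Q ^ 2 = g * lam * T := Real.sq_sqrt (by positivity)
  have hYQ : ∀ c y : ℝ, 0 < c → 0 ≤ y → g ≤ c → Real.exp (2 * c) - 1 ≤ y ^ 2 * c → Y ≤ y * Q := by
    intro c y hc hy hgc hcy
    refine le_of_sq_le_sq_of_nonneg (hY.trans ?_) (by positivity)
    have h3 := exp_two_mul_sub_one_le hg hc hgc
    have h4 : (Real.exp (2 * c) - 1) / c ≤ y ^ 2 := (div_le_iff₀ hc).2 hcy
    rw [mul_pow, hQ2]
    calc T * (lam * (Real.exp (2 * g) - 1)) ≤ T * (lam * (y ^ 2 * g)) := by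
          gcongr
          exact h3.trans (by gcongr)
      _ = _ := by ring
  have hθbQ : 0 ≤ θ * b * Q := by positivity
  have hBQ : 0 ≤ B * Q := by positivity
  have hsmall : Y ≤ 4 * Q → R ≤ 4 * (B + θ * b) * Q := by
    intro h
    have := mul_le_mul_of_nonneg_left h hB
    nlinarith
  -- (exp(3.3) - 1)/1.65 ≤ 16 = 4², so the trivial estimate suffices up to 1.65.
  rcases le_or_gt g 1.65 with hg1 | hg1
  · refine hsmall (hYQ 1.65 4 (by norm_num) (by norm_num) hg1 ?_)
    have : Real.exp (2 * 1.65) ≤ 27.4 :=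
      exp_le_of_pow_le (n := 33) (by norm_num) (by norm_num) (by norm_num)
    linarith
  -- If T ≤ 16gλ then Y ≤ T ≤ 4Q. Otherwise T > 16·1.65 = 26.4, so 2(T-1)/T ≥ 1.924 and b² ≥ 1.924
  -- g.
  rcases le_or_gt T (16 * g * lam) with hT1 | hT1
  · refine hsmall (hYT.trans (le_of_sq_le_sq_of_nonneg ?_ (by positivity)))
    rw [mul_pow, hQ2]
    nlinarith
  have hT2 : 26.4 < T := by nlinarith
  have hb2 : 1.924 * g ≤ b ^ 2 := by
    have : T * (1.924 * g) ≤ T * b ^ 2 := by nlinarith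
    exact le_of_mul_le_mul_left this (by linarith)
  have hbpos : 0 < b := by
    rcases hb0.eq_or_lt with h | h
    · rw [← h] at hb2; nlinarith
    · exact h
  have hE : Real.exp (-1 / 2) ≤ 0.6066 := by
    refine le_of_sq_le_sq_of_nonneg ?_ (by norm_num)
    rw [← Real.exp_nat_mul]
    have e : ((2 : ℕ) : ℝ) * (-1 / 2) = -1 := by norm_num
    rw [e, Real.exp_neg, inv_le_comm₀ (Real.exp_pos _) (by norm_num)]
    have := Real.exp_one_gt_d9
    refine le_trans ?_ this.le
    norm_num
  -- Here 2.4264 = 4·0.6066 bounds the constant of `hW`, and 3.0605 is just above 2.4264²/1.924.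
  have hWQ : ∀ κ c : ℝ, 0 ≤ κ → 0 < c → c ≤ g → 3.0605 ≤ κ ^ 2 * c ^ 2 → W ≤ κ * (b * Q) := by
    intro κ c hκ hc hcg h
    have hW1 : W ≤ 2.4264 * √(lam * T) := hW.trans (by gcongr; linarith)
    refine hW1.trans (le_of_sq_le_sq_of_nonneg ?_ (by positivity))
    rw [mul_pow, mul_pow, mul_pow, hQ2, Real.sq_sqrt (by positivity)]
    have h5 : 2.4264 ^ 2 ≤ κ ^ 2 * (1.924 * g * g) := by
      have : κ ^ 2 * c ^ 2 ≤ κ ^ 2 * g ^ 2 := by gcongr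
      nlinarith
    calc 2.4264 ^ 2 * (lam * T) ≤ κ ^ 2 * (1.924 * g * g) * (lam * T) := by gcongr
      _ = κ ^ 2 * (1.924 * g * (g * lam * T)) := by ring
      _ ≤ _ := by gcongr
  have hP : √(T * (2 / Real.log 2 * (lam * g))) ≤ 1.7 * Q := by
    rw [Real.sqrt_le_left (by positivity), mul_pow, hQ2]
    have : 2 / Real.log 2 ≤ 1.7 ^ 2 := by
      have := Real.log_two_gt_d9
      rw [div_le_iff₀ (by linarith)]
      linarith
    calc _ ≤ T * (1.7 ^ 2 * (lam * g)) := by gcongr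
      _ = _ := by ring
  have hR : ∀ κ c : ℝ, 0 ≤ κ → 0 < c → c ≤ g → 3.0605 ≤ κ ^ 2 * c ^ 2 →
      R ≤ 3.4 * (B * Q) + (3.4 + κ) * (θ * b * Q) := by
    intro κ c hκ hc hcg h
    have h3 := h2 hbpos (by linarith)
    have h4 := mul_le_mul_of_nonneg_left (hWQ κ c hκ hc hcg h) hθ
    have h5 := mul_le_mul_of_nonneg_left hP (by positivity : 0 ≤ 2 * (B + θ * b))
    linarith
  -- The failure cost affects only the coefficient of θb, while the trivial estimate has no θb term
  -- at all. For g ≤ 3 a convex combination of the two brings both coefficients to at most 4; beyond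
  -- 3 already 3.4 + 0.584 < 4.
  rcases le_or_gt g 2.6 with hg2 | hg2
  · have h3 := hR 1.061 1.65 (by norm_num) (by norm_num) hg1.le (by norm_num)
    have h4 := hYQ 2.6 8.34 (by norm_num) (by norm_num) hg2 (by
      have : Real.exp (2 * 2.6) ≤ 181.8 :=
        exp_le_of_pow_le (n := 52) (by norm_num) (by norm_num) (by norm_num)
      linarith)
    have h5 := mul_le_mul_of_nonneg_left h4 hB
    linarith
  rcases le_or_gt g 3 with hg3 | hg3
  · have h3 := hR 0.673 2.6 (by norm_num) (by norm_num) hg2.le (by norm_num)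
    have h4 := hYQ 3 11.62 (by norm_num) (by norm_num) hg3 (by
      have : Real.exp (2 * 3) ≤ 404 :=
        exp_le_of_pow_le (n := 60) (by norm_num) (by norm_num) (by norm_num)
      refine (sub_le_sub_right this 1).trans ?_
      norm_num)
    have h5 := mul_le_mul_of_nonneg_left h4 hB
    linarith
  · have h3 := hR 0.584 3 (by norm_num) (by norm_num) hg3.le (by norm_num)
    linarith

end Numerics

/-! ### The law of a trajectory for fixed noise -/

section Law

variable {A Z : Type*}

/-- The probability of the actions `a` in the contexts `z` with noise `e` when the player follows
the behavioural strategy `p`. -/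
def pathProb (p : ∀ n : ℕ, (Fin n → A × Z × ℝ) → Z → A → ℝ) {n : ℕ} (e : Fin n → ℝ)
    (z : Fin n → Z) (a : Fin n → A) : ℝ :=
  ∏ t : Fin n, p t (Fin.take t t.isLt.le (history a z e)) (z t) (a t)

theorem history_snoc {n : ℕ} (a : Fin n → A) (a' : A) (z : Fin n → Z) (z' : Z) (e : ℕ → ℝ) :
    history (Fin.snoc a a' : Fin (n + 1) → A) (Fin.snoc z z' : Fin (n + 1) → Z)
      (fun t : Fin (n + 1) => e t) =
    Fin.snoc (history a z fun t : Fin n => e t) (a', z', e n) := by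
  ext t : 1
  refine Fin.lastCases ?_ (fun i => ?_) t <;> simp [history]

theorem take_snoc {E : Type*} {n m : ℕ} (h : m ≤ n) (v : Fin n → E) (w : E) :
    Fin.take m (h.trans n.le_succ) (Fin.snoc v w : Fin (n + 1) → E) = Fin.take m h v := by
  ext t
  simp only [Fin.take]
  have : Fin.castLE (h.trans n.le_succ) t = (Fin.castLE h t).castSucc := rfl
  rw [this, Fin.snoc_castSucc]

theorem pathProb_snoc (p : ∀ n : ℕ, (Fin n → A × Z × ℝ) → Z → A → ℝ) {n : ℕ}
    (a : Fin n → A) (a' : A) (z : Fin n → Z) (z' : Z) (e : ℕ → ℝ) :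
    pathProb p (fun t : Fin (n + 1) => e t) (Fin.snoc z z' : Fin (n + 1) → Z)
      (Fin.snoc a a' : Fin (n + 1) → A) =
    pathProb p (fun t : Fin n => e t) z a * p n (history a z fun t : Fin n => e t) z' a' := by
  rw [pathProb, Fin.prod_univ_castSucc, history_snoc]
  congr 1
  · refine Finset.prod_congr rfl fun t _ => ?_
    rw [Fin.snoc_castSucc, Fin.snoc_castSucc]
    exact congrArg (fun h => p t h (z t) (a t)) (take_snoc t.isLt.le _ _)
  · rw [Fin.snoc_last, Fin.snoc_last]
    exact congrArg (fun h => p n h z' a') (take_snoc le_rfl _ _)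

variable [MeasurableSpace A] [MeasurableSpace Z]

theorem measurable_history {n : ℕ} (a : Fin n → A) {α : Type*} [MeasurableSpace α]
    {z : α → Fin n → Z} (hz : Measurable z) {e : α → Fin n → ℝ} (he : Measurable e) :
    Measurable fun q => history a (z q) (e q) := by
  refine measurable_pi_lambda _ fun t => ?_
  exact measurable_const.prodMk (((measurable_pi_apply t).comp hz).prodMk
    ((measurable_pi_apply t).comp he))

theorem measurable_take {E : Type*} [MeasurableSpace E] {m n : ℕ} (h : m ≤ n) :
    Measurable fun v : Fin n → E => Fin.take m h v :=
  measurable_pi_lambda _ fun _ => measurable_pi_apply _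

theorem measurable_snoc {E α : Type*} [MeasurableSpace E] [MeasurableSpace α] {n : ℕ}
    {v : α → Fin n → E} (hv : Measurable v) {w : α → E} (hw : Measurable w) :
    Measurable fun q => (Fin.snoc (v q) (w q) : Fin (n + 1) → E) := by
  refine measurable_pi_lambda _ fun t => ?_
  refine Fin.lastCases ?_ (fun i => ?_) t
  · simpa using hw
  · simp only [Fin.snoc_castSucc]
    exact (measurable_pi_apply i).comp hv

variable [Fintype A]

/-- The law of the history of `n` rounds for the noise sequence `e`. -/
def gameLaw (p : ∀ n : ℕ, (Fin n → A × Z × ℝ) → Z → A → ℝ) (ζ : Measure Z) (e : ℕ → ℝ) (n : ℕ) :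
    Measure (Fin n → A × Z × ℝ) :=
  Measure.sum fun a : Fin n → A =>
    ((Measure.pi fun _ => ζ).withDensity fun z =>
      ENNReal.ofReal (pathProb p (fun t : Fin n => e t) z a)).map
        fun z => history a z fun t : Fin n => e t

/-- A measurable behavioural strategy. -/
structure IsStrategy (p : ∀ n : ℕ, (Fin n → A × Z × ℝ) → Z → A → ℝ) : Prop where
  nonneg : ∀ n h z a, 0 ≤ p n h z a
  sum_eq_one : ∀ n h z, ∑ a, p n h z a = 1
  measurable : ∀ n a, Measurable fun q : (Fin n → A × Z × ℝ) × Z => p n q.1 q.2 a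

variable {p : ∀ n : ℕ, (Fin n → A × Z × ℝ) → Z → A → ℝ} {ζ : Measure Z}

theorem IsStrategy.pathProb_nonneg (hp : IsStrategy p) {n : ℕ} (e : Fin n → ℝ) (z : Fin n → Z)
    (a : Fin n → A) : 0 ≤ pathProb p e z a :=
  Finset.prod_nonneg fun _ _ => hp.nonneg _ _ _ _

theorem IsStrategy.measurable_pathProb (hp : IsStrategy p) {n : ℕ} (a : Fin n → A) :
    Measurable fun q : (Fin n → ℝ) × (Fin n → Z) => pathProb p q.1 q.2 a := by
  refine Finset.measurable_fun_prod _ fun t _ => ?_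
  have h1 : Measurable fun q : (Fin n → ℝ) × (Fin n → Z) =>
      (Fin.take t t.isLt.le (history a q.2 q.1), q.2 t) :=
    ((measurable_take t.isLt.le).comp (measurable_history a measurable_snd measurable_fst)).prodMk
      ((measurable_pi_apply t).comp measurable_snd)
  exact (hp.measurable t (a t)).comp h1

theorem lintegral_gameLaw (hp : IsStrategy p) (e : ℕ → ℝ) {n : ℕ}
    {F : (Fin n → A × Z × ℝ) → ENNReal} (hF : Measurable F) :
    ∫⁻ h, F h ∂gameLaw p ζ e n = ∑ a : Fin n → A, ∫⁻ z : Fin n → Z,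
      ENNReal.ofReal (pathProb p (fun t : Fin n => e t) z a) *
        F (history a z fun t : Fin n => e t) ∂Measure.pi fun _ => ζ := by
  rw [gameLaw, lintegral_sum_measure, tsum_fintype]
  refine Finset.sum_congr rfl fun a _ => ?_
  have hm : Measurable fun z : Fin n → Z => history a z fun t : Fin n => e t :=
    measurable_history a measurable_id measurable_const
  rw [lintegral_map hF hm, lintegral_withDensity_eq_lintegral_mul₀]
  · rfl
  · exact ((hp.measurable_pathProb a).comp
      (measurable_const.prodMk measurable_id)).ennreal_ofReal.aemeasurable
  · exact (hF.comp hm).aemeasurable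

theorem lintegral_pi_snoc [SigmaFinite ζ] {n : ℕ} {G : (Fin (n + 1) → Z) → ENNReal}
    (hG : Measurable G) :
    ∫⁻ z, G z ∂(Measure.pi fun _ => ζ) =
      ∫⁻ z : Fin n → Z, ∫⁻ z', G (Fin.snoc z z' : Fin (n + 1) → Z) ∂ζ ∂(Measure.pi fun _ => ζ) := by
  have hmp := (measurePreserving_piFinSuccAbove (fun _ : Fin (n + 1) => ζ) (Fin.last n)).symm
  rw [← hmp.lintegral_comp hG, lintegral_prod_symm]
  · simp [MeasurableEquiv.piFinSuccAbove, Fin.insertNthEquiv]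
  · exact (hG.comp (MeasurableEquiv.measurable _)).aemeasurable

/-- Conditioning on the history before the last round. -/
theorem lintegral_gameLaw_succ [SigmaFinite ζ] (hp : IsStrategy p) (e : ℕ → ℝ) {n : ℕ}
    {F : (Fin (n + 1) → A × Z × ℝ) → ENNReal} (hF : Measurable F) :
    ∫⁻ h, F h ∂gameLaw p ζ e (n + 1) =
      ∫⁻ h, ∫⁻ z, ∑ a, ENNReal.ofReal (p n h z a) * F (Fin.snoc h (a, z, e n)) ∂ζ
        ∂gameLaw p ζ e n := by
  obtain ⟨Φ, hΦ⟩ : ∃ Φ : (Fin n → A × Z × ℝ) → Z → A → ENNReal, ∀ h z a,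
      ENNReal.ofReal (p n h z a) * F (Fin.snoc h (a, z, e n)) = Φ h z a := ⟨_, fun _ _ _ => rfl⟩
  have hΦm : ∀ a : A, Measurable fun q : (Fin n → A × Z × ℝ) × Z => Φ q.1 q.2 a := by
    intro a
    simp only [← hΦ]
    exact (hp.measurable n a).ennreal_ofReal.mul (hF.comp (measurable_snoc measurable_fst
      (measurable_const.prodMk (measurable_snd.prodMk measurable_const))))
  simp only [hΦ]
  have hinner : Measurable fun h : Fin n → A × Z × ℝ => ∫⁻ z, ∑ a, Φ h z a ∂ζ :=
    (Finset.measurable_fun_sum _ fun a _ => hΦm a).lintegral_prod_right'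
  rw [lintegral_gameLaw hp e hF, lintegral_gameLaw hp e hinner,
    ← (Fin.snocEquiv fun _ => A).sum_comp, Fintype.sum_prod_type_right]
  refine Finset.sum_congr rfl fun a _ => ?_
  have hG : ∀ b : Fin (n + 1) → A, Measurable fun z : Fin (n + 1) → Z =>
      ENNReal.ofReal (pathProb p (fun t : Fin (n + 1) => e t) z b) *
        F (history b z fun t : Fin (n + 1) => e t) := fun b =>
    ((hp.measurable_pathProb b).comp (measurable_const.prodMk measurable_id)).ennreal_ofReal.mul
      (hF.comp (measurable_history b measurable_id measurable_const))
  have hz : Measurable fun z : Fin n → Z => history a z fun t : Fin n => e t :=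
    measurable_history a measurable_id measurable_const
  have hΦz : ∀ a' : A, Measurable fun q : (Fin n → Z) × Z =>
      Φ (history a q.1 fun t : Fin n => e t) q.2 a' := fun a' =>
    (hΦm a').comp ((hz.comp measurable_fst).prodMk measurable_snd)
  have hpp : Measurable fun z : Fin n → Z => pathProb p (fun t : Fin n => e t) z a :=
    (hp.measurable_pathProb a).comp (measurable_const.prodMk measurable_id)
  calc _ = ∑ a' : A, ∫⁻ z : Fin n → Z, ENNReal.ofReal (pathProb p (fun t : Fin n => e t) z a) *
        ∫⁻ z', Φ (history a z fun t : Fin n => e t) z' a' ∂ζ ∂Measure.pi fun _ => ζ := by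
        refine Finset.sum_congr rfl fun a' _ => ?_
        rw [lintegral_pi_snoc (hG _)]
        refine lintegral_congr fun z => ?_
        rw [← lintegral_const_mul' _ _ ENNReal.ofReal_ne_top]
        refine lintegral_congr fun z' => ?_
        have e1 : (Fin.snocEquiv fun _ : Fin (n + 1) => A) (a', a) = Fin.snoc a a' := rfl
        rw [e1, pathProb_snoc, history_snoc, ENNReal.ofReal_mul (hp.pathProb_nonneg _ _ _),
          mul_assoc, hΦ]
    _ = ∫⁻ z : Fin n → Z, ∑ a' : A, ENNReal.ofReal (pathProb p (fun t : Fin n => e t) z a) *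
        ∫⁻ z', Φ (history a z fun t : Fin n => e t) z' a' ∂ζ ∂Measure.pi fun _ => ζ := by
        rw [lintegral_finsetSum]
        exact fun a' _ => hpp.ennreal_ofReal.mul (hΦz a').lintegral_prod_right'
    _ = _ := by
        refine lintegral_congr fun z => ?_
        rw [lintegral_finsetSum, Finset.mul_sum]
        exact fun a' _ => (hΦm a').comp (measurable_const.prodMk measurable_id)

theorem IsStrategy.sum_ofReal_mul (hp : IsStrategy p) {n : ℕ} (h : Fin n → A × Z × ℝ) (z : Z)
    (c : ENNReal) : ∑ a, ENNReal.ofReal (p n h z a) * c = c := by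
  rw [← Finset.sum_mul, ← ENNReal.ofReal_sum_of_nonneg fun a _ => hp.nonneg n h z a,
    hp.sum_eq_one, ENNReal.ofReal_one, one_mul]

/-- The laws are consistent: the action probabilities of each later round sum to one. -/
theorem lintegral_gameLaw_take [IsProbabilityMeasure ζ] (hp : IsStrategy p) (e : ℕ → ℝ)
    {m n : ℕ} (hmn : m ≤ n) {F : (Fin m → A × Z × ℝ) → ENNReal} (hF : Measurable F) :
    ∫⁻ h, F (Fin.take m hmn h) ∂gameLaw p ζ e n = ∫⁻ h, F h ∂gameLaw p ζ e m := by
  induction n, hmn using Nat.le_induction with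
  | base => rfl
  | succ n hmn ih =>
    rw [lintegral_gameLaw_succ (F := fun h => F (Fin.take m (hmn.trans n.le_succ) h)) hp e
      (hF.comp (measurable_take _)), ← ih]
    refine lintegral_congr fun h => ?_
    simp only [take_snoc hmn, hp.sum_ofReal_mul, lintegral_const, measure_univ, mul_one]

theorem isProbabilityMeasure_gameLaw [IsProbabilityMeasure ζ] (hp : IsStrategy p) (e : ℕ → ℝ)
    (n : ℕ) : IsProbabilityMeasure (gameLaw p ζ e n) := by
  constructor
  have h1 := lintegral_gameLaw_take (ζ := ζ) hp e n.zero_le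
    (F := fun _ => 1) measurable_const
  rw [lintegral_const, one_mul, lintegral_gameLaw hp e measurable_const] at h1
  rw [h1]
  simp [pathProb]

theorem take_succ_eq {E : Type*} {m n : ℕ} (hmn : m < n) (v : Fin n → E) :
    Fin.take (m + 1) hmn v = Fin.snoc (Fin.take m hmn.le v) (v ⟨m, hmn⟩) :=
  Fin.take_succ_eq_snoc m hmn v

/-- The context and the action of round `n + 1` may be replaced by a fresh context and an action
drawn for it. -/
theorem lintegral_gameLaw_round [IsProbabilityMeasure ζ] (hp : IsStrategy p) (e : ℕ → ℝ)
    {m n : ℕ} (hmn : m < n) {F : (Fin m → A × Z × ℝ) → A → Z → ENNReal}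
    (hF : Measurable fun q : (Fin m → A × Z × ℝ) × A × Z => F q.1 q.2.1 q.2.2) :
    ∫⁻ h, F (Fin.take m hmn.le h) (h ⟨m, hmn⟩).1 (h ⟨m, hmn⟩).2.1 ∂gameLaw p ζ e n =
      ∫⁻ h, ∫⁻ z, ∑ a, ENNReal.ofReal (p m (Fin.take m hmn.le h) z a) *
        F (Fin.take m hmn.le h) a z ∂ζ ∂gameLaw p ζ e n := by
  let G : (Fin (m + 1) → A × Z × ℝ) → ENNReal := fun h =>
    F (Fin.take m m.le_succ h) (h (Fin.last m)).1 (h (Fin.last m)).2.1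
  have hG : Measurable G := by
    have hl := measurable_pi_apply (X := fun _ : Fin (m + 1) => A × Z × ℝ) (Fin.last m)
    exact hF.comp ((measurable_take m.le_succ).prodMk ((measurable_fst.comp hl).prodMk
      (measurable_fst.comp (measurable_snd.comp hl))))
  have h1 : ∀ (h : Fin m → A × Z × ℝ) w, G (Fin.snoc h w) = F h w.1 w.2.1 := by
    intro h w
    simp only [G, take_snoc le_rfl, Fin.snoc_last]
    rfl
  have hFs : Measurable fun h : Fin m → A × Z × ℝ =>
      ∫⁻ z, ∑ a, ENNReal.ofReal (p m h z a) * F h a z ∂ζ := by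
    refine Measurable.lintegral_prod_right' (f := fun q : (Fin m → A × Z × ℝ) × Z =>
      ∑ a, ENNReal.ofReal (p m q.1 q.2 a) * F q.1 a q.2) ?_
    exact Finset.measurable_fun_sum _ fun a _ => (hp.measurable m a).ennreal_ofReal.mul
      (hF.comp (measurable_fst.prodMk (measurable_const.prodMk measurable_snd)))
  calc _ = ∫⁻ h, G (Fin.take (m + 1) hmn h) ∂gameLaw p ζ e n := by
        refine lintegral_congr fun h => ?_
        rw [take_succ_eq hmn, h1]
    _ = ∫⁻ h, G h ∂gameLaw p ζ e (m + 1) := lintegral_gameLaw_take hp e hmn hG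
    _ = _ := by
        rw [lintegral_gameLaw_succ hp e hG, lintegral_gameLaw_take hp e hmn.le hFs]
        simp only [h1]

theorem integral_gameLaw_round [IsProbabilityMeasure ζ] (hp : IsStrategy p) (e : ℕ → ℝ)
    {m n : ℕ} (hmn : m < n) {F : (Fin m → A × Z × ℝ) → A → Z → ℝ}
    (hF : Measurable fun q : (Fin m → A × Z × ℝ) × A × Z => F q.1 q.2.1 q.2.2)
    (hF0 : ∀ h a z, 0 ≤ F h a z) :
    ∫ h, F (Fin.take m hmn.le h) (h ⟨m, hmn⟩).1 (h ⟨m, hmn⟩).2.1 ∂gameLaw p ζ e n =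
      ∫ q, ∑ a, p m (Fin.take m hmn.le q.1) q.2 a * F (Fin.take m hmn.le q.1) a q.2
        ∂(gameLaw p ζ e n).prod ζ := by
  have := isProbabilityMeasure_gameLaw (ζ := ζ) hp e n
  have hl := measurable_pi_apply (X := fun _ : Fin n => A × Z × ℝ) ⟨m, hmn⟩
  have hm1 : Measurable fun h : Fin n → A × Z × ℝ =>
      F (Fin.take m hmn.le h) (h ⟨m, hmn⟩).1 (h ⟨m, hmn⟩).2.1 :=
    hF.comp ((measurable_take hmn.le).prodMk ((measurable_fst.comp hl).prodMk
      (measurable_fst.comp (measurable_snd.comp hl))))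
  have hm2 : Measurable fun q : (Fin n → A × Z × ℝ) × Z =>
      ∑ a, p m (Fin.take m hmn.le q.1) q.2 a * F (Fin.take m hmn.le q.1) a q.2 := by
    refine Finset.measurable_fun_sum _ fun a _ => ?_
    have ht : Measurable fun q : (Fin n → A × Z × ℝ) × Z => Fin.take m hmn.le q.1 :=
      (measurable_take hmn.le).comp measurable_fst
    exact ((hp.measurable m a).comp (ht.prodMk measurable_snd)).mul
      (hF.comp (ht.prodMk (measurable_const.prodMk measurable_snd)))
  rw [integral_eq_lintegral_of_nonneg_ae (Filter.Eventually.of_forall fun h => hF0 _ _ _)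
      hm1.aestronglyMeasurable,
    integral_eq_lintegral_of_nonneg_ae (Filter.Eventually.of_forall fun q =>
      Finset.sum_nonneg fun a _ => mul_nonneg (hp.nonneg _ _ _ _) (hF0 _ _ _))
      hm2.aestronglyMeasurable, lintegral_prod _ hm2.ennreal_ofReal.aemeasurable,
    lintegral_gameLaw_round (F := fun h a z => ENNReal.ofReal (F h a z)) hp e hmn
      hF.ennreal_ofReal]
  congr 1
  refine lintegral_congr fun h => lintegral_congr fun z => ?_
  rw [ENNReal.ofReal_sum_of_nonneg fun a _ => mul_nonneg (hp.nonneg _ _ _ _) (hF0 _ _ _)]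
  simp only [ENNReal.ofReal_mul (hp.nonneg _ _ _ _)]

theorem IsStrategy.pathProb_le_one (hp : IsStrategy p) {n : ℕ} (e : Fin n → ℝ) (z : Fin n → Z)
    (a : Fin n → A) : pathProb p e z a ≤ 1 :=
  Finset.prod_le_one (fun _ _ => hp.nonneg _ _ _ _) fun t _ => by
    rw [← hp.sum_eq_one t (Fin.take t t.isLt.le (history a z e)) (z t)]
    exact Finset.single_le_sum (fun b _ => hp.nonneg _ _ _ b) (Finset.mem_univ _)

/-- Translates the weighted sum over action sequences, in which the mean regret is expressed, into
an integral over histories. -/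
theorem integral_gameLaw [IsProbabilityMeasure ζ] (hp : IsStrategy p) (e : ℕ → ℝ) {n : ℕ}
    {F : (Fin n → A × Z × ℝ) → ℝ} (hF : Measurable F) {C : ℝ} (hC : ∀ h, |F h| ≤ C) :
    Integrable (fun z : Fin n → Z => ∑ a : Fin n → A,
        pathProb p (fun t : Fin n => e t) z a * F (history a z fun t : Fin n => e t))
        (Measure.pi fun _ => ζ) ∧
      ∫ z : Fin n → Z, ∑ a : Fin n → A,
        pathProb p (fun t : Fin n => e t) z a * F (history a z fun t : Fin n => e t)
          ∂(Measure.pi fun _ => ζ) = ∫ h, F h ∂gameLaw p ζ e n := by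
  have hprob := isProbabilityMeasure_gameLaw (ζ := ζ) hp e n
  have hpm : ∀ a : Fin n → A, Measurable fun z => pathProb p (fun t : Fin n => e t) z a :=
    fun a => (hp.measurable_pathProb a).comp (measurable_const.prodMk measurable_id)
  have hm : ∀ a : Fin n → A, Measurable fun z : Fin n → Z => history a z fun t : Fin n => e t :=
    fun a => measurable_history a measurable_id measurable_const
  have hint : ∀ a : Fin n → A, Integrable (fun z : Fin n → Z =>
      pathProb p (fun t : Fin n => e t) z a * F (history a z fun t : Fin n => e t))
        (Measure.pi fun _ => ζ) := by
    intro a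
    refine Integrable.of_bound ((hpm a).mul (hF.comp (hm a))).aestronglyMeasurable C
      (Filter.Eventually.of_forall fun z => ?_)
    rw [norm_mul, Real.norm_eq_abs, Real.norm_eq_abs, abs_of_nonneg (hp.pathProb_nonneg _ _ _)]
    exact (mul_le_of_le_one_left (abs_nonneg _) (hp.pathProb_le_one _ _ _)).trans (hC _)
  refine ⟨integrable_finsetSum _ fun a _ => hint a, ?_⟩
  have hFi : Integrable F (gameLaw p ζ e n) :=
    Integrable.of_bound hF.aestronglyMeasurable C (Filter.Eventually.of_forall hC)
  rw [integral_finsetSum _ fun a _ => hint a]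
  rw [gameLaw] at hFi ⊢
  rw [integral_sum_measure hFi, tsum_fintype]
  refine Finset.sum_congr rfl fun a _ => ?_
  rw [integral_map (hm a).aemeasurable hF.aestronglyMeasurable,
    integral_withDensity_eq_integral_toReal_smul (hpm a).ennreal_ofReal
      (Filter.Eventually.of_forall fun z => ENNReal.ofReal_lt_top)]
  refine integral_congr_ae (Filter.Eventually.of_forall fun z => ?_)
  simp only [ENNReal.toReal_ofReal (hp.pathProb_nonneg _ _ _), smul_eq_mul]

end Law

/-! ### Measurability of the regression quantities -/

section MatrixMeasurability

variable {α : Type*} [MeasurableSpace α] {n : ℕ}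

theorem measurable_det {M : α → Matrix (Fin n) (Fin n) ℝ}
    (hM : ∀ i j, Measurable fun q => M q i j) : Measurable fun q => (M q).det := by
  simp only [Matrix.det_apply]
  refine Finset.measurable_fun_sum _ fun σ _ => ?_
  exact (Finset.measurable_fun_prod _ fun i _ => hM _ _).const_smul (Equiv.Perm.sign σ)

/-- The inverse is the adjugate times the inverse of the determinant; singular matrices have inverse
zero in both descriptions. -/
theorem measurable_inv_apply {M : α → Matrix (Fin n) (Fin n) ℝ}
    (hM : ∀ i j, Measurable fun q => M q i j) (i j : Fin n) :
    Measurable fun q => (M q)⁻¹ i j := by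
  simp only [Matrix.inv_def, Ring.inverse_eq_inv', Matrix.smul_apply, smul_eq_mul,
    Matrix.adjugate_apply]
  refine (measurable_det hM).inv.mul (measurable_det fun a b => ?_)
  by_cases h : a = j
  · subst h
    simp only [Matrix.updateRow_self]
    exact measurable_const
  · simp only [Matrix.updateRow_ne h]
    exact hM a b

theorem measurable_dotProduct_mulVec {M : α → Matrix (Fin n) (Fin n) ℝ} {u v : α → Fin n → ℝ}
    (hM : ∀ i j, Measurable fun q => M q i j) (hu : ∀ i, Measurable fun q => u q i)
    (hv : ∀ i, Measurable fun q => v q i) : Measurable fun q => u q ⬝ᵥ (M q *ᵥ v q) := by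
  simp only [dotProduct, Matrix.mulVec]
  exact Finset.measurable_fun_sum _ fun i _ => (hu i).mul
    (Finset.measurable_fun_sum _ fun j _ => (hM i j).mul (hv j))

end MatrixMeasurability

section RegressionMeasurability

variable {X α : Type*} [MeasurableSpace X] [MeasurableSpace α] {n : ℕ} {k : X → X → ℝ} {lam : ℝ}
  {x : α → Fin n → X} {y : α → X}

theorem measurable_ridge (hk : Measurable fun p : X × X => k p.1 p.2) (hx : Measurable x)
    (i j : Fin n) : Measurable fun q => ridge k lam (x q) i j := by
  simp only [ridge, gram, Matrix.add_apply, Matrix.of_apply]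
  exact (hk.comp (((measurable_pi_apply i).comp hx).prodMk
    ((measurable_pi_apply j).comp hx))).add_const _

theorem measurable_kerVec (hk : Measurable fun p : X × X => k p.1 p.2) (hx : Measurable x)
    (hy : Measurable y) (i : Fin n) : Measurable fun q => kerVec k (x q) (y q) i :=
  hk.comp (((measurable_pi_apply i).comp hx).prodMk hy)

theorem measurable_infoDet (hk : Measurable fun p : X × X => k p.1 p.2) (hx : Measurable x) :
    Measurable fun q => infoDet k lam (x q) := by
  refine measurable_det fun i j => ?_
  simp only [gram, Matrix.add_apply, Matrix.smul_apply, Matrix.of_apply, smul_eq_mul]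
  exact ((hk.comp (((measurable_pi_apply i).comp hx).prodMk
    ((measurable_pi_apply j).comp hx))).const_mul _).const_add _

theorem measurable_designVar (hk : Measurable fun p : X × X => k p.1 p.2) (hx : Measurable x)
    (hy : Measurable y) : Measurable fun q => designVar k lam (x q) (y q) :=
  (hk.comp (hy.prodMk hy)).sub (measurable_dotProduct_mulVec
    (measurable_inv_apply (measurable_ridge hk hx)) (measurable_kerVec hk hx hy)
    (measurable_kerVec hk hx hy))

theorem measurable_noiseEnergy (hk : Measurable fun p : X × X => k p.1 p.2) (hx : Measurable x)
    {e : α → Fin n → ℝ} (he : Measurable e) :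
    Measurable fun q => noiseEnergy k lam (x q) (e q) := by
  have he' : ∀ i, Measurable fun q => e q i := fun i => (measurable_pi_apply i).comp he
  refine Measurable.sub ?_ (Measurable.const_mul ?_ _)
  · exact Finset.measurable_fun_sum _ fun i _ => (he' i).mul (he' i)
  · exact measurable_dotProduct_mulVec (measurable_inv_apply (measurable_ridge hk hx)) he' he'

theorem measurable_ucb (hk : Measurable fun p : X × X => k p.1 p.2) {β : ℕ → ℝ}
    {d : α → Fin n → X × ℝ} (hd : Measurable d) (hy : Measurable y) :
    Measurable fun q => ucb k lam β (d q) (y q) := by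
  have hd1 : Measurable fun q => fun j => (d q j).1 :=
    measurable_pi_lambda _ fun j => measurable_fst.comp ((measurable_pi_apply j).comp hd)
  refine (Measurable.add ?_ (Measurable.const_mul ?_ _)).min measurable_const
  · exact measurable_dotProduct_mulVec (measurable_inv_apply (measurable_ridge hk hd1))
      (measurable_kerVec hk hd1 hy)
      (fun j => measurable_snd.comp ((measurable_pi_apply j).comp hd))
  · exact (measurable_designVar hk hd1 hy).sqrt

end RegressionMeasurability

/-! ### The algorithm as a strategy, and the mixture process -/

section Histories

variable {A O Z : Type*}

theorem visited_snoc (f : ∀ n : ℕ, (Fin n → A × Z × ℝ) → O) {n : ℕ} (h : Fin n → A × Z × ℝ)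
    (w : A × Z × ℝ) :
    visited f (Fin.snoc h w : Fin (n + 1) → A × Z × ℝ) =
      Fin.snoc (visited f h) (w.1, f n h, w.2.1) := by
  ext t : 1
  refine Fin.lastCases ?_ (fun i => ?_) t
  · simp only [visited, Fin.snoc_last]
    exact congrArg (fun h' => (w.1, f n h', w.2.1)) (take_snoc le_rfl h w)
  · simp only [visited, Fin.snoc_castSucc]
    exact congrArg (fun h' => ((h i).1, f i h', (h i).2.1)) (take_snoc i.isLt.le h w)

/-- The behavioural strategy of the algorithm. -/
def strategy [Fintype A] (k : A × O × Z → A × O × Z → ℝ) (lam : ℝ) (β η : ℕ → ℝ)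
    (r : A × O × Z → ℝ) (f : ∀ n : ℕ, (Fin n → A × Z × ℝ) → O) (n : ℕ) (h : Fin n → A × Z × ℝ)
    (z : Z) (a : A) : ℝ :=
  playProb k lam β η (observed r f h) z a

/-- The normalized noise along a history. -/
def scaledNoise (sg : ℝ) {n : ℕ} (h : Fin n → A × Z × ℝ) (t : Fin n) : ℝ := (h t).2.2 / sg

/-- The value after `n` rounds of the supermartingale of the method of mixtures. -/
def mixture (k : A × O × Z → A × O × Z → ℝ) (lam sg : ℝ) (f : ∀ n : ℕ, (Fin n → A × Z × ℝ) → O)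
    {n : ℕ} (h : Fin n → A × Z × ℝ) : ℝ :=
  Real.exp (noiseEnergy k lam (visited f h) (scaledNoise sg h) / 2 -
    Real.log (infoDet k lam (visited f h)) / 2)

theorem scaledNoise_snoc (sg : ℝ) {n : ℕ} (h : Fin n → A × Z × ℝ) (w : A × Z × ℝ) :
    scaledNoise sg (Fin.snoc h w : Fin (n + 1) → A × Z × ℝ) =
      Fin.snoc (scaledNoise sg h) (w.2.2 / sg) := by
  ext t
  refine Fin.lastCases ?_ (fun i => ?_) t <;> simp [scaledNoise]

end Histories

section GameMeasurability

variable {A O Z α : Type*} [MeasurableSpace A] [MeasurableSpace O] [MeasurableSpace Z]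
  [MeasurableSpace α] {f : ∀ n : ℕ, (Fin n → A × Z × ℝ) → O}

theorem measurable_visited (hf : ∀ n, Measurable (f n)) (n : ℕ) :
    Measurable fun h : Fin n → A × Z × ℝ => visited f h := by
  refine measurable_pi_lambda _ fun t => ?_
  have hl := measurable_pi_apply (X := fun _ : Fin n => A × Z × ℝ) t
  exact (measurable_fst.comp hl).prodMk (((hf t).comp (measurable_take t.isLt.le)).prodMk
    (measurable_fst.comp (measurable_snd.comp hl)))

theorem measurable_observed (hf : ∀ n, Measurable (f n)) {r : A × O × Z → ℝ} (hr : Measurable r)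
    (n : ℕ) : Measurable fun h : Fin n → A × Z × ℝ => observed r f h := by
  refine measurable_pi_lambda _ fun t => ?_
  have hl := measurable_pi_apply (X := fun _ : Fin n => A × Z × ℝ) t
  have hv : Measurable fun h : Fin n → A × Z × ℝ => visited f h t :=
    (measurable_pi_apply t).comp (measurable_visited hf n)
  exact hv.prodMk ((hr.comp hv).add (measurable_snd.comp (measurable_snd.comp hl)))

theorem measurable_score {k : A × O × Z → A × O × Z → ℝ}
    (hk : Measurable fun p : (A × O × Z) × (A × O × Z) => k p.1 p.2) {lam : ℝ} {β : ℕ → ℝ}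
    {n : ℕ} {d : α → Fin n → (A × O × Z) × ℝ} (hd : Measurable d) {z : α → Z}
    (hz : Measurable z) (a : A) : Measurable fun q => score k lam β (d q) (z q) a := by
  refine Finset.measurable_fun_sum _ fun τ _ => ?_
  have h1 : Measurable fun q => (d q τ).1.2.1 :=
    measurable_fst.comp (measurable_snd.comp (measurable_fst.comp
      ((measurable_pi_apply τ).comp hd)))
  exact measurable_ucb hk (d := fun q => Fin.take (τ + 1) τ.isLt (d q))
    ((measurable_take _).comp hd) (measurable_const.prodMk (h1.prodMk hz))

theorem isStrategy_strategy [Fintype A] [Nonempty A] {k : A × O × Z → A × O × Z → ℝ}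
    (hk : Measurable fun p : (A × O × Z) × (A × O × Z) => k p.1 p.2) (lam : ℝ) (β η : ℕ → ℝ)
    {r : A × O × Z → ℝ} (hr : Measurable r) (hf : ∀ n, Measurable (f n)) :
    IsStrategy (strategy k lam β η r f) where
  nonneg n h z a := expWeights_nonneg (η (n + 1)) (score k lam β (observed r f h) z) a
  sum_eq_one n h z := sum_expWeights (η (n + 1)) (score k lam β (observed r f h) z)
  measurable n a := by
    have h1 : ∀ b : A, Measurable fun q : (Fin n → A × Z × ℝ) × Z =>
        Real.exp (η (n + 1) * score k lam β (observed r f q.1) q.2 b) := fun b =>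
      ((measurable_score hk ((measurable_observed hf hr n).comp measurable_fst)
        measurable_snd b).const_mul _).exp
    exact (h1 a).div (Finset.measurable_fun_sum _ fun b _ => h1 b)

theorem measurable_scaledNoise (sg : ℝ) (n : ℕ) :
    Measurable fun h : Fin n → A × Z × ℝ => scaledNoise sg h := by
  refine measurable_pi_lambda _ fun t => ?_
  exact (measurable_snd.comp (measurable_snd.comp (measurable_pi_apply t))).div_const _

theorem measurable_mixture {k : A × O × Z → A × O × Z → ℝ}
    (hk : Measurable fun p : (A × O × Z) × (A × O × Z) => k p.1 p.2) (lam sg : ℝ)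
    (hf : ∀ n, Measurable (f n)) (n : ℕ) :
    Measurable fun h : Fin n → A × Z × ℝ => mixture k lam sg f h :=
  (((measurable_noiseEnergy hk (measurable_visited hf n) (measurable_scaledNoise sg n)).div_const
    _).sub ((measurable_infoDet hk (measurable_visited hf n)).log.div_const _)).exp

end GameMeasurability

/-! ### The averaged mixture is a supermartingale along the noise -/

section Supermartingale

variable {A O Z : Type*} {H : Type*} [NormedAddCommGroup H] [InnerProductSpace ℝ H]
  {φ : A × O × Z → H} {k : A × O × Z → A × O × Z → ℝ} {lam : ℝ}

/-- By the recursions of energy and determinant, the mixture grows at most by the quadratic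
exponential over √(1+s), where s = v/λ and `m` is the noise value predicted from the past. Gaussian
mixing bounds the mean of this factor by one. -/
theorem lintegral_mixture_snoc_le (hk : ∀ x y, k x y = inner ℝ (φ x) (φ y)) (hlam : 0 < lam)
    {ν : Measure ℝ} [SFinite ν] {sg : ℝ}
    (hν : ∀ g : ℝ, ∫⁻ x, ENNReal.ofReal (Real.exp (g * (x / sg) - g ^ 2 / 2)) ∂ν ≤ 1)
    (f : ∀ n : ℕ, (Fin n → A × Z × ℝ) → O) {n : ℕ} (h : Fin n → A × Z × ℝ) (a : A) (z : Z) :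
    ∫⁻ x, ENNReal.ofReal (mixture k lam sg f (Fin.snoc h (a, z, x) : Fin (n + 1) → A × Z × ℝ)) ∂ν ≤
      ENNReal.ofReal (mixture k lam sg f h) := by
  set y : A × O × Z := (a, f n h, z)
  set s := designVar k lam (visited f h) y / lam with hs
  have hs0 : 0 ≤ s := div_nonneg (designVar_nonneg hk hlam _ _) hlam.le
  set m := noiseMean k lam (visited f h) (scaledNoise sg h) y
  have hD := one_le_infoDet hk hlam (visited f h)
  have h1s : 0 < 1 + s := by linarith
  have hle : ∀ x, ENNReal.ofReal
      (mixture k lam sg f (Fin.snoc h (a, z, x) : Fin (n + 1) → A × Z × ℝ)) ≤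
      ENNReal.ofReal (mixture k lam sg f h / √(1 + s)) *
        ENNReal.ofReal (Real.exp (((x / sg) ^ 2 - (x / sg - m) ^ 2 / (1 + s)) / 2)) := by
    intro x
    rw [← ENNReal.ofReal_mul (by unfold mixture; positivity)]
    refine ENNReal.ofReal_le_ofReal ?_
    have h1 := noiseEnergy_snoc_le hk hlam (visited f h) (scaledNoise sg h) y (x / sg)
    have h2 : √(1 + s) = Real.exp (Real.log (1 + s) / 2) := by
      rw [Real.exp_half, Real.exp_log h1s]
    rw [mixture, mixture, visited_snoc, scaledNoise_snoc, infoDet_snoc hk hlam,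
      Real.log_mul (by linarith) h1s.ne', h2, ← Real.exp_sub, ← Real.exp_add, Real.exp_le_exp]
    linarith
  have hmap : ∫⁻ x, ENNReal.ofReal
      (Real.exp (((x / sg) ^ 2 - (x / sg - m) ^ 2 / (1 + s)) / 2)) ∂ν ≤
      ENNReal.ofReal (√(1 + s)) := by
    have hd : Measurable fun x : ℝ => x / sg := measurable_id.div_const _
    have h3 := lintegral_exp_quadratic_le (ν := ν.map fun x => x / sg) (fun g => by
      rw [lintegral_map (by fun_prop) hd]; exact hν g) m hs0
    rwa [lintegral_map (by fun_prop) hd] at h3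
  refine (lintegral_mono hle).trans ?_
  rw [lintegral_const_mul' _ _ ENNReal.ofReal_ne_top]
  refine (mul_le_mul_right hmap _).trans (le_of_eq ?_)
  rw [← ENNReal.ofReal_mul (by unfold mixture; positivity),
    div_mul_cancel₀ _ (Real.sqrt_pos.2 h1s).ne']

variable [MeasurableSpace A] [MeasurableSpace Z]

/-- The noise is an infinite sequence so that the laws for all `n` share one argument; only its
first `n` terms count. -/
theorem gameLaw_congr (p : ∀ n : ℕ, (Fin n → A × Z × ℝ) → Z → A → ℝ) (ζ : Measure Z)
    {e e' : ℕ → ℝ} {n : ℕ} (h : ∀ i < n, e i = e' i) : gameLaw p ζ e n = gameLaw p ζ e' n := by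
  have : (fun t : Fin n => e t) = fun t : Fin n => e' t := funext fun t => h t t.isLt
  simp only [gameLaw, this]

variable [Fintype A] [MeasurableSpace O]
  {p : ∀ n : ℕ, (Fin n → A × Z × ℝ) → Z → A → ℝ} {ζ : Measure Z}
  {f : ∀ n : ℕ, (Fin n → A × Z × ℝ) → O}

/-- The mean of the mixture supermartingale given the noise is a supermartingale. -/
theorem lintegral_mixture_update_le [IsProbabilityMeasure ζ] (hp : IsStrategy p)
    (hk : ∀ x y, k x y = inner ℝ (φ x) (φ y)) (hlam : 0 < lam)
    (hkm : Measurable fun p : (A × O × Z) × (A × O × Z) => k p.1 p.2)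
    (hf : ∀ n, Measurable (f n)) {ν : Measure ℝ} [SFinite ν] {sg : ℝ}
    (hν : ∀ g : ℝ, ∫⁻ x, ENNReal.ofReal (Real.exp (g * (x / sg) - g ^ 2 / 2)) ∂ν ≤ 1)
    (e : ℕ → ℝ) (n : ℕ) :
    ∫⁻ x, ∫⁻ h, ENNReal.ofReal (mixture k lam sg f h)
        ∂gameLaw p ζ (Function.update e n x) (n + 1) ∂ν ≤
      ∫⁻ h, ENNReal.ofReal (mixture k lam sg f h) ∂gameLaw p ζ e n := by
  have := isProbabilityMeasure_gameLaw (ζ := ζ) hp e n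
  obtain ⟨Φ, hΦ⟩ : ∃ Φ : (Fin n → A × Z × ℝ) → Z → ℝ → A → ENNReal, ∀ h z x a,
      ENNReal.ofReal (mixture k lam sg f (Fin.snoc h (a, z, x) : Fin (n + 1) → A × Z × ℝ)) =
        Φ h z x a := ⟨_, fun _ _ _ _ => rfl⟩
  have hΦm : ∀ a, Measurable fun q : ((Fin n → A × Z × ℝ) × Z) × ℝ => Φ q.1.1 q.1.2 q.2 a := by
    intro a
    simp only [← hΦ]
    exact ((measurable_mixture hkm lam sg hf (n + 1)).comp (measurable_snoc
      (measurable_fst.comp measurable_fst) (measurable_const.prodMk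
        ((measurable_snd.comp measurable_fst).prodMk measurable_snd)))).ennreal_ofReal
  have hΦle : ∀ h z a, ∫⁻ x, Φ h z x a ∂ν ≤ ENNReal.ofReal (mixture k lam sg f h) := by
    intro h z a
    simp only [← hΦ]
    exact lintegral_mixture_snoc_le hk hlam hν f h a z
  have hsum : Measurable fun q : ((Fin n → A × Z × ℝ) × Z) × ℝ =>
      ∑ a, ENNReal.ofReal (p n q.1.1 q.1.2 a) * Φ q.1.1 q.1.2 q.2 a :=
    Finset.measurable_fun_sum _ fun a _ =>
      ((hp.measurable n a).comp measurable_fst).ennreal_ofReal.mul (hΦm a)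
  have hsum' : Measurable fun q : (ℝ × (Fin n → A × Z × ℝ)) × Z =>
      ∑ a, ENNReal.ofReal (p n q.1.2 q.2 a) * Φ q.1.2 q.2 q.1.1 a :=
    hsum.comp (((measurable_snd.comp measurable_fst).prodMk measurable_snd).prodMk
      (measurable_fst.comp measurable_fst))
  calc _ = ∫⁻ x, ∫⁻ h, ∫⁻ z, ∑ a, ENNReal.ofReal (p n h z a) * Φ h z x a ∂ζ
        ∂gameLaw p ζ e n ∂ν := by
        refine lintegral_congr fun x => ?_
        rw [lintegral_gameLaw_succ hp _ (measurable_mixture hkm lam sg hf (n + 1)).ennreal_ofReal,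
          gameLaw_congr p ζ (e' := e) fun i hi => Function.update_of_ne hi.ne _ _,
          Function.update_self]
        simp only [hΦ]
    -- The new noise term affects neither the past nor the context and action of its own round, so
    -- it can be integrated first, where the one-step bound applies for each history, context and
    -- action.
    _ = ∫⁻ h, ∫⁻ x, ∫⁻ z, ∑ a, ENNReal.ofReal (p n h z a) * Φ h z x a ∂ζ ∂ν
        ∂gameLaw p ζ e n := by
        refine lintegral_lintegral_swap (Measurable.aemeasurable ?_)
        exact hsum'.lintegral_prod_right'
    _ = ∫⁻ h, ∫⁻ z, ∫⁻ x, ∑ a, ENNReal.ofReal (p n h z a) * Φ h z x a ∂ν ∂ζ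
        ∂gameLaw p ζ e n := by
        refine lintegral_congr fun h => lintegral_lintegral_swap (Measurable.aemeasurable ?_)
        exact hsum.comp ((measurable_const.prodMk measurable_snd).prodMk measurable_fst)
    _ ≤ ∫⁻ h, ∫⁻ _z, ENNReal.ofReal (mixture k lam sg f h) ∂ζ ∂gameLaw p ζ e n := by
        refine lintegral_mono fun h => lintegral_mono fun z => ?_
        rw [lintegral_finsetSum]
        · rw [← hp.sum_ofReal_mul h z (ENNReal.ofReal (mixture k lam sg f h))]
          refine Finset.sum_le_sum fun a _ => ?_
          rw [lintegral_const_mul' _ _ ENNReal.ofReal_ne_top]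
          exact mul_le_mul_right (hΦle h z a) _
        · intro a _
          have hx : Measurable fun x : ℝ => ((h, z), x) := measurable_prodMk_left
          exact Measurable.const_mul ((hΦm a).comp hx) _
    _ = _ := by simp

theorem measurable_lintegral_gameLaw [IsProbabilityMeasure ζ] (hp : IsStrategy p) {n : ℕ}
    {F : (Fin n → A × Z × ℝ) → ENNReal} (hF : Measurable F) :
    Measurable fun e : ℕ → ℝ => ∫⁻ h, F h ∂gameLaw p ζ e n := by
  simp only [lintegral_gameLaw hp _ hF]
  refine Finset.measurable_fun_sum _ fun a _ => ?_
  have he : Measurable fun q : (ℕ → ℝ) × (Fin n → Z) => fun t : Fin n => q.1 t :=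
    measurable_pi_lambda _ fun t => (measurable_pi_apply _).comp measurable_fst
  exact Measurable.lintegral_prod_right' (f := fun q : (ℕ → ℝ) × (Fin n → Z) =>
    ENNReal.ofReal (pathProb p (fun t : Fin n => q.1 t) q.2 a) *
      F (history a q.2 fun t : Fin n => q.1 t))
    (((hp.measurable_pathProb a).comp (he.prodMk measurable_snd)).ennreal_ofReal.mul
      (hF.comp (measurable_history a measurable_snd he)))

end Supermartingale

/-! ### Maximal inequality -/

section Ville

variable {Ω : Type*} [MeasurableSpace Ω] {P : Measure Ω} [IsProbabilityMeasure P]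

/-- Extension of a finite sequence by zero. -/
def extendZero {n : ℕ} (v : Fin n → ℝ) (i : ℕ) : ℝ := if h : i < n then v ⟨i, h⟩ else 0

theorem measurable_extendZero (n : ℕ) : Measurable fun v : Fin n → ℝ => extendZero v := by
  refine measurable_pi_lambda _ fun i => ?_
  by_cases h : i < n
  · simpa [extendZero, h] using measurable_pi_apply _
  · simp [extendZero, h]

/-- The integral of the next value of a supermartingale over an event of the past. -/
theorem setLIntegral_next_le {ξ : ℕ → Ω → ℝ} (hξ : ∀ n, Measurable (ξ n)) {n : ℕ}
    (hind : IndepFun (fun ω (i : Fin n) => ξ i ω) (ξ n) P) {m m' : (ℕ → ℝ) → ENNReal}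
    (hm' : Measurable m')
    (hdep : ∀ e e' : ℕ → ℝ, (∀ i < n, e i = e' i) → m e = m e')
    (hdep' : ∀ e e' : ℕ → ℝ, (∀ i < n + 1, e i = e' i) → m' e = m' e')
    (hstep : ∀ e, ∫⁻ x, m' (Function.update e n x) ∂(P.map (ξ n)) ≤ m e)
    {U : Set (ℕ → ℝ)} (hU : MeasurableSet U)
    (hUdep : ∀ e e' : ℕ → ℝ, (∀ i < n, e i = e' i) → (e ∈ U ↔ e' ∈ U)) :
    ∫⁻ ω in {ω | (fun i => ξ i ω) ∈ U}, m' (fun i => ξ i ω) ∂P ≤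
      ∫⁻ ω in {ω | (fun i => ξ i ω) ∈ U}, m (fun i => ξ i ω) ∂P := by
  have hξm : Measurable fun ω => fun i => ξ i ω := measurable_pi_lambda _ hξ
  have hS : MeasurableSet {ω | (fun i => ξ i ω) ∈ U} := hξm hU
  have hv : Measurable fun ω => fun i : Fin n => ξ i ω := measurable_pi_lambda _ fun i => hξ i
  -- The past event is read off the vector of the first `n` terms, so that independence factors the
  -- joint law of this vector and the next term.
  set V : Set (Fin n → ℝ) := {v | extendZero v ∈ U}
  have hV : MeasurableSet V := measurable_extendZero n hU
  have hagree : ∀ ω, ∀ i < n, ξ i ω = extendZero (fun i : Fin n => ξ i ω) i := by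
    intro ω i hi
    simp [extendZero, hi]
  have hUV : ∀ ω, (fun i => ξ i ω) ∈ U ↔ (fun i : Fin n => ξ i ω) ∈ V := fun ω =>
    hUdep _ _ (hagree ω)
  have hupd : Measurable fun q : (Fin n → ℝ) × ℝ => Function.update (extendZero q.1) n q.2 := by
    refine measurable_pi_lambda _ fun i => ?_
    by_cases h : i = n
    · subst h; simpa using measurable_snd
    · simp only [Function.update_of_ne h]
      exact (measurable_pi_apply i).comp ((measurable_extendZero n).comp measurable_fst)
  have hG : Measurable fun q : (Fin n → ℝ) × ℝ => V.indicator 1 q.1 *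
      m' (Function.update (extendZero q.1) n q.2) :=
    ((measurable_one.indicator hV).comp measurable_fst).mul (hm'.comp hupd)
  rw [← lintegral_indicator hS, ← lintegral_indicator hS]
  calc _ = ∫⁻ ω, V.indicator 1 (fun i : Fin n => ξ i ω) *
        m' (Function.update (extendZero fun i : Fin n => ξ i ω) n (ξ n ω)) ∂P := by
        refine lintegral_congr fun ω => ?_
        have e1 : m' (fun i => ξ i ω) =
            m' (Function.update (extendZero fun i : Fin n => ξ i ω) n (ξ n ω)) := by
          refine hdep' _ _ fun i hi => ?_
          rcases Nat.lt_succ_iff_lt_or_eq.1 hi with h | rfl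
          · rw [Function.update_of_ne h.ne, ← hagree ω i h]
          · simp
        by_cases hω : (fun i => ξ i ω) ∈ U
        · rw [Set.indicator_of_mem (by exact hω), Set.indicator_of_mem ((hUV ω).1 hω), e1]
          simp
        · rw [Set.indicator_of_notMem (by exact hω),
            Set.indicator_of_notMem (fun h => hω ((hUV ω).2 h))]
          simp
    _ = ∫⁻ q, V.indicator 1 q.1 * m' (Function.update (extendZero q.1) n q.2)
        ∂(P.map fun ω => ((fun i : Fin n => ξ i ω), ξ n ω)) := by
        rw [lintegral_map hG (hv.prodMk (hξ n))]
    _ = ∫⁻ v, ∫⁻ x, V.indicator 1 v * m' (Function.update (extendZero v) n x)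
        ∂(P.map (ξ n)) ∂(P.map fun ω => fun i : Fin n => ξ i ω) := by
        rw [(indepFun_iff_map_prod_eq_prod_map_map hv.aemeasurable (hξ n).aemeasurable).1 hind,
          lintegral_prod _ hG.aemeasurable]
    _ ≤ ∫⁻ v, V.indicator 1 v * m (extendZero v)
        ∂(P.map fun ω => fun i : Fin n => ξ i ω) := by
        refine lintegral_mono fun v => ?_
        rw [lintegral_const_mul' _ _ (by
          by_cases h : v ∈ V <;> simp [h])]
        exact mul_le_mul_right (hstep _) _
    _ ≤ ∫⁻ ω, V.indicator 1 (fun i : Fin n => ξ i ω) *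
        m (extendZero fun i : Fin n => ξ i ω) ∂P := lintegral_map_le _ _
    _ = _ := by
        refine lintegral_congr fun ω => ?_
        rw [← hdep _ _ (hagree ω)]
        by_cases hω : (fun i => ξ i ω) ∈ U
        · rw [Set.indicator_of_mem ((hUV ω).1 hω), Set.indicator_of_mem (by exact hω)]
          simp
        · rw [Set.indicator_of_notMem (fun h => hω ((hUV ω).2 h)),
            Set.indicator_of_notMem (by exact hω)]
          simp

/-- Ville's maximal inequality for a nonnegative supermartingale in the filtration of an
independent sequence. -/
theorem ville {ξ : ℕ → Ω → ℝ} (hξ : ∀ n, Measurable (ξ n)) {T : ℕ}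
    (hind : ∀ n < T, IndepFun (fun ω (i : Fin n) => ξ i ω) (ξ n) P) {m : ℕ → (ℕ → ℝ) → ENNReal}
    (hm : ∀ n, Measurable (m n))
    (hdep : ∀ n, ∀ e e' : ℕ → ℝ, (∀ i < n, e i = e' i) → m n e = m n e')
    (hstep : ∀ n < T, ∀ e, ∫⁻ x, m (n + 1) (Function.update e n x) ∂(P.map (ξ n)) ≤ m n e)
    (h0 : ∀ e, m 0 e ≤ 1) {c : ENNReal} (hc : 1 ≤ c) :
    c * P {ω | ¬ ∀ j ≤ T, m j (fun i => ξ i ω) ≤ c} ≤ 1 := by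
  have hξm : Measurable fun ω => fun i => ξ i ω := measurable_pi_lambda _ hξ
  set U : ℕ → Set (ℕ → ℝ) := fun n => {e | ∀ j ≤ n, m j e ≤ c} with hUdef
  have hU : ∀ n, MeasurableSet (U n) := by
    intro n
    simp only [hUdef, Set.ofPred_forall]
    exact MeasurableSet.iInter fun j => MeasurableSet.iInter fun _ =>
      measurableSet_le (hm j) measurable_const
  set S : ℕ → Set Ω := fun n => {ω | (fun i => ξ i ω) ∈ U n} with hSdef
  have hS : ∀ n, MeasurableSet (S n) := fun n => hξm (hU n)
  -- The integral over the paths that have stayed below `c`, plus `c` times the probability of the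
  -- others, does not increase in `n`. This takes the place of a stopping time.
  have key : ∀ n ≤ T, ∫⁻ ω in S n, m n (fun i => ξ i ω) ∂P + c * P (S n)ᶜ ≤ 1 := by
    intro n
    induction n with
    | zero =>
      intro _
      have : S 0 = Set.univ := by
        ext ω
        simp only [hSdef, hUdef, Set.mem_ofPred_eq, Set.mem_univ, iff_true]
        intro j hj
        obtain rfl : j = 0 := by omega
        exact (h0 _).trans hc
      rw [this]
      simp only [Measure.restrict_univ, Set.compl_univ, measure_empty, mul_zero, add_zero]
      calc _ ≤ ∫⁻ _, 1 ∂P := lintegral_mono fun ω => h0 _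
        _ = 1 := by simp
    | succ n ih =>
      intro hn
      refine le_trans ?_ (ih (by omega))
      have h1 := setLIntegral_next_le hξ (hind n (by omega)) (hm (n + 1)) (hdep n)
        (hdep (n + 1)) (hstep n (by omega)) (hU n) (by
          intro e e' h
          simp only [hUdef, Set.mem_ofPred_eq]
          refine forall₂_congr fun j hj => ?_
          rw [hdep j e e' fun i hi => h i (by omega)])
      refine le_trans ?_ (add_le_add h1 le_rfl)
      change _ ≤ ∫⁻ ω in S n, m (n + 1) (fun i => ξ i ω) ∂P + _
      have hsub : S (n + 1) ⊆ S n := fun ω hω j hj => hω j (by omega)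
      have hdiff : S n = S (n + 1) ∪ (S n \ S (n + 1)) := (Set.union_sdiff_cancel hsub).symm
      have h2 : ∫⁻ ω in S n, m (n + 1) (fun i => ξ i ω) ∂P =
          ∫⁻ ω in S (n + 1), m (n + 1) (fun i => ξ i ω) ∂P +
            ∫⁻ ω in S n \ S (n + 1), m (n + 1) (fun i => ξ i ω) ∂P := by
        conv_lhs => rw [hdiff]
        exact lintegral_union ((hS n).diff (hS (n + 1))) disjoint_sdiff_self_right
      have h3 : c * P (S n \ S (n + 1)) ≤
          ∫⁻ ω in S n \ S (n + 1), m (n + 1) (fun i => ξ i ω) ∂P := by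
        rw [← setLIntegral_const]
        refine setLIntegral_mono ((hm (n + 1)).comp hξm) fun ω hω => ?_
        by_contra hlt
        refine hω.2 fun j hj => ?_
        rcases Nat.le_succ_iff.1 hj with h | rfl
        · exact hω.1 j h
        · exact (not_le.1 hlt).le
      have h4 : P (S (n + 1))ᶜ ≤ P (S n \ S (n + 1)) + P (S n)ᶜ := by
        refine (measure_mono ?_).trans (measure_union_le _ _)
        intro ω hω
        by_cases h : ω ∈ S n
        · exact Or.inl ⟨h, hω⟩
        · exact Or.inr h
      rw [h2, add_assoc]
      refine add_le_add le_rfl ?_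
      calc _ ≤ c * (P (S n \ S (n + 1)) + P (S n)ᶜ) := by gcongr
        _ = c * P (S n \ S (n + 1)) + c * P (S n)ᶜ := mul_add _ _ _
        _ ≤ _ := by gcongr
  exact (le_add_self).trans (key T le_rfl)

end Ville

/-! ### The good noise event -/

section NoiseEvent

variable {Ω : Type*} [MeasurableSpace Ω] {P : Measure Ω}

/-- The sub-Gaussian bound at g/σ. For σ = 0 division by zero gives 0, and the integrand is
exp(-g²/2) ≤ 1. -/
theorem lintegral_exp_scaled_le {X : Ω → ℝ} (hX : Measurable X) {sg : ℝ≥0}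
    (h : HasSubgaussianMGF X (sg ^ 2) P) (g : ℝ) :
    ∫⁻ x, ENNReal.ofReal (Real.exp (g * (x / sg) - g ^ 2 / 2)) ∂(P.map X) ≤ 1 := by
  rw [lintegral_map (by fun_prop) hX]
  have e1 : ∀ ω, Real.exp (g * (X ω / sg) - g ^ 2 / 2) =
      Real.exp (-(g ^ 2 / 2)) * Real.exp (g / sg * X ω) := by
    intro ω
    rw [← Real.exp_add]; congr 1; ring
  simp only [e1]
  rw [← ofReal_integral_eq_lintegral_ofReal ((h.integrable_exp_mul _).const_mul _)
    (Filter.Eventually.of_forall fun ω => by positivity), integral_const_mul]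
  rw [ENNReal.ofReal_le_one]
  have h1 := h.mgf_le (g / sg)
  rw [mgf] at h1
  calc _ ≤ Real.exp (-(g ^ 2 / 2)) * Real.exp (((sg ^ 2 : ℝ≥0) : ℝ) * (g / sg) ^ 2 / 2) := by
        gcongr
    _ ≤ 1 := by
        rw [← Real.exp_add, Real.exp_le_one_iff]
        rcases eq_or_ne sg 0 with rfl | hs
        · simp; positivity
        · have : (sg : ℝ) ≠ 0 := by exact_mod_cast hs
          push_cast
          apply le_of_eq
          field_simp
          ring

theorem indepFun_past {T : ℕ} {ε : Fin T → Ω → ℝ} (hε : ∀ t, Measurable (ε t))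
    (hind : iIndepFun ε P) {n : ℕ} (hn : n < T) :
    IndepFun (fun ω (i : Fin n) => extendZero (fun t => ε t ω) i)
      (fun ω => extendZero (fun t => ε t ω) n) P := by
  have hlt : ∀ i : Fin n, (i : ℕ) < T := fun i => i.isLt.trans hn
  set S : Finset (Fin T) := Finset.univ.filter fun i : Fin T => (i : ℕ) < n
  have hS : ∀ i : Fin n, (⟨i, hlt i⟩ : Fin T) ∈ S := fun i => by simp [S]
  have hL : (⟨n, hn⟩ : Fin T) ∈ ({⟨n, hn⟩} : Finset (Fin T)) := Finset.mem_singleton_self _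
  have h1 := hind.indepFun_finset S {⟨n, hn⟩} (by
    rw [Finset.disjoint_singleton_right]
    simp [S]) hε
  have hφ : Measurable fun (v : S → ℝ) (i : Fin n) => v ⟨⟨i, hlt i⟩, hS i⟩ := by fun_prop
  have hψ : Measurable fun v : ({⟨n, hn⟩} : Finset (Fin T)) → ℝ => v ⟨⟨n, hn⟩, hL⟩ := by fun_prop
  have h2 := h1.comp hφ hψ
  convert! h2 using 1
  · ext ω i
    simp [extendZero, hlt i]
  · ext ω
    simp [extendZero, hn]

variable {A O Z : Type*} [Fintype A] [MeasurableSpace A] [MeasurableSpace O] [MeasurableSpace Z]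
  {H : Type*} [NormedAddCommGroup H] [InnerProductSpace ℝ H]
  {φ : A × O × Z → H} {k : A × O × Z → A × O × Z → ℝ} {lam : ℝ}
  {p : ∀ n : ℕ, (Fin n → A × Z × ℝ) → Z → A → ℝ} {ζ : Measure Z}
  {f : ∀ n : ℕ, (Fin n → A × Z × ℝ) → O}

/-- The event that the mixture supermartingale, averaged over the contexts and the actions, stays
small. -/
theorem exists_noise_event [IsProbabilityMeasure P] [IsProbabilityMeasure ζ] (hp : IsStrategy p)
    (hk : ∀ x y, k x y = inner ℝ (φ x) (φ y)) (hlam : 0 < lam)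
    (hkm : Measurable fun p : (A × O × Z) × (A × O × Z) => k p.1 p.2)
    (hf : ∀ n, Measurable (f n)) {T : ℕ} {ε : Fin T → Ω → ℝ} (hε : ∀ t, Measurable (ε t))
    (hind : iIndepFun ε P) {sg : ℝ≥0} (hsub : ∀ t, HasSubgaussianMGF (ε t) (sg ^ 2) P)
    {δ : ℝ} (hδ : δ ∈ Set.Ioo (0 : ℝ) 1) :
    ∃ G : Set Ω, MeasurableSet G ∧ ENNReal.ofReal (1 - δ) ≤ P G ∧ ∀ ω ∈ G,
      (sg = 0 → ∀ t, ε t ω = 0) ∧ ∀ n ≤ T, ∫⁻ h, ENNReal.ofReal (mixture k lam sg f h)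
        ∂gameLaw p ζ (extendZero fun t => ε t ω) n ≤ ENNReal.ofReal (1 / δ) := by
  set ξ : ℕ → Ω → ℝ := fun n ω => extendZero (fun t => ε t ω) n with hξdef
  have hξ : ∀ n, Measurable (ξ n) := fun n =>
    (measurable_pi_apply n).comp ((measurable_extendZero T).comp (measurable_pi_lambda _ hε))
  set m : ℕ → (ℕ → ℝ) → ENNReal := fun n e =>
    ∫⁻ h, ENNReal.ofReal (mixture k lam sg f h) ∂gameLaw p ζ e n with hmdef
  have hm : ∀ n, Measurable (m n) := fun n =>
    measurable_lintegral_gameLaw hp (measurable_mixture hkm lam sg hf n).ennreal_ofReal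
  have hξm : Measurable fun ω => fun i => ξ i ω := measurable_pi_lambda _ hξ
  have hδ1 : 1 ≤ 1 / δ := by rw [le_div_iff₀ hδ.1]; linarith [hδ.2]
  have hv := ville (P := P) hξ (T := T) (fun n hn => indepFun_past hε hind hn) hm
    (fun n e e' h => by simp only [hmdef, gameLaw_congr p ζ h])
    (fun n hn e => by
      have : IsProbabilityMeasure (P.map (ξ n)) :=
        Measure.isProbabilityMeasure_map (hξ n).aemeasurable
      refine lintegral_mixture_update_le hp hk hlam hkm hf (fun g => ?_) e n
      have : ξ n = ε ⟨n, hn⟩ := by ext ω; simp [hξdef, extendZero, hn]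
      rw [this]
      exact lintegral_exp_scaled_le (hε _) (hsub _) g)
    (fun e => by
      have := isProbabilityMeasure_gameLaw (ζ := ζ) hp e 0
      calc m 0 e ≤ ∫⁻ _, 1 ∂gameLaw p ζ e 0 := lintegral_mono fun h => by
            rw [mixture, noiseEnergy, infoDet_zero]; simp [dotProduct]
        _ = 1 := by simp) (c := ENNReal.ofReal (1 / δ)) (by
          rw [← ENNReal.ofReal_one]; exact ENNReal.ofReal_le_ofReal hδ1)
  set G1 : Set Ω := {ω | ∀ j ≤ T, m j (fun i => ξ i ω) ≤ ENNReal.ofReal (1 / δ)} with hG1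
  -- For σ = 0 the normalized noise is 0 by convention and does not determine the noise. The event
  -- therefore also records that the noise vanishes, which then holds almost surely.
  set G2 : Set Ω := {ω | sg = 0 → ∀ t, ε t ω = 0} with hG2
  have hG1m : MeasurableSet G1 := by
    simp only [hG1, Set.ofPred_forall]
    exact MeasurableSet.iInter fun j => MeasurableSet.iInter fun _ =>
      measurableSet_le ((hm j).comp hξm) measurable_const
  have hG2m : MeasurableSet G2 := by
    simp only [hG2, Set.ofPred_forall]
    exact MeasurableSet.iInter fun _ => MeasurableSet.iInter fun t =>
      hε t (measurableSet_singleton 0)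
  have hG2P : P G2ᶜ = 0 := by
    change ∀ᵐ ω ∂P, ω ∈ G2
    by_cases hs : sg = 0
    · subst hs
      have : ∀ t, ∀ᵐ ω ∂P, ε t ω = 0 := fun t => by
        have := hsub t
        rw [zero_pow two_ne_zero] at this
        exact this.ae_eq_zero_of_hasSubgaussianMGF_zero
      filter_upwards [ae_all_iff.2 this] with ω hω using fun _ => hω
    · exact Filter.Eventually.of_forall fun ω h => absurd h hs
  have hG1P : P G1ᶜ ≤ ENNReal.ofReal δ := by
    have h1 : ENNReal.ofReal (1 / δ) * P G1ᶜ ≤ 1 := hv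
    calc P G1ᶜ = ENNReal.ofReal δ * (ENNReal.ofReal (1 / δ) * P G1ᶜ) := by
          rw [← mul_assoc, ← ENNReal.ofReal_mul hδ.1.le, mul_one_div_cancel hδ.1.ne',
            ENNReal.ofReal_one, one_mul]
      _ ≤ ENNReal.ofReal δ * 1 := by gcongr
      _ = _ := mul_one _
  refine ⟨G1 ∩ G2, hG1m.inter hG2m, ?_, fun ω hω => ⟨hω.2, hω.1⟩⟩
  have hc : P (G1 ∩ G2)ᶜ ≤ ENNReal.ofReal δ := by
    rw [Set.compl_inter]
    refine (measure_union_le _ _).trans ?_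
    rw [hG2P, add_zero]
    exact hG1P
  rw [ENNReal.ofReal_sub _ hδ.1.le, ENNReal.ofReal_one, tsub_le_iff_right,
    ← prob_add_prob_compl (μ := P) (hG1m.inter hG2m)]
  gcongr

end NoiseEvent

/-! ### Confidence bounds in terms of the noise energy -/

section Confidence

variable {X : Type*} {H : Type*} [NormedAddCommGroup H] [InnerProductSpace ℝ H]
  {φ : X → H} {k : X → X → ℝ} {lam : ℝ} {ρ : H} {R : X → ℝ} {B θ sg : ℝ}

/-- The error is a bias, the pairing of ρ with the residual of φ(y), whose norm is at most √v by the
formula for the posterior variance, minus the posterior mean of the noise, controlled by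
`noiseMean_sq_le`. -/
theorem abs_sub_postMean_le (hk : ∀ x y, k x y = inner ℝ (φ x) (φ y)) (hlam : 0 < lam)
    (hR : ∀ x, R x = inner ℝ ρ (φ x)) (hsg : 0 ≤ sg) {n : ℕ} (x : Fin n → X) (s : Fin n → ℝ)
    (y : X) :
    |R y - postMean k lam (fun j => (x j, R (x j) + sg * s j)) y| ≤
      (‖ρ‖ + sg / √lam * √(noiseEnergy k lam x s)) * √(designVar k lam x y) := by
  set w := (ridge k lam x)⁻¹ *ᵥ kerVec k x y with hw
  set v := designVar k lam x y with hv
  have hv0 : 0 ≤ v := designVar_nonneg hk hlam x y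
  have h1 : postMean k lam (fun j => (x j, R (x j) + sg * s j)) y =
      inner ℝ ρ (∑ j, w j • φ (x j)) + sg * noiseMean k lam x s y := by
    have e1 : (fun j => R (x j) + sg * s j) = (fun j => R (x j)) + sg • s := rfl
    have e2 : postMean k lam (fun j => (x j, R (x j) + sg * s j)) y =
      kerVec k x y ⬝ᵥ ((ridge k lam x)⁻¹ *ᵥ fun j => R (x j) + sg * s j) := rfl
    rw [e2, e1, Matrix.mulVec_add, dotProduct_add, ← noiseMean_smul]
    congr 1
    rw [dotProduct_ridge_inv_comm hk hlam, inner_sum, dotProduct]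
    refine Finset.sum_congr rfl fun j _ => ?_
    rw [inner_smul_right, hR, mul_comm]
  have h2 : |inner ℝ ρ (φ y - ∑ j, w j • φ (x j))| ≤ ‖ρ‖ * √v := by
    refine (abs_real_inner_le_norm _ _).trans (mul_le_mul_of_nonneg_left ?_ (norm_nonneg _))
    refine Real.le_sqrt_of_sq_le ?_
    have := designVar_eq hk hlam x y
    have h3 : 0 ≤ w ⬝ᵥ w := Finset.sum_nonneg fun j _ => mul_self_nonneg _
    rw [← hw, ← hv] at this
    nlinarith
  have h3 : |noiseMean k lam x s y| ≤ √(noiseEnergy k lam x s) / √lam * √v := by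
    refine abs_le_of_sq_le_sq ?_ (by positivity)
    rw [mul_pow, div_pow, Real.sq_sqrt hlam.le, Real.sq_sqrt hv0,
      Real.sq_sqrt (noiseEnergy_nonneg hk hlam x s)]
    refine (noiseMean_sq_le hk hlam x s y).trans (le_of_eq ?_)
    rw [← hv]; ring
  have h4 : R y - postMean k lam (fun j => (x j, R (x j) + sg * s j)) y =
      inner ℝ ρ (φ y - ∑ j, w j • φ (x j)) - sg * noiseMean k lam x s y := by
    rw [h1, hR, inner_sub_right]; ring
  rw [h4]
  refine (abs_sub _ _).trans ?_
  rw [abs_mul, abs_of_nonneg hsg, add_mul]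
  refine add_le_add h2 ((mul_le_mul_of_nonneg_left h3 hsg).trans (le_of_eq ?_))
  ring

variable {β : ℕ → ℝ} {l : ℝ}

/-- The cost of a failure of the upper confidence bound. -/
theorem sub_ucb_le [Nonempty X] (hk : ∀ x y, k x y = inner ℝ (φ x) (φ y)) (hlam : 1 ≤ lam)
    (hk1 : ∀ x, k x x ≤ 1) (hR : ∀ x, R x = inner ℝ ρ (φ x)) (hρ : ‖ρ‖ ≤ B) (hsg : 0 ≤ sg)
    (hl : 0 ≤ l) {n : ℕ} (hβ : β (n + 1) = B + sg / √lam * √(2 * (infoGain k lam n + l)))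
    (x : Fin (n + 1) → X) (s : Fin (n + 1) → ℝ) {y : X} (hy : R y ≤ 1) :
    R y - ucb k lam β (fun j => (x j, R (x j) + sg * s j)) y ≤
      sg / √lam * (failCoef lam n *
        Real.exp (noiseEnergy k lam x s / 2 - Real.log (infoDet k lam x) / 2 - l)) := by
  have h0 : 0 < lam := by linarith
  have hθ : 0 ≤ sg / √lam := by positivity
  have hc := (abs_le.1 (abs_sub_postMean_le hk h0 hR hsg x s y)).2
  have hf := posPart_mul_sqrt_designVar_le hk hlam hk1 x y hl (√(noiseEnergy k lam x s))
  rw [Real.sq_sqrt (noiseEnergy_nonneg hk h0 x s)] at hf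
  have hS := Real.sqrt_nonneg (designVar k lam x y)
  have hnn : 0 ≤ failCoef lam n *
        Real.exp (noiseEnergy k lam x s / 2 - Real.log (infoDet k lam x) / 2 - l) :=
    mul_nonneg (failCoef_nonneg _ _) (Real.exp_pos _).le
  rw [sub_le_comm, ucb]
  -- The truncation at 1 costs nothing because the reward is at most 1.
  refine le_min ?_ (by nlinarith [mul_nonneg hθ hnn])
  rw [postVar_eq_designVar, hβ, sub_le_iff_le_add]
  have h1 := mul_le_mul_of_nonneg_left
    ((mul_le_mul_of_nonneg_right (le_max_left (√(noiseEnergy k lam x s) -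
      √(2 * (infoGain k lam n + l))) 0) hS).trans hf) hθ
  have h2 := mul_le_mul_of_nonneg_right hρ hS
  change R y ≤ _ + (B + _) * √(designVar k lam x y) + _
  nlinarith

/-- The cost of an optimistic upper confidence bound. -/
theorem ucb_sub_le [Nonempty X] (hk : ∀ x y, k x y = inner ℝ (φ x) (φ y)) (hlam : 1 ≤ lam)
    (hk1 : ∀ x, k x x ≤ 1) (hR : ∀ x, R x = inner ℝ ρ (φ x)) (hρ : ‖ρ‖ ≤ B) (hsg : 0 ≤ sg)
    {n m : ℕ} (hnm : n + 1 ≤ m)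
    (hβ : β (n + 1) = B + sg / √lam * √(2 * (infoGain k lam n + l)))
    (x : Fin (n + 1) → X) (s : Fin (n + 1) → ℝ) {y : X} (hy : 0 ≤ R y) {b κ : ℝ} (hb : 0 < b)
    (hbm : b = √(2 * (infoGain k lam m + l))) (hκ : 0 < κ) :
    max (ucb k lam β (fun j => (x j, R (x j) + sg * s j)) y) 0 - R y ≤
      (B + sg / √lam * b) * κ + sg / √lam * κ / b *
        (Real.exp (noiseEnergy k lam x s / 2 - Real.log (infoDet k lam x) / 2 - l) - 1) +
      (B + sg / √lam * b) / κ * designVar k lam (Fin.take n n.le_succ x) y := by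
  have h0 : 0 < lam := by linarith
  have hθ : 0 ≤ sg / √lam := by positivity
  have hB : 0 ≤ B := (norm_nonneg _).trans hρ
  set θ := sg / √lam with hθd
  set N := noiseEnergy k lam x s with hN
  have hN0 : 0 ≤ N := noiseEnergy_nonneg hk h0 x s
  set L := Real.log (infoDet k lam x) with hL
  set E := Real.exp (N / 2 - L / 2 - l) with hE
  set v := designVar k lam (Fin.take n n.le_succ x) y with hv
  have hv0 : 0 ≤ v := designVar_nonneg hk h0 _ _
  -- Dropping the newest point leaves a variance determined by the earlier rounds, as the passage to
  -- a fresh context requires.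
  have hvv : designVar k lam x y ≤ v :=
    designVar_anti hk h0 x (Fin.castLE n.le_succ) (Fin.castLE_injective _) y
  have hb2 : b ^ 2 = 2 * (infoGain k lam m + l) := by
    rw [hbm, Real.sq_sqrt]
    by_contra hneg
    rw [hbm, Real.sqrt_eq_zero_of_nonpos (by linarith)] at hb
    exact lt_irrefl _ hb
  have hbb : √(2 * (infoGain k lam n + l)) ≤ b := by
    rw [hbm]
    have := infoGain_mono hk hlam hk1 (by omega : n ≤ m)
    gcongr
  -- From 1 + t ≤ exp t. Since `E - 1` will have nonpositive mean, the energy may be treated as `b ^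
  -- 2` in expectation.
  have hNE : N ≤ 2 * (E - 1) + b ^ 2 := by
    have h1 := Real.add_one_le_exp (N / 2 - L / 2 - l)
    have h2 : L ≤ 2 * infoGain k lam (n + 1) := log_infoDet_le_infoGain hk hlam hk1 x
    have h3 := infoGain_mono hk hlam hk1 hnm
    rw [hb2]
    linarith
  have hu : max (ucb k lam β (fun j => (x j, R (x j) + sg * s j)) y) 0 - R y ≤
      (2 * B + θ * b + θ * √N) * √v := by
    have hc := (abs_le.1 (abs_sub_postMean_le hk h0 hR hsg x s y)).1
    have hS : √(designVar k lam x y) ≤ √v := Real.sqrt_le_sqrt hvv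
    have hS0 := Real.sqrt_nonneg (designVar k lam x y)
    have h1 : postMean k lam (fun j => (x j, R (x j) + sg * s j)) y +
        β (n + 1) * √(designVar k lam x y) - R y ≤
        (2 * B + θ * b + θ * √N) * √(designVar k lam x y) := by
      rw [hβ]
      have h2 := mul_le_mul_of_nonneg_right hρ hS0
      have h3 := mul_le_mul_of_nonneg_right (mul_le_mul_of_nonneg_left hbb hθ) hS0
      nlinarith
    have h4 : (2 * B + θ * b + θ * √N) * √(designVar k lam x y) ≤
        (2 * B + θ * b + θ * √N) * √v := by gcongr
    have h5 : 0 ≤ (2 * B + θ * b + θ * √N) * √v := by positivity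
    rw [sub_le_iff_le_add]
    refine max_le ((min_le_left _ _).trans ?_) (by linarith)
    rw [postVar_eq_designVar]
    change _ + _ * √(designVar k lam x y) ≤ _
    linarith
  refine hu.trans ?_
  have hv2 := Real.sq_sqrt hv0
  have hN2 := Real.sq_sqrt hN0
  -- √v and √(Nv) are linearized by the inequality of the means, so that expectations can be taken
  -- term by term. The parameter κ is fixed after integration.
  have a1 : 2 * √v ≤ κ + v / κ := by
    have : 0 ≤ (κ - √v) ^ 2 / κ := by positivity
    have e : (κ - √v) ^ 2 / κ = κ + √v ^ 2 / κ - 2 * √v := by field_simp; ring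
    rw [hv2] at e
    linarith
  have a2 : 2 * (√N * √v) ≤ κ / b * N + b / κ * v := by
    have : 0 ≤ (κ * √N - b * √v) ^ 2 / (κ * b) := by positivity
    have e : (κ * √N - b * √v) ^ 2 / (κ * b) =
        κ / b * √N ^ 2 + b / κ * √v ^ 2 - 2 * (√N * √v) := by field_simp; ring
    rw [hv2, hN2] at e
    linarith
  have a3 : κ / b * N ≤ κ / b * (2 * (E - 1) + b ^ 2) :=
    mul_le_mul_of_nonneg_left hNE (by positivity)
  have a4 : κ / b * (2 * (E - 1) + b ^ 2) = 2 * (κ / b * (E - 1)) + κ * b := by field_simp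
  have b1 := mul_le_mul_of_nonneg_left a1 (by positivity : 0 ≤ B + θ * b / 2)
  have b2 := mul_le_mul_of_nonneg_left (a2.trans (add_le_add_left (a3.trans_eq a4) _)) hθ
  have e1 : (B + θ * b) * κ + θ * κ / b * (E - 1) + (B + θ * b) / κ * v =
      (B + θ * b / 2) * (κ + v / κ) +
        θ * (2 * (κ / b * (E - 1)) + κ * b + b / κ * v) / 2 := by field_simp; ring
  rw [e1]
  linarith

end Confidence

/-! ### Regret along one history in one fixed context -/

section Pathwise

variable {A O Z : Type*}
  {H : Type*} [NormedAddCommGroup H] [InnerProductSpace ℝ H]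
  {φ : A × O × Z → H} {k : A × O × Z → A × O × Z → ℝ} {lam : ℝ} {ρ : H} {R : A × O × Z → ℝ}
  {B sg l : ℝ} {β η : ℕ → ℝ} {f : ∀ n : ℕ, (Fin n → A × Z × ℝ) → O}

theorem observed_eq (R : A × O × Z → ℝ) (f : ∀ n : ℕ, (Fin n → A × Z × ℝ) → O) {n : ℕ}
    {h : Fin n → A × Z × ℝ} (hs : ∀ j, (h j).2.2 = sg * scaledNoise sg h j) :
    observed R f h = fun j => (visited f h j, R (visited f h j) + sg * scaledNoise sg h j) := by
  ext j : 1
  rw [observed, hs]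

variable [Fintype A] [Nonempty A]

/-- The regret along a history in a fixed context, for the actions that the algorithm would choose
in this context. -/
theorem sum_regret_le [Nonempty (A × O × Z)]
    (hk : ∀ x y, k x y = inner ℝ (φ x) (φ y)) (hlam : 1 ≤ lam)
    (hk1 : ∀ x, k x x ≤ 1) (hR : ∀ x, R x = inner ℝ ρ (φ x)) (hR01 : ∀ x, R x ∈ Set.Icc (0 : ℝ) 1)
    (hρ : ‖ρ‖ ≤ B) (hsg : 0 ≤ sg) (hl : 0 ≤ l)
    (hβ : ∀ n, β (n + 1) = B + sg / √lam * √(2 * (infoGain k lam n + l))) {N : ℕ}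
    (hη : ∀ t, η t = √(8 * Real.log (Fintype.card A) / (N + 1 : ℕ)))
    {b κ : ℝ} (hb : 0 < b) (hbN : b = √(2 * (infoGain k lam N + l))) (hκ : 0 < κ)
    {h : Fin (N + 1) → A × Z × ℝ} (hs : ∀ j, (h j).2.2 = sg * scaledNoise sg h j) (z : Z) (a : A) :
    ∑ i : Fin (N + 1), (R (a, f i (Fin.take i i.isLt.le h), z) -
        ∑ c, strategy k lam β η R f i (Fin.take i i.isLt.le h) z c *
          R (c, f i (Fin.take i i.isLt.le h), z)) ≤
      √(0.5 * (N + 1 : ℕ) * Real.log (Fintype.card A)) +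
      ((N + 1 : ℕ) * ((B + sg / √lam * b) * κ) +
      ∑ i : Fin N, (sg / √lam * (failCoef lam i * (Real.exp (-l) *
          mixture k lam sg f (Fin.take (i + 1) (by omega) h))) +
        sg / √lam * κ / b * (Real.exp (-l) *
          mixture k lam sg f (Fin.take (i + 1) (by omega) h) - 1)) +
      (B + sg / √lam * b) / κ * ∑ i : Fin (N + 1), ∑ c,
        strategy k lam β η R f i (Fin.take i i.isLt.le h) z c *
          designVar k lam (visited f (Fin.take i i.isLt.le h))
            (c, f i (Fin.take i i.isLt.le h), z)) := by
  have h0 : 0 < lam := by linarith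
  have hB : 0 ≤ B := (norm_nonneg _).trans hρ
  -- The last `ucb` never influences an action, so the true reward stands in its place. All bounds
  -- in use then come from at most `N` observations, and γ_N in `b` suffices.
  set u : ℕ → A → ℝ := fun i c =>
    if hi : i < N then ucb k lam β (Fin.take (i + 1) (by omega) (observed R f h))
      (c, f i (Fin.take i (by omega) h), z)
    else if hi' : i < N + 1 then R (c, f i (Fin.take i hi'.le h), z) else 0 with hu
  have hu1 : ∀ i c, u i c ≤ 1 := by
    intro i c
    simp only [hu]
    split_ifs
    · exact min_le_right _ _
    · exact (hR01 _).2
    · exact zero_le_one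
  have hulast : ∀ c, u N c = R (c, f N (Fin.take N N.le_succ h), z) := by
    intro c
    simp only [hu]
    rw [dif_neg (lt_irrefl N), dif_pos N.lt_succ_self]
  have hst : ∀ i : Fin (N + 1), ∀ c, strategy k lam β η R f i (Fin.take i i.isLt.le h) z c =
      expWeights (√(8 * Real.log (Fintype.card A) / (N + 1 : ℕ)))
        (fun b => ∑ j ∈ Finset.range i, u j b) c := by
    intro i c
    have hsc : ∀ c', score k lam β (observed R f (Fin.take i i.isLt.le h)) z c' =
        ∑ j ∈ Finset.range i, u j c' := by
      intro c'
      rw [Finset.sum_range]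
      refine Finset.sum_congr rfl fun j _ => ?_
      have hj : (j : ℕ) < N := by omega
      simp only [hu, dif_pos hj]
      rfl
    simp only [strategy, playProb, expWeights, hη, hsc]
  have hexp : ∀ n, ∀ hn : n ≤ N + 1, Real.exp (noiseEnergy k lam (visited f (Fin.take n hn h))
      (scaledNoise sg (Fin.take n hn h)) / 2 -
      Real.log (infoDet k lam (visited f (Fin.take n hn h))) / 2 - l) =
      Real.exp (-l) * mixture k lam sg f (Fin.take n hn h) := by
    intro n hn
    rw [mixture, ← Real.exp_add]
    congr 1; ring
  have hobs : ∀ n, ∀ hn : n ≤ N + 1, Fin.take n hn (observed R f h) = fun j =>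
      (visited f (Fin.take n hn h) j, R (visited f (Fin.take n hn h) j) +
        sg * scaledNoise sg (Fin.take n hn h) j) := fun n hn =>
    observed_eq R f (h := Fin.take n hn h) fun j => hs (Fin.castLE hn j)
  have hfail : ∀ i : Fin N, R (a, f i (Fin.take i (by omega) h), z) - u i a ≤
      sg / √lam * (failCoef lam i * (Real.exp (-l) *
          mixture k lam sg f (Fin.take (i + 1) (by omega) h))) := by
    intro i
    simp only [hu, dif_pos i.isLt]
    rw [hobs, ← hexp]
    exact sub_ucb_le hk hlam hk1 hR hρ hsg hl (hβ i) _ _ (hR01 _).2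
  have hopt : ∀ i : Fin N, ∀ c, max (u i c) 0 - R (c, f i (Fin.take i (by omega) h), z) ≤
      (B + sg / √lam * b) * κ + sg / √lam * κ / b * (Real.exp (-l) *
          mixture k lam sg f (Fin.take (i + 1) (by omega) h) - 1) +
        (B + sg / √lam * b) / κ * designVar k lam (visited f (Fin.take i (by omega) h))
          (c, f i (Fin.take i (by omega) h), z) := by
    intro i c
    simp only [hu, dif_pos i.isLt]
    rw [hobs, ← hexp]
    exact ucb_sub_le hk hlam hk1 hR hρ hsg i.isLt (hβ i) _ _ (hR01 _).1 hb hbN hκ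
  have hstn : ∀ (i : Fin (N + 1)) c,
      0 ≤ strategy k lam β η R f i (Fin.take i i.isLt.le h) z c := fun i c => by
    rw [hst]; exact expWeights_nonneg _ _ _
  have hst1 : ∀ i : Fin (N + 1),
      ∑ c, strategy k lam β η R f i (Fin.take i i.isLt.le h) z c = 1 := fun i => by
    simp only [hst]; exact sum_expWeights _ _
  have hround : ∀ i : Fin N, ∑ c, strategy k lam β η R f i (Fin.take i (by omega) h) z c *
        max (u i c) 0 ≤
      ∑ c, strategy k lam β η R f i (Fin.take i (by omega) h) z c *
          R (c, f i (Fin.take i (by omega) h), z) +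
      ((B + sg / √lam * b) * κ + sg / √lam * κ / b * (Real.exp (-l) *
          mixture k lam sg f (Fin.take (i + 1) (by omega) h) - 1) +
        (B + sg / √lam * b) / κ *
          ∑ c, strategy k lam β η R f i (Fin.take i (by omega) h) z c *
            designVar k lam (visited f (Fin.take i (by omega) h))
              (c, f i (Fin.take i (by omega) h), z)) := by
    intro i
    have h1 : ∑ c, strategy k lam β η R f i (Fin.take i (by omega) h) z c = 1 := hst1 i.castSucc
    set q := (B + sg / √lam * b) * κ + sg / √lam * κ / b * (Real.exp (-l) *
          mixture k lam sg f (Fin.take (i + 1) (by omega) h) - 1) with hq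
    rw [← mul_one q, ← h1, Finset.mul_sum, Finset.mul_sum, ← Finset.sum_add_distrib,
      ← Finset.sum_add_distrib]
    refine Finset.sum_le_sum fun c _ => ?_
    have h2 : 0 ≤ strategy k lam β η R f i (Fin.take i (by omega) h) z c := hstn i.castSucc c
    have h3 := mul_le_mul_of_nonneg_left (hopt i c) h2
    linarith
  have hedge := sum_le_sum_expWeights u hu1 N.succ_pos rfl a
  rw [Finset.sum_range, Finset.sum_range] at hedge
  simp only [← hst] at hedge
  rw [Fin.sum_univ_castSucc, Fin.sum_univ_castSucc (f := fun i : Fin (N + 1) =>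
    ∑ c, strategy k lam β η R f i (Fin.take i i.isLt.le h) z c * max (u i c) 0)] at hedge
  simp only [Fin.val_castSucc, Fin.val_last, hulast] at hedge
  have hlast : ∀ c, max (R (c, f N (Fin.take N N.le_succ h), z)) 0 =
    R (c, f N (Fin.take N N.le_succ h), z) := fun c => max_eq_left (hR01 _).1
  simp only [hlast] at hedge
  have hS1 := Finset.sum_le_sum fun i (_ : i ∈ Finset.univ) => hfail i
  have hS2 := Finset.sum_le_sum fun i (_ : i ∈ Finset.univ) => hround i
  have hlastv : 0 ≤ ∑ c, strategy k lam β η R f N (Fin.take N N.le_succ h) z c *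
            designVar k lam (visited f (Fin.take N N.le_succ h))
              (c, f N (Fin.take N N.le_succ h), z) :=
    Finset.sum_nonneg fun c _ => mul_nonneg (hstn (Fin.last N) c) (designVar_nonneg hk h0 _ _)
  have hBb : 0 ≤ B + sg / √lam * b := by positivity
  have hlv := mul_nonneg (div_nonneg hBb hκ.le) hlastv
  have hlc := mul_nonneg hBb hκ.le
  rw [Fin.sum_univ_castSucc, Fin.sum_univ_castSucc (f := fun i : Fin (N + 1) =>
    ∑ c, strategy k lam β η R f i (Fin.take i i.isLt.le h) z c *
          designVar k lam (visited f (Fin.take i i.isLt.le h))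
            (c, f i (Fin.take i i.isLt.le h), z))]
  simp only [Fin.val_castSucc, Fin.val_last]
  simp only [Finset.sum_sub_distrib, Finset.sum_add_distrib, ← Finset.mul_sum,
    Finset.sum_const, Finset.card_univ, Fintype.card_fin, nsmul_eq_mul, mul_one] at hS1 hS2 hedge ⊢
  push_cast at hedge ⊢
  nlinarith

end Pathwise

/-! ### Measurability of rewards, regret and variances -/

section GameMeasurability

variable {A O Z : Type*} [MeasurableSpace A] [MeasurableSpace O] [MeasurableSpace Z]
  {f : ∀ n : ℕ, (Fin n → A × Z × ℝ) → O} {R : A × O × Z → ℝ}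
  {k : A × O × Z → A × O × Z → ℝ} {lam : ℝ}

theorem integrable_of_mem_Icc {α : Type*} [MeasurableSpace α] {μ : Measure α} [IsFiniteMeasure μ]
    {F : α → ℝ} (hF : Measurable F) (h01 : ∀ x, F x ∈ Set.Icc (0 : ℝ) 1) : Integrable F μ :=
  Integrable.of_bound hF.aestronglyMeasurable 1 (Filter.Eventually.of_forall fun x => by
    rw [Real.norm_eq_abs, abs_of_nonneg (h01 x).1]; exact (h01 x).2)

theorem measurable_reward (hf : ∀ n, Measurable (f n)) (hR : Measurable R) (m : ℕ) :
    Measurable fun q : (Fin m → A × Z × ℝ) × A × Z => R (q.2.1, f m q.1, q.2.2) :=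
  hR.comp ((measurable_fst.comp measurable_snd).prodMk (((hf m).comp measurable_fst).prodMk
    (measurable_snd.comp measurable_snd)))

theorem measurable_policyReward (hf : ∀ n, Measurable (f n)) (hR : Measurable R) {π : Z → A}
    (hπ : Measurable π) (m : ℕ) :
    Measurable fun q : (Fin m → A × Z × ℝ) × A × Z => R (π q.2.2, f m q.1, q.2.2) :=
  hR.comp ((hπ.comp (measurable_snd.comp measurable_snd)).prodMk
    (((hf m).comp measurable_fst).prodMk (measurable_snd.comp measurable_snd)))

theorem measurable_round {m n : ℕ} (hmn : m < n) {F : (Fin m → A × Z × ℝ) → A → Z → ℝ}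
    (hF : Measurable fun q : (Fin m → A × Z × ℝ) × A × Z => F q.1 q.2.1 q.2.2) :
    Measurable fun h : Fin n → A × Z × ℝ =>
      F (Fin.take m hmn.le h) (h ⟨m, hmn⟩).1 (h ⟨m, hmn⟩).2.1 := by
  have hl := measurable_pi_apply (X := fun _ : Fin n => A × Z × ℝ) ⟨m, hmn⟩
  exact hF.comp ((measurable_take hmn.le).prodMk ((measurable_fst.comp hl).prodMk
    (measurable_fst.comp (measurable_snd.comp hl))))

theorem measurable_regret (hf : ∀ n, Measurable (f n)) (hR : Measurable R) {π : Z → A}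
    (hπ : Measurable π) (n : ℕ) : Measurable fun h : Fin n → A × Z × ℝ => regret R f π h :=
  (Finset.measurable_fun_sum _ fun (i : Fin n) _ => measurable_round i.isLt
      (F := fun h _ z => R (π z, f i h, z)) (measurable_policyReward hf hR hπ i)).sub
    (Finset.measurable_fun_sum _ fun (i : Fin n) _ => measurable_round i.isLt
      (F := fun h a z => R (a, f i h, z)) (measurable_reward hf hR i))

theorem measurable_nextVar (hkm : Measurable fun p : (A × O × Z) × (A × O × Z) => k p.1 p.2)
    (hf : ∀ n, Measurable (f n)) (m : ℕ) :
    Measurable fun q : (Fin m → A × Z × ℝ) × A × Z =>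
      designVar k lam (visited f q.1) (q.2.1, f m q.1, q.2.2) :=
  measurable_designVar hkm ((measurable_visited hf m).comp measurable_fst)
    ((measurable_fst.comp measurable_snd).prodMk (((hf m).comp measurable_fst).prodMk
      (measurable_snd.comp measurable_snd)))

end GameMeasurability

/-! ### Passage to a fresh context, and expectations -/

section Expectations

variable {A O Z : Type*} [Fintype A] [MeasurableSpace A]
  [MeasurableSpace O] [MeasurableSpace Z]
  {p : ∀ n : ℕ, (Fin n → A × Z × ℝ) → Z → A → ℝ} {ζ : Measure Z} [IsProbabilityMeasure ζ]
  {f : ∀ n : ℕ, (Fin n → A × Z × ℝ) → O} {R : A × O × Z → ℝ}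

theorem ae_gameLaw_noise (hp : IsStrategy p) (e : ℕ → ℝ) (n : ℕ) :
    ∀ᵐ h ∂gameLaw p ζ e n, ∀ j : Fin n, (h j).2.2 = e j := by
  have hS : MeasurableSet {h : Fin n → A × Z × ℝ | ∀ j : Fin n, (h j).2.2 = e j} := by
    simp only [Set.ofPred_forall]
    exact MeasurableSet.iInter fun j => (measurable_snd.comp (measurable_snd.comp
      (measurable_pi_apply j))) (measurableSet_singleton (e j))
  rw [ae_iff]
  have h1 := lintegral_gameLaw (ζ := ζ) hp e (F := Set.indicator
    {h : Fin n → A × Z × ℝ | ∀ j : Fin n, (h j).2.2 = e j}ᶜ 1) (measurable_one.indicator hS.compl)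
  rw [lintegral_indicator_one hS.compl] at h1
  refine h1.trans (Finset.sum_eq_zero fun a _ => ?_)
  simp [history]

theorem IsStrategy.sum_mul_mem_Icc (hp : IsStrategy p) {n : ℕ} (h : Fin n → A × Z × ℝ) (z : Z)
    {F : A → ℝ} (hF : ∀ a, F a ∈ Set.Icc (0 : ℝ) 1) :
    ∑ a, p n h z a * F a ∈ Set.Icc (0 : ℝ) 1 := by
  refine ⟨Finset.sum_nonneg fun a _ => mul_nonneg (hp.nonneg _ _ _ _) (hF a).1, ?_⟩
  rw [← hp.sum_eq_one n h z]
  exact Finset.sum_le_sum fun a _ => mul_le_of_le_one_right (hp.nonneg _ _ _ _) (hF a).2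

theorem IsStrategy.measurable_sum_mul (hp : IsStrategy p) {m n : ℕ} (hmn : m ≤ n)
    {F : (Fin m → A × Z × ℝ) → A → Z → ℝ}
    (hF : Measurable fun q : (Fin m → A × Z × ℝ) × A × Z => F q.1 q.2.1 q.2.2) :
    Measurable fun q : (Fin n → A × Z × ℝ) × Z =>
      ∑ a, p m (Fin.take m hmn q.1) q.2 a * F (Fin.take m hmn q.1) a q.2 := by
  refine Finset.measurable_fun_sum _ fun a _ => ?_
  have ht : Measurable fun q : (Fin n → A × Z × ℝ) × Z => Fin.take m hmn q.1 :=
    (measurable_take hmn).comp measurable_fst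
  exact ((hp.measurable m a).comp (ht.prodMk measurable_snd)).mul
    (hF.comp (ht.prodMk (measurable_const.prodMk measurable_snd)))

/-- In the expected regret, the contexts may be replaced by fresh ones. -/
theorem integral_regret (hp : IsStrategy p) (e : ℕ → ℝ) (hf : ∀ n, Measurable (f n))
    (hR : Measurable R) (hR01 : ∀ x, R x ∈ Set.Icc (0 : ℝ) 1) {π : Z → A} (hπ : Measurable π)
    (n : ℕ) :
    ∫ h, regret R f π h ∂gameLaw p ζ e n =
      ∫ q, ∑ i : Fin n, (R (π q.2, f i (Fin.take i i.isLt.le q.1), q.2) -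
        ∑ c, p i (Fin.take i i.isLt.le q.1) q.2 c * R (c, f i (Fin.take i i.isLt.le q.1), q.2))
          ∂(gameLaw p ζ e n).prod ζ := by
  have := isProbabilityMeasure_gameLaw (ζ := ζ) hp e n
  have hm1 : ∀ i : Fin n, Measurable fun h : Fin n → A × Z × ℝ =>
      R (π (h i).2.1, (visited f h i).2) := fun i : Fin n => measurable_round i.isLt
      (F := fun h _ z => R (π z, f i h, z)) (measurable_policyReward hf hR hπ i)
  have hm2 : ∀ i : Fin n, Measurable fun h : Fin n → A × Z × ℝ =>
      R (visited f h i) := fun i : Fin n => measurable_round i.isLt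
      (F := fun h a z => R (a, f i h, z)) (measurable_reward hf hR i)
  have hm3 := fun i : Fin n => hp.measurable_sum_mul i.isLt.le
      (F := fun h _ z => R (π z, f i h, z)) (measurable_policyReward hf hR hπ i)
  have hm4 := fun i : Fin n => hp.measurable_sum_mul i.isLt.le
      (F := fun h a z => R (a, f i h, z)) (measurable_reward hf hR i)
  have hi3 := fun i : Fin n => integrable_of_mem_Icc (μ := (gameLaw p ζ e n).prod ζ) (hm3 i)
    fun q => hp.sum_mul_mem_Icc _ _ fun _ => hR01 _
  -- The reward of the policy is written as an average over an action it ignores, so that the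
  -- replacement rule for a round applies to it as well.
  have e1 : ∀ (i : Fin n) (q : (Fin n → A × Z × ℝ) × Z),
      R (π q.2, f i (Fin.take i i.isLt.le q.1), q.2) =
        ∑ c, p i (Fin.take i i.isLt.le q.1) q.2 c *
          R (π q.2, f i (Fin.take i i.isLt.le q.1), q.2) := by
    intro i q
    rw [← Finset.sum_mul, hp.sum_eq_one, one_mul]
  have hi3' : ∀ i : Fin n, Integrable (fun q : (Fin n → A × Z × ℝ) × Z =>
      R (π q.2, f i (Fin.take i i.isLt.le q.1), q.2)) ((gameLaw p ζ e n).prod ζ) := fun i =>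
    (hi3 i).congr (Filter.Eventually.of_forall fun q => (e1 i q).symm)
  have hi4 := fun i : Fin n => integrable_of_mem_Icc (μ := (gameLaw p ζ e n).prod ζ) (hm4 i)
    fun q => hp.sum_mul_mem_Icc _ _ fun _ => hR01 _
  simp_rw [Finset.sum_sub_distrib]
  rw [integral_sub (integrable_finsetSum _ fun i _ => hi3' i)
    (integrable_finsetSum _ fun i _ => hi4 i),
    integral_finsetSum _ fun i _ => hi3' i,
    integral_finsetSum _ fun i _ => hi4 i]
  have h1 : ∀ i : Fin n, ∫ q, R (π q.2, f i (Fin.take i i.isLt.le q.1), q.2)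
      ∂(gameLaw p ζ e n).prod ζ = ∫ h, R (π (h i).2.1, (visited f h i).2) ∂gameLaw p ζ e n := by
    intro i
    rw [integral_congr_ae (Filter.Eventually.of_forall (e1 i))]
    exact (integral_gameLaw_round hp e i.isLt (F := fun h _ z => R (π z, f i h, z))
      (measurable_policyReward hf hR hπ i) fun _ _ _ => (hR01 _).1).symm
  have h2 : ∀ i : Fin n, ∫ q, ∑ c, p i (Fin.take i i.isLt.le q.1) q.2 c *
      R (c, f i (Fin.take i i.isLt.le q.1), q.2)
      ∂(gameLaw p ζ e n).prod ζ = ∫ h, R (visited f h i) ∂gameLaw p ζ e n := by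
    intro i
    exact (integral_gameLaw_round hp e i.isLt (F := fun h a z => R (a, f i h, z))
      (measurable_reward hf hR i) fun _ _ _ => (hR01 _).1).symm
  simp only [h1, h2]
  rw [← integral_finsetSum _ fun i _ => integrable_of_mem_Icc (hm1 i) fun _ => hR01 _,
    ← integral_finsetSum _ fun i _ => integrable_of_mem_Icc (hm2 i) fun _ => hR01 _,
    ← integral_sub (integrable_finsetSum _ fun i _ => integrable_of_mem_Icc (hm1 i) fun _ => hR01 _)
      (integrable_finsetSum _ fun i _ => integrable_of_mem_Icc (hm2 i) fun _ => hR01 _)]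
  rfl

variable {H : Type*} [NormedAddCommGroup H] [InnerProductSpace ℝ H]
  {φ : A × O × Z → H} {k : A × O × Z → A × O × Z → ℝ} {lam : ℝ}

theorem integrable_nextVar (hp : IsStrategy p) (hk : ∀ x y, k x y = inner ℝ (φ x) (φ y))
    (hlam : 0 < lam) (hk1 : ∀ x, k x x ≤ 1)
    (hkm : Measurable fun p : (A × O × Z) × (A × O × Z) => k p.1 p.2)
    (hf : ∀ n, Measurable (f n)) (e : ℕ → ℝ) {n : ℕ} (i : Fin n) :
    Integrable (fun q : (Fin n → A × Z × ℝ) × Z => ∑ c, p i (Fin.take i i.isLt.le q.1) q.2 c *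
      designVar k lam (visited f (Fin.take i i.isLt.le q.1))
        (c, f i (Fin.take i i.isLt.le q.1), q.2)) ((gameLaw p ζ e n).prod ζ) := by
  have := isProbabilityMeasure_gameLaw (ζ := ζ) hp e n
  exact integrable_of_mem_Icc (hp.measurable_sum_mul i.isLt.le
      (F := fun h a z => designVar k lam (visited f h) (a, f i h, z)) (measurable_nextVar hkm hf i))
    fun q => hp.sum_mul_mem_Icc _ _ fun _ => ⟨designVar_nonneg hk hlam _ _,
      (designVar_le_self hk hlam _ _).trans (hk1 _)⟩

/-- Given the past, a fresh context with an action drawn for it has the law of the actual round, so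
the mean is that of the variances at the visited points. -/
theorem integral_sum_nextVar_le (hp : IsStrategy p) (hk : ∀ x y, k x y = inner ℝ (φ x) (φ y))
    (hlam : 1 ≤ lam) (hk1 : ∀ x, k x x ≤ 1)
    (hkm : Measurable fun p : (A × O × Z) × (A × O × Z) => k p.1 p.2)
    (hf : ∀ n, Measurable (f n)) (e : ℕ → ℝ) (n : ℕ) :
    ∫ q : (Fin n → A × Z × ℝ) × Z, ∑ i : Fin n, ∑ c, p i (Fin.take i i.isLt.le q.1) q.2 c *
      designVar k lam (visited f (Fin.take i i.isLt.le q.1))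
        (c, f i (Fin.take i i.isLt.le q.1), q.2) ∂(gameLaw p ζ e n).prod ζ ≤
      2 / Real.log 2 * (lam * infoGain k lam n) := by
  have h0 : 0 < lam := by linarith
  have := isProbabilityMeasure_gameLaw (ζ := ζ) hp e n
  have hi : ∀ i : Fin n, Integrable (fun h : Fin n → A × Z × ℝ =>
      designVar k lam (Fin.take i i.isLt.le (visited f h)) (visited f h i)) (gameLaw p ζ e n) :=
    fun i => integrable_of_mem_Icc (measurable_round i.isLt
      (F := fun h a z => designVar k lam (visited f h) (a, f i h, z)) (measurable_nextVar hkm hf i))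
      fun h => ⟨designVar_nonneg hk h0 _ _, (designVar_le_self hk h0 _ _).trans (hk1 _)⟩
  rw [integral_finsetSum _ fun i _ => integrable_nextVar hp hk h0 hk1 hkm hf e i]
  have h1 : ∀ i : Fin n, ∫ q : (Fin n → A × Z × ℝ) × Z, ∑ c,
      p i (Fin.take i i.isLt.le q.1) q.2 c *
      designVar k lam (visited f (Fin.take i i.isLt.le q.1))
        (c, f i (Fin.take i i.isLt.le q.1), q.2) ∂(gameLaw p ζ e n).prod ζ =
      ∫ h, designVar k lam (Fin.take i i.isLt.le (visited f h)) (visited f h i)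
        ∂gameLaw p ζ e n := fun i =>
    (integral_gameLaw_round hp e i.isLt
      (F := fun h a z => designVar k lam (visited f h) (a, f i h, z)) (measurable_nextVar hkm hf i)
      fun _ _ _ => designVar_nonneg hk h0 _ _).symm
  simp only [h1]
  rw [← integral_finsetSum _ fun i _ => hi i]
  refine (integral_mono (integrable_finsetSum _ fun i _ => hi i) (integrable_const _)
    fun h => sum_designVar_take_le hk hlam hk1 (visited f h)).trans ?_
  simp

/-- The normalized mixture is integrable with mean at most one on the good noise event. -/
theorem integral_mixture_le (hp : IsStrategy p)
    (hkm : Measurable fun p : (A × O × Z) × (A × O × Z) => k p.1 p.2)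
    (hf : ∀ n, Measurable (f n)) {e : ℕ → ℝ} {sg l : ℝ} {m n : ℕ} (hmn : m ≤ n)
    (h : ∫⁻ h, ENNReal.ofReal (mixture k lam sg f h) ∂gameLaw p ζ e m ≤
      ENNReal.ofReal (Real.exp l)) :
    Integrable (fun q : (Fin n → A × Z × ℝ) × Z =>
      Real.exp (-l) * mixture k lam sg f (Fin.take m hmn q.1)) ((gameLaw p ζ e n).prod ζ) ∧
    ∫ q : (Fin n → A × Z × ℝ) × Z, Real.exp (-l) * mixture k lam sg f (Fin.take m hmn q.1)
      ∂(gameLaw p ζ e n).prod ζ ≤ 1 := by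
  have := isProbabilityMeasure_gameLaw (ζ := ζ) hp e n
  have hm : Measurable fun h : Fin n → A × Z × ℝ =>
      Real.exp (-l) * mixture k lam sg f (Fin.take m hmn h) :=
    ((measurable_mixture hkm lam sg hf m).comp (measurable_take hmn)).const_mul _
  have hnn : ∀ h : Fin n → A × Z × ℝ,
      0 ≤ Real.exp (-l) * mixture k lam sg f (Fin.take m hmn h) := fun h => by
    unfold mixture; positivity
  have hL : ∫⁻ h : Fin n → A × Z × ℝ, ENNReal.ofReal
      (Real.exp (-l) * mixture k lam sg f (Fin.take m hmn h)) ∂gameLaw p ζ e n ≤ 1 := by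
    simp only [ENNReal.ofReal_mul (Real.exp_pos (-l)).le]
    rw [lintegral_const_mul' _ _ ENNReal.ofReal_ne_top, lintegral_gameLaw_take
      (F := fun h => ENNReal.ofReal (mixture k lam sg f h)) hp e hmn
      (measurable_mixture hkm lam sg hf m).ennreal_ofReal]
    refine (mul_le_mul_right h _).trans (le_of_eq ?_)
    rw [← ENNReal.ofReal_mul (Real.exp_pos _).le, ← Real.exp_add, neg_add_cancel, Real.exp_zero,
      ENNReal.ofReal_one]
  have hI : Integrable (fun h : Fin n → A × Z × ℝ =>
      Real.exp (-l) * mixture k lam sg f (Fin.take m hmn h)) (gameLaw p ζ e n) := by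
    refine ⟨hm.aestronglyMeasurable, ?_⟩
    rw [hasFiniteIntegral_iff_ofReal (Filter.Eventually.of_forall hnn)]
    exact hL.trans_lt ENNReal.one_lt_top
  refine ⟨hI.comp_fst ζ, ?_⟩
  rw [integral_fun_fst (fun h : Fin n → A × Z × ℝ =>
    Real.exp (-l) * mixture k lam sg f (Fin.take m hmn h))]
  rw [integral_eq_lintegral_of_nonneg_ae (Filter.Eventually.of_forall hnn) hm.aestronglyMeasurable]
  have := ENNReal.toReal_mono ENNReal.one_ne_top hL
  simpa using this

end Expectations

/-! ### The regret bound for given noise -/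

section RegretBound

variable {A O Z : Type*}
  {H : Type*} [NormedAddCommGroup H] [InnerProductSpace ℝ H]
  {φ : A × O × Z → H} {k : A × O × Z → A × O × Z → ℝ} {lam : ℝ} {ρ : H} {R : A × O × Z → ℝ}
  {B sg l : ℝ} {β η : ℕ → ℝ} {f : ∀ n : ℕ, (Fin n → A × Z × ℝ) → O}

/-- A bound on the regret by the size of the rewards. -/
theorem regret_le_mul (hk : ∀ x y, k x y = inner ℝ (φ x) (φ y)) (hlam : 1 ≤ lam)
    (hk1 : ∀ x, k x x ≤ 1) (hR : ∀ x, R x = inner ℝ ρ (φ x)) (hR0 : ∀ x, 0 ≤ R x)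
    (hρ : ‖ρ‖ ≤ B) (π : Z → A) {n : ℕ} (hn : 0 < n) (h : Fin n → A × Z × ℝ) :
    regret R f π h ≤
      B * min (n : ℝ) (√(n * (lam * (Real.exp (2 * infoGain k lam n) - 1)))) := by
  have hB : 0 ≤ B := (norm_nonneg _).trans hρ
  have hn' : (0 : ℝ) < n := by exact_mod_cast hn
  set Y := min (n : ℝ) (√(n * (lam * (Real.exp (2 * infoGain k lam n) - 1)))) with hY
  have h1 : ∀ y, R y ≤ B * (Y / n) := by
    intro y
    have hy0 : 0 ≤ k y y := by rw [hk]; exact real_inner_self_nonneg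
    have h2 : R y ≤ B * √(k y y) := by
      rw [hR, hk, real_inner_self_eq_norm_sq, Real.sqrt_sq (norm_nonneg _)]
      exact (real_inner_le_norm _ _).trans (mul_le_mul_of_nonneg_right hρ (norm_nonneg _))
    refine h2.trans (mul_le_mul_of_nonneg_left ?_ hB)
    rw [le_div_iff₀ hn', hY]
    refine le_min ?_ (Real.le_sqrt_of_sq_le ?_)
    · exact mul_le_of_le_one_left hn'.le (Real.sqrt_le_one.2 (hk1 y))
    · rw [mul_pow, Real.sq_sqrt hy0]
      have := mul_kernel_le hk hlam hk1 (n := n) y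
      nlinarith
  have h3 : ∑ t, R (π (h t).2.1, (visited f h t).2) ≤ ∑ _t : Fin n, B * (Y / n) :=
    Finset.sum_le_sum fun t _ => h1 _
  have h4 : 0 ≤ ∑ t, R (visited f h t) := Finset.sum_nonneg fun t _ => hR0 _
  rw [Finset.sum_const, Finset.card_univ, Fintype.card_fin, nsmul_eq_mul] at h3
  have e : (n : ℝ) * (B * (Y / n)) = B * Y := by field_simp
  rw [e] at h3
  rw [regret]
  linarith

theorem eq_mul_scaledNoise {e : ℕ → ℝ} {n : ℕ} (he : sg = 0 → ∀ i < n, e i = 0)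
    {h : Fin n → A × Z × ℝ} (hh : ∀ j : Fin n, (h j).2.2 = e j) (j : Fin n) :
    (h j).2.2 = sg * scaledNoise sg h j := by
  rw [scaledNoise]
  rcases eq_or_ne sg 0 with hs | hs
  · rw [hh, he hs j j.isLt]; simp
  · field_simp

theorem abs_regret_le (hR01 : ∀ x, R x ∈ Set.Icc (0 : ℝ) 1) (π : Z → A) {n : ℕ}
    (h : Fin n → A × Z × ℝ) : |regret R f π h| ≤ n := by
  rw [regret, ← Finset.sum_sub_distrib]
  refine (Finset.abs_sum_le_sum_abs _ _).trans ((Finset.sum_le_sum (g := fun _ => 1)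
    fun t _ => ?_).trans (by simp))
  have h1 := hR01 (π (h t).2.1, (visited f h t).2)
  have h2 := hR01 (visited f h t)
  rw [abs_le]
  constructor <;> linarith [h1.1, h1.2, h2.1, h2.2]

variable [Fintype A] [Nonempty A] [MeasurableSpace A] [MeasurableSpace O] [MeasurableSpace Z]
  {ζ : Measure Z} [IsProbabilityMeasure ζ]

/-- Integrates the pathwise bound in the fresh context: the terms with E - 1 contribute nothing
positive, and each failure contributes at most θ times its coefficient. -/
theorem integral_regret_le_of_pos [Nonempty (A × O × Z)]
    (hk : ∀ x y, k x y = inner ℝ (φ x) (φ y))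
    (hlam : 1 ≤ lam) (hk1 : ∀ x, k x x ≤ 1)
    (hkm : Measurable fun p : (A × O × Z) × (A × O × Z) => k p.1 p.2)
    (hR : ∀ x, R x = inner ℝ ρ (φ x)) (hRm : Measurable R) (hR01 : ∀ x, R x ∈ Set.Icc (0 : ℝ) 1)
    (hρ : ‖ρ‖ ≤ B) (hsg : 0 ≤ sg) (hl : 0 ≤ l)
    (hβ : ∀ n, β (n + 1) = B + sg / √lam * √(2 * (infoGain k lam n + l))) {N : ℕ}
    (hη : ∀ t, η t = √(8 * Real.log (Fintype.card A) / (N + 1 : ℕ)))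
    (hf : ∀ n, Measurable (f n)) {e : ℕ → ℝ} (he : sg = 0 → ∀ i < N + 1, e i = 0)
    (hM : ∀ m ≤ N + 1, ∫⁻ h, ENNReal.ofReal (mixture k lam sg f h)
      ∂gameLaw (strategy k lam β η R f) ζ e m ≤ ENNReal.ofReal (Real.exp l))
    {π : Z → A} (hπ : Measurable π) {b : ℝ} (hbN : b = √(2 * (infoGain k lam N + l)))
    (hb : 0 < b) (hg : 0 < infoGain k lam (N + 1)) :
    ∫ h, regret R f π h ∂gameLaw (strategy k lam β η R f) ζ e (N + 1) ≤
      √(0.5 * (N + 1 : ℕ) * Real.log (Fintype.card A)) +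
      (2 * (B + sg / √lam * b) *
        √((N + 1 : ℕ) * (2 / Real.log 2 * (lam * infoGain k lam (N + 1)))) +
        sg / √lam * ∑ n ∈ Finset.range N, failCoef lam n) := by
  have h0 : 0 < lam := by linarith
  have hB : 0 ≤ B := (norm_nonneg _).trans hρ
  have hp : IsStrategy (strategy k lam β η R f) := isStrategy_strategy hkm lam β η hRm hf
  have hprob := isProbabilityMeasure_gameLaw (ζ := ζ) hp e (N + 1)
  set μ := (gameLaw (strategy k lam β η R f) ζ e (N + 1)).prod ζ with hμ
  have hlog2 : 0 < Real.log 2 := Real.log_pos one_lt_two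
  set V := 2 / Real.log 2 * (lam * infoGain k lam (N + 1)) with hV
  have hV0 : 0 < V := by positivity
  have hT : (0 : ℝ) < (N + 1 : ℕ) := by exact_mod_cast N.succ_pos
  set T : ℝ := ((N + 1 : ℕ) : ℝ) with hTd
  -- This κ balances Tκ against V/κ; both become √(TV).
  set κ := √(V / T) with hκd
  have hκ : 0 < κ := Real.sqrt_pos.2 (by positivity)
  set θ := sg / √lam with hθd
  have hθ : 0 ≤ θ := by positivity
  have hTκ : T * κ = √(T * V) := by
    symm
    rw [Real.sqrt_eq_iff_mul_self_eq (by positivity) (by positivity)]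
    have : κ * κ = V / T := Real.mul_self_sqrt (by positivity)
    calc T * V = T * T * (κ * κ) := by rw [this]; field_simp
      _ = T * κ * (T * κ) := by ring
  have hVκ : V / κ = √(T * V) := by
    rw [← hTκ, div_eq_iff hκ.ne', mul_assoc, Real.mul_self_sqrt (by positivity)]
    field_simp
  set E : Fin N → (Fin (N + 1) → A × Z × ℝ) × Z → ℝ := fun i q =>
    Real.exp (-l) * mixture k lam sg f (Fin.take (i + 1) (by omega) q.1) with hE
  have hEi : ∀ i, Integrable (E i) μ ∧ ∫ q, E i q ∂μ ≤ 1 := fun i =>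
    integral_mixture_le hp hkm hf (by omega) (hM _ (by omega))
  set S : (Fin (N + 1) → A × Z × ℝ) × Z → ℝ := fun q => ∑ i : Fin (N + 1), ∑ c,
    strategy k lam β η R f i (Fin.take i i.isLt.le q.1) q.2 c *
      designVar k lam (visited f (Fin.take i i.isLt.le q.1))
        (c, f i (Fin.take i i.isLt.le q.1), q.2) with hS
  have hSi : Integrable S μ :=
    integrable_finsetSum _ fun i _ => integrable_nextVar hp hk h0 hk1 hkm hf e i
  have hSV : ∫ q, S q ∂μ ≤ V := integral_sum_nextVar_le hp hk hlam hk1 hkm hf e (N + 1)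
  have hE1 : ∀ i : Fin N, Integrable (fun q => E i q - 1) μ := fun i =>
    (hEi i).1.sub (integrable_const _)
  have hE2 : ∀ i : Fin N, Integrable (fun q => θ * (failCoef lam i * E i q)) μ := fun i =>
    ((hEi i).1.const_mul _).const_mul _
  have hE3 : ∀ i : Fin N, Integrable (fun q => θ * κ / b * (E i q - 1)) μ := fun i =>
    (hE1 i).const_mul _
  have hFi : ∀ i : Fin N, Integrable (fun q => θ * (failCoef lam i * E i q) +
      θ * κ / b * (E i q - 1)) μ := fun i =>
    (hE2 i).add (hE3 i)
  have hFle : ∀ i : Fin N, ∫ q, (θ * (failCoef lam i * E i q) + θ * κ / b * (E i q - 1)) ∂μ ≤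
      θ * failCoef lam i := by
    intro i
    have h1 := failCoef_nonneg lam i
    rw [integral_add (hE2 i) (hE3 i), integral_const_mul θ fun q => failCoef lam i * E i q,
      integral_const_mul _ (E i), integral_const_mul _ fun q => E i q - 1,
      integral_sub (hEi i).1 (integrable_const _)]
    simp only [integral_const, probReal_univ, smul_eq_mul, mul_one]
    have h2 := (hEi i).2
    have h3 : θ * (failCoef lam i * ∫ q, E i q ∂μ) ≤ θ * (failCoef lam i * 1) := by gcongr
    have h4 : θ * κ / b * (∫ q, E i q ∂μ - 1) ≤ 0 :=
      mul_nonpos_of_nonneg_of_nonpos (by positivity) (by linarith)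
    linarith
  rw [integral_regret hp e hf hRm hR01 hπ]
  refine (integral_mono_ae (g := fun q => √(0.5 * T * Real.log (Fintype.card A)) +
      (T * ((B + θ * b) * κ) + ∑ i : Fin N, (θ * (failCoef lam i * E i q) +
        θ * κ / b * (E i q - 1)) + (B + θ * b) / κ * S q)) ?_ ?_ ?_).trans ?_
  · refine integrable_finsetSum _ fun i _ => Integrable.sub ?_ ?_
    · refine integrable_of_mem_Icc ?_ fun _ => hR01 _
      exact (measurable_policyReward hf hRm hπ i).comp
        (((measurable_take i.isLt.le).comp measurable_fst).prodMk
          ((hπ.comp measurable_snd).prodMk measurable_snd))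
    · exact integrable_of_mem_Icc (hp.measurable_sum_mul i.isLt.le
        (F := fun h a z => R (a, f i h, z)) (measurable_reward hf hRm i))
        fun q => hp.sum_mul_mem_Icc _ _ fun _ => hR01 _
  · exact (integrable_const _).add (((integrable_const _).add
      (integrable_finsetSum _ fun i _ => hFi i)).add (hSi.const_mul _))
  · have hae : ∀ᵐ q ∂μ, ∀ j : Fin (N + 1), (q.1 j).2.2 = e j :=
      Measure.quasiMeasurePreserving_fst.ae (ae_gameLaw_noise hp e (N + 1))
    filter_upwards [hae] with q hq
    exact sum_regret_le hk hlam hk1 hR hR01 hρ hsg hl hβ hη hb hbN hκ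
      (eq_mul_scaledNoise he hq) q.2 (π q.2)
  · have hS1 : Integrable (fun q => ∑ i : Fin N, (θ * (failCoef lam i * E i q) +
        θ * κ / b * (E i q - 1))) μ := integrable_finsetSum _ fun i _ => hFi i
    have hS2 : Integrable (fun q => T * ((B + θ * b) * κ) + ∑ i : Fin N,
        (θ * (failCoef lam i * E i q) + θ * κ / b * (E i q - 1))) μ :=
      (integrable_const _).add hS1
    have hS3 : Integrable (fun q => (B + θ * b) / κ * S q) μ := hSi.const_mul _
    have hS4 : Integrable (fun q => T * ((B + θ * b) * κ) + ∑ i : Fin N,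
        (θ * (failCoef lam i * E i q) + θ * κ / b * (E i q - 1)) + (B + θ * b) / κ * S q) μ :=
      hS2.add hS3
    rw [integral_add (integrable_const _) hS4, integral_add hS2 hS3,
      integral_add (integrable_const _) hS1, integral_finsetSum _ fun i _ => hFi i,
      integral_const_mul _ S]
    simp only [integral_const, probReal_univ, smul_eq_mul, one_mul]
    have h1 := Finset.sum_le_sum fun i (_ : i ∈ Finset.univ) => hFle i
    rw [← Finset.mul_sum, ← Finset.sum_range (fun i => failCoef lam i)] at h1
    have hBb : 0 ≤ B + θ * b := by positivity
    have h2 := mul_le_mul_of_nonneg_left hSV (div_nonneg hBb hκ.le)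
    have h3 : (B + θ * b) / κ * V = (B + θ * b) * √(T * V) := by rw [← hVκ]; ring
    have h4 : T * ((B + θ * b) * κ) = (B + θ * b) * √(T * V) := by rw [← hTκ]; ring
    rw [h4]
    rw [h3] at h2
    linarith

/-- The bound on the expected regret given the noise. -/
theorem integral_regret_le [Nonempty (A × O × Z)] (hk : ∀ x y, k x y = inner ℝ (φ x) (φ y))
    (hlam : 1 ≤ lam) (hk1 : ∀ x, k x x ≤ 1)
    (hkm : Measurable fun p : (A × O × Z) × (A × O × Z) => k p.1 p.2)
    (hR : ∀ x, R x = inner ℝ ρ (φ x)) (hRm : Measurable R) (hR01 : ∀ x, R x ∈ Set.Icc (0 : ℝ) 1)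
    (hρ : ‖ρ‖ ≤ B) (hsg : 0 ≤ sg) (hl : 0 ≤ l)
    (hβ : ∀ n, β (n + 1) = B + sg / √lam * √(2 * (infoGain k lam n + l))) {N : ℕ}
    (hη : ∀ t, η t = √(8 * Real.log (Fintype.card A) / (N + 1 : ℕ)))
    (hf : ∀ n, Measurable (f n)) {e : ℕ → ℝ} (he : sg = 0 → ∀ i < N + 1, e i = 0)
    (hM : ∀ m ≤ N + 1, ∫⁻ h, ENNReal.ofReal (mixture k lam sg f h)
      ∂gameLaw (strategy k lam β η R f) ζ e m ≤ ENNReal.ofReal (Real.exp l))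
    {π : Z → A} (hπ : Measurable π) :
    ∫ h, regret R f π h ∂gameLaw (strategy k lam β η R f) ζ e (N + 1) ≤
      √(0.5 * (N + 1 : ℕ) * Real.log (Fintype.card A)) +
        4 * β (N + 1) * √(infoGain k lam (N + 1) * lam * (N + 1 : ℕ)) := by
  have hB : 0 ≤ B := (norm_nonneg _).trans hρ
  have hp : IsStrategy (strategy k lam β η R f) := isStrategy_strategy hkm lam β η hRm hf
  have hprob := isProbabilityMeasure_gameLaw (ζ := ζ) hp e (N + 1)
  have hg : ∀ n, 0 ≤ infoGain k lam n := infoGain_nonneg hk hlam hk1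
  have hT : (1 : ℝ) ≤ (N + 1 : ℕ) := by exact_mod_cast N.succ_pos
  rw [hβ, ← sub_le_iff_le_add']
  set Y := min ((N + 1 : ℕ) : ℝ)
    (√((N + 1 : ℕ) * (lam * (Real.exp (2 * infoGain k lam (N + 1)) - 1)))) with hY
  refine regret_numerics (W := ∑ n ∈ Finset.range N, failCoef lam n) (Y := Y) hB
    (by positivity) (Real.sqrt_nonneg _) (hg _) hlam hT ?_ ?_ (min_le_left _ _) ?_ ?_ ?_
  · rw [Real.sq_sqrt (by linarith [hg N])]
    push_cast
    rcases N.eq_zero_or_pos with rfl | hN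
    · have := hg 0
      simp; linarith
    · have := mul_infoGain_le hk hlam hk1 hN N.le_succ
      push_cast at this
      nlinarith
  · have := sum_failCoef_le hlam N
    push_cast
    exact this
  · have h1 : 0 ≤ Real.exp (2 * infoGain k lam (N + 1)) - 1 := by
      rw [sub_nonneg]; exact Real.one_le_exp (by linarith [hg (N + 1)])
    have h2 : 0 ≤ (N + 1 : ℕ) * (lam * (Real.exp (2 * infoGain k lam (N + 1)) - 1)) := by positivity
    rw [← Real.sq_sqrt h2]
    exact pow_le_pow_left₀ (le_min (by linarith) (Real.sqrt_nonneg _)) (min_le_right _ _) 2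
  · refine (sub_le_self _ (Real.sqrt_nonneg _)).trans ?_
    refine (integral_mono (Integrable.of_bound (measurable_regret hf hRm hπ _).aestronglyMeasurable
      (N + 1 : ℕ) (Filter.Eventually.of_forall fun h => abs_regret_le hR01 π h))
      (integrable_const _) fun h => regret_le_mul hk hlam hk1 hR (fun x => (hR01 x).1) hρ π
        N.succ_pos h).trans ?_
    simp [hY]
  · intro hb hγ
    rw [sub_le_iff_le_add']
    exact integral_regret_le_of_pos hk hlam hk1 hkm hR hRm hR01 hρ hsg hl hβ hη hf he hM hπ rfl
      hb hγ

end RegretBound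

end CGPMW

end

/-! ### Conclusion in the reproducing kernel Hilbert space -/

theorem theorem2
    {A O Z : Type*} [Fintype A] [Nonempty A] [MeasurableSpace A] [MeasurableSingletonClass A]
    [MeasurableSpace O] [MeasurableSpace Z]
    -- the reproducing kernel Hilbert space, its kernel and the reward function
    {H : Type*} [NormedAddCommGroup H] [InnerProductSpace ℝ H] [CompleteSpace H]
    [RKHS ℝ H (A × O × Z) ℝ]
    (k : A × O × Z → A × O × Z → ℝ) (hk : k = CGPMW.scalarKernel H)
    (hk_meas : Measurable fun p : (A × O × Z) × (A × O × Z) => k p.1 p.2)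
    (hk_bdd : ∀ x y, k x y ∈ Set.Icc (-1 : ℝ) 1)
    (r : H) (hr_meas : Measurable fun x : A × O × Z => r x)
    (hr_range : ∀ x : A × O × Z, r x ∈ Set.Icc (0 : ℝ) 1)
    (B : ℝ) (hr_norm : ‖r‖ ≤ B)
    -- the horizon, the distribution of the contexts and the opponents
    (T : ℕ) (hT : 0 < T) (ζ : Measure Z) [IsProbabilityMeasure ζ]
    (f : ∀ n : ℕ, (Fin n → A × Z × ℝ) → O) (hf : ∀ n, Measurable (f n))
    -- the noise
    {Ω : Type*} [MeasurableSpace Ω] (P : Measure Ω) [IsProbabilityMeasure P]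
    (ε : Fin T → Ω → ℝ) (hε_meas : ∀ t, Measurable (ε t)) (hε_indep : iIndepFun ε P)
    (sg : ℝ≥0) (hε_subG : ∀ t, HasSubgaussianMGF (ε t) (sg ^ 2) P)
    -- the parameters
    (δ : ℝ) (hδ : δ ∈ Set.Ioo (0 : ℝ) 1) (lam : ℝ) (hlam : 1 ≤ lam)
    (β : ℕ → ℝ) (hβ : β = CGPMW.confidence k lam B sg δ)
    (η : ℕ → ℝ) (hη : ∀ t, η t = √(8 * Real.log (Fintype.card A) / T)) :
    ∃ G : Set Ω, MeasurableSet G ∧ ENNReal.ofReal (1 - δ) ≤ P G ∧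
      ∀ ω ∈ G, ∀ π : Z → A, Measurable π →
        Integrable (fun z : Fin T → Z => CGPMW.meanRegret k lam β η (fun x => r x) f π
          (fun t => ε t ω) z) (Measure.pi fun _ => ζ) ∧
        ∫ z : Fin T → Z, CGPMW.meanRegret k lam β η (fun x => r x) f π (fun t => ε t ω) z
            ∂(Measure.pi fun _ => ζ) ≤
          √(0.5 * T * Real.log (Fintype.card A))
            + 4 * β T * √(CGPMW.infoGain k lam T * lam * T) := by
  -- With T = N + 1 the parameter β_T contains γ_N without truncated subtraction.
  obtain ⟨N, rfl⟩ : ∃ N, T = N + 1 := ⟨T - 1, by omega⟩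
  have hk' : ∀ x y, k x y = inner ℝ (RKHS.kerFun H x (1 : ℝ)) (RKHS.kerFun H y (1 : ℝ)) := by
    intro x y
    have := RKHS.kernel_inner (𝕜 := ℝ) (H := H) x y (1 : ℝ) (1 : ℝ)
    rw [hk, CGPMW.scalarKernel, real_inner_comm, ← this]
    simp
  have hr : ∀ x, r x = inner ℝ r (RKHS.kerFun H x (1 : ℝ)) := by
    intro x
    rw [RKHS.inner_kerFun]
    simp
  have hk1 : ∀ x, k x x ≤ 1 := fun x => (hk_bdd x x).2
  have hδ1 : 1 ≤ 1 / δ := by rw [le_div_iff₀ hδ.1]; linarith [hδ.2]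
  have hexp : Real.exp (Real.log (1 / δ)) = 1 / δ := Real.exp_log (by linarith)
  have hl : 0 ≤ Real.log (1 / δ) := Real.log_nonneg hδ1
  have : Nonempty Z := nonempty_of_isProbabilityMeasure ζ
  have : Nonempty O := ⟨f 0 Fin.elim0⟩
  have hp : CGPMW.IsStrategy (CGPMW.strategy k lam β η (fun x => r x) f) :=
    CGPMW.isStrategy_strategy hk_meas lam β η hr_meas hf
  -- The event is fixed before the policy, so the bound holds for all policies at once.
  obtain ⟨G, hGm, hG, hGω⟩ := CGPMW.exists_noise_event (ζ := ζ) hp hk'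
    (zero_lt_one.trans_le hlam) hk_meas hf hε_meas hε_indep hε_subG hδ
  refine ⟨G, hGm, hG, fun ω hω π hπ => ?_⟩
  obtain ⟨h0, hM⟩ := hGω ω hω
  set e : ℕ → ℝ := CGPMW.extendZero fun t => ε t ω with he
  have heq : (fun t => ε t ω) = fun t : Fin (N + 1) => e t := by
    ext t
    rw [he, CGPMW.extendZero, dif_pos t.isLt]
  have hint := CGPMW.integral_gameLaw (ζ := ζ) hp e (CGPMW.measurable_regret hf hr_meas hπ (N + 1))
    (CGPMW.abs_regret_le hr_range π)
  rw [heq]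
  refine ⟨hint.1, hint.2.trans_le ?_⟩
  refine CGPMW.integral_regret_le hk' hlam hk1 hk_meas hr hr_meas hr_range hr_norm sg.2 hl
    (fun n => by rw [hβ]; rfl) hη hf (fun hs i hi => ?_) (fun m hm => ?_) hπ
  · have := h0 (NNReal.eq hs) ⟨i, hi⟩
    rw [he, CGPMW.extendZero, dif_pos hi, this]
  · rw [hexp]
    exact hM m hm
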